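/- Let $L,\gamma>0$, and let $\dot H^2$ be the space of real $L$-periodic $H^2$ functions of $x$ with zero mean; write $|u|^2=\int_0^L u^2\,dx$, $|u|_{H^2}^2=\int_0^L u_{xx}^2\,dx$, $|u|_\infty=\sup_{[0,L]}|u|$. Let $f\in\dot H^2$ be time independent, and consider the damped and driven KdV equation with period $L$, $$u_t+uu_x+u_{xxx}+\gamma u=f. \qquad (1)$$ Its global attractor $\mathcal A\subset\dot H^2$ is the maximal compact invariant set of its solution operator in $\dot H^2$; a trajectory in $\mathcal A$ is a solution $u\in C(\mathbb R,\dot H^2)$ of (1) with $u(s)\in\mathcal A$ for all $s\in\mathbb R$. Let $R>0$ be such that $\sup_{s\in\mathbb R}|u(s)|_{H^2}\le R$ for every trajectory $u$ in $\mathcal A$, and put $\rho=4R$. Let $P_m$ be the $L^2$-projection onto $H_m=\mathrm{span}\{e^{2\pi ikx/L}:0<|k|\le m\}$. Let $X$ be the space of bounded continuous $v:\mathbb R\to P_m\dot H^2$, with $|v|_X=\sup_s|v(s)|_{H^2}$, let $\mathcal B_X^\rho(0)=\{v\in X:|v|_X<\rho\}$, and let $Y$ be the space of bounded continuous $w:\mathbb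 R\to\dot H^2$. For $v\in\mathcal B_X^\rho(0)$ and $\mu>0$ consider $$w_s+ww_x+w_{xxx}+\gamma w=f-\mu[P_mw-v],\qquad s\in\mathbb R, \qquad (2)$$ with equality in $H^{-1}$. We write $W(v)=w$ if $w$ is the unique solution of (2) in $Y$. Let $c,\varepsilon\ge0$ (the value $\varepsilon=0$ is allowed) and define, as functions of $\mu\ge0$, $$\tilde R_0=\frac{|f|+\gamma^{1/2}\mu^{1/2}\rho}{\gamma},\qquad R_0=\frac{|f|}{\gamma}+\rho+1,$$ $$\tilde{\tilde R}_1^{\,2}=\frac{2((\gamma+\mu)^{4/3}+\gamma^{4/3})}{\gamma^{4/3}}\tilde R_0^{10/3}+\frac2\gamma\Big\{(|f|_\infty+\mu\rho)\tilde R_0^2+2(|f|_{H^2}+\mu\rho)\tilde R_0+c\varepsilon\tilde R_0^6\Big\},$$ $$\tilde R_1^{\,2}=\frac2\gamma\Big\{\Big(\frac{(\gamma+\mu)^{4/3}}{\gamma^{1/3}}+\gamma\Big)R_0^{10/3}+(|f|_\infty+\mu\rho)R_0^2+2(|f|_{H^2}+\mu\rho)R_0+c\varepsilon\tilde R_0^6\Big\},$$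 $$R_1^2=\frac2{\gamma+\mu}\Big\{\Big(\frac{(\gamma+\mu)^{4/3}}{\gamma^{1/3}}+\gamma+\mu\Big)R_0^{10/3}+(|f|_{H^2}+\mu\rho)R_0^2+2(|f|_{H^2}+\mu\rho)R_0+c\varepsilon R_0^6+\mu^{4/3}\Big\},$$ and, for $r\ge0$, $$C_1(r)=3\gamma R_0^{3/2}r^{1/2}+3(|f|_\infty+\mu\rho)R_0+\tfrac92\mu R_0^{3/2}r^{1/2}+\tfrac{18}5(|f|_{H^2}+\mu\rho)+6(|f|_{H^2}+\mu\rho)R_0,$$ $$C_2(r)=\tfrac32R_0^{3/2}r^{1/2}(|f|_{H^2}+\mu\rho)+(|f|_{H^2}+\mu\rho)R_0^{5/2}r^{1/2}+\mu R_0^3r,$$ $$K(r)=\Big(\frac{5}{36\gamma^2}C_1(r)^2+\frac1\gamma C_2(r)+\frac{\varepsilon c R_0^{22/3}}\gamma+\frac{45}{64}R_0^3r\Big)^{1/2},\qquad \tilde R_2=K(\tilde R_1),\quad R_2=K(R_1),$$ $$R_\infty=R_0^{1/2}R_1^{1/2},\qquad R'=\tfrac12R_0^{3/2}R_1^{1/2}+R_2+(\gamma+\mu)R_0+|f|+\mu\rho,\qquad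 C_3=R_1^{1/2}R_2^{1/2}.$$ Let $C_3^0$ be the value of $C_3$ at $\mu=0$ (with the same $\rho$). Assume that $\mu>0$ and the integer $m\ge0$ satisfy $$\frac{\mu L^2}{2\pi^2(m+1)^2}\tilde{\tilde R}_1^{\,2}\le\mu,\qquad \frac{\mu L^2\tilde R_2^2}{4\pi^2(m+1)^2}\le\mu^{4/3},\qquad C_3^0\le\mu,$$ $$\frac{C_3L^2}{8\pi^2(m+1)^2}\,\frac1{\gamma^2}\Big[(2\gamma+2\mu)R_\infty+2R'^4\gamma^{-3}\Big]\le\frac12 .$$ Then: 1. If $u$ is a trajectory in the global attractor $\mathcal A$, then $P_mu\in\mathcal B_X^\rho(0)$, equation (2) with $v=P_mu$ has a unique solution in $Y$, and this solution is $u$; that is, $W(P_mu)(s)=u(s)$ for all $s\in\mathbb R$. 2. If $v\in\mathcal B_X^\rho(0)$, $w\in Y$ is a solution of (2), and $v=P_mw$ (in particular, if $v=P_mW(v)$ with $w=W(v)$), then $w$ is a trajectory in $\mathcal A$. Hence, for $u:\mathbb R\to\dot H^2$, one has $P_mu\in\mathcal B_X^\rho(0)$ and $W(P_mu)=u$ if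 and only if $u$ is a trajectory in $\mathcal A$. -/

import Mathlib

open Set Filter Topology MeasureTheory

namespace DampedKdV

noncomputable section

/-! ### Function spaces on the circle of length `L`

Elements of the periodic Sobolev space of order two with zero mean are represented by their
unique continuous representatives, as `L`-periodic functions `ℝ → ℝ`. -/

/-- The `L²(0, L)` norm `|u|`. -/
def l2Norm (L : ℝ) (u : ℝ → ℝ) : ℝ := Real.sqrt (∫ x in (0 : ℝ)..L, u x ^ 2)

/-- The norm `|u|_{H²} = |u_xx|` on functions with zero mean. -/
def h2Norm (L : ℝ) (u : ℝ → ℝ) : ℝ :=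
  Real.sqrt (∫ x in (0 : ℝ)..L, deriv (deriv u) x ^ 2)

/-- The supremum norm `|u|_∞` over `[0, L]`. -/
def supNorm (L : ℝ) (u : ℝ → ℝ) : ℝ := sSup ((fun x => |u x|) '' Icc 0 L)

/-- `u` belongs to the space of `L`-periodic `H²` functions with zero mean: in one dimension this
says that `u` is `C¹`, that `u_x` is absolutely continuous, and that `u_xx` (which then exists
almost everywhere and is the weak second derivative) is square integrable. -/
structure IsH2dot (L : ℝ) (u : ℝ → ℝ) : Prop where
  periodic : Function.Periodic u L
  mean_zero : ∫ x in (0 : ℝ)..L, u x = 0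
  contDiff : ContDiff ℝ 1 u
  absolutelyContinuous : AbsolutelyContinuousOnInterval (deriv u) 0 L
  memLp : MemLp (deriv (deriv u)) 2 (volume.restrict (Ioc 0 L))

/-- The real functions in the span of `exp (2πikx/L)`, `0 < |k| ≤ m`. -/
def trigSpace (L : ℝ) (m : ℕ) : Submodule ℝ (ℝ → ℝ) :=
  Submodule.span ℝ {e | ∃ k : ℕ, 1 ≤ k ∧ k ≤ m ∧
    (e = (fun x => Real.cos (2 * Real.pi * k * x / L)) ∨
      e = (fun x => Real.sin (2 * Real.pi * k * x / L)))}

/-- The `L²`-orthogonal projection `P_m` onto `trigSpace L m`, through the Fourier coefficients. -/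
def proj (L : ℝ) (m : ℕ) (u : ℝ → ℝ) : ℝ → ℝ := fun x =>
  ∑ k ∈ Finset.Icc 1 m,
    ((2 / L * ∫ y in (0 : ℝ)..L, u y * Real.cos (2 * Real.pi * k * y / L)) *
        Real.cos (2 * Real.pi * k * x / L) +
      (2 / L * ∫ y in (0 : ℝ)..L, u y * Real.sin (2 * Real.pi * k * y / L)) *
        Real.sin (2 * Real.pi * k * x / L))

/-! ### Functions of time with values in these spaces: `u s x`, with `s` the time -/

/-- Continuity on the time set `J` with respect to the `H²` norm. -/
def ContinuousH2On (L : ℝ) (J : Set ℝ) (u : ℝ → ℝ → ℝ) : Prop :=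
  ∀ s ∈ J, Tendsto (fun t => h2Norm L (u t - u s)) (𝓝[J] s) (𝓝 0)

/-- The space `X`: bounded continuous functions of time with values in `P_m H²`. -/
structure IsX (L : ℝ) (m : ℕ) (v : ℝ → ℝ → ℝ) : Prop where
  mem : ∀ s, v s ∈ trigSpace L m
  continuous : ContinuousH2On L univ v
  bounded : BddAbove (range fun s => h2Norm L (v s))

/-- The norm `|v|_X`. -/
def xNorm (L : ℝ) (v : ℝ → ℝ → ℝ) : ℝ := ⨆ s, h2Norm L (v s)

/-- The open ball of radius `ρ` about the origin of `X`. -/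
def InXBall (L : ℝ) (m : ℕ) (ρ : ℝ) (v : ℝ → ℝ → ℝ) : Prop := IsX L m v ∧ xNorm L v < ρ

/-- The space `Y`: bounded continuous functions of time with values in zero-mean `H²`. -/
structure IsY (L : ℝ) (w : ℝ → ℝ → ℝ) : Prop where
  mem : ∀ s, IsH2dot L (w s)
  continuous : ContinuousH2On L univ w
  bounded : BddAbove (range fun s => h2Norm L (w s))

/-! ### The equations -/

/-- `w_s + w w_x + w_xxx + γ w = g` on the time set `J`, tested against smooth periodic functions.
For `w` continuous in time with values in `H²` this is the equation in `H⁻¹`. -/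
def SolvesOn (L γ : ℝ) (g : ℝ → ℝ → ℝ) (J : Set ℝ) (w : ℝ → ℝ → ℝ) : Prop :=
  ∀ φ : ℝ → ℝ, ContDiff ℝ (⊤ : ℕ∞) φ → Function.Periodic φ L → ∀ s ∈ J,
    HasDerivWithinAt (fun t => ∫ x in (0 : ℝ)..L, w t x * φ x)
      (∫ x in (0 : ℝ)..L,
        (w s x ^ 2 / 2 * deriv φ x + w s x * iteratedDeriv 3 φ x
          - γ * w s x * φ x + g s x * φ x)) J s

/-- An `H²` solution, on the time set `J`, of `u_s + u u_x + u_xxx + γ u = f`. -/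
structure IsKdVSolutionOn (L γ : ℝ) (f : ℝ → ℝ) (J : Set ℝ) (u : ℝ → ℝ → ℝ) : Prop where
  mem : ∀ s ∈ J, IsH2dot L (u s)
  continuous : ContinuousH2On L J u
  solves : SolvesOn L γ (fun _ => f) J u

/-- `w ∈ Y` is a bounded solution, for all times, of
`w_s + w w_x + w_xxx + γ w = f - μ (P_m w - v)`. -/
structure IsBoundedSolution (L γ μ : ℝ) (m : ℕ) (f : ℝ → ℝ) (v w : ℝ → ℝ → ℝ) : Prop where
  memY : IsY L w
  solves : SolvesOn L γ (fun s x => f x - μ * (proj L m (w s) x - v s x)) univ w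

/-- `W(v) = w`: the function `w` is the unique bounded solution in `Y` that belongs to `v`. -/
def IsW (L γ μ : ℝ) (m : ℕ) (f : ℝ → ℝ) (v w : ℝ → ℝ → ℝ) : Prop :=
  IsBoundedSolution L γ μ m f v w ∧ ∀ w', IsBoundedSolution L γ μ m f v w' → w' = w

/-! ### The global attractor -/

/-- `S(t) a = b` for the solution operator `S` of the damped and driven equation. -/
def Flow (L γ : ℝ) (f : ℝ → ℝ) (t : ℝ) (a b : ℝ → ℝ) : Prop :=
  ∃ u, IsKdVSolutionOn L γ f (Ici 0) u ∧ u 0 = a ∧ u t = b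

/-- `S(t) A = A` for all `t ≥ 0`. -/
def IsInvariantSet (L γ : ℝ) (f : ℝ → ℝ) (A : Set (ℝ → ℝ)) : Prop :=
  ∀ t, 0 ≤ t → {b | ∃ a ∈ A, Flow L γ f t a b} = A

/-- Compactness in zero-mean `H²` (sequential, the topology being metric). -/
def IsCompactH2 (L : ℝ) (A : Set (ℝ → ℝ)) : Prop :=
  (∀ a ∈ A, IsH2dot L a) ∧
  ∀ a : ℕ → ℝ → ℝ, (∀ n, a n ∈ A) → ∃ b ∈ A, ∃ ψ : ℕ → ℕ, StrictMono ψ ∧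
    Tendsto (fun n => h2Norm L (a (ψ n) - b)) atTop (𝓝 0)

/-- The global attractor, the maximal compact invariant set of the solution operator in `H²`:
the union of all compact invariant sets. -/
def globalAttractor (L γ : ℝ) (f : ℝ → ℝ) : Set (ℝ → ℝ) :=
  ⋃₀ {A | IsCompactH2 L A ∧ IsInvariantSet L γ f A}

/-- `u` is a trajectory in the global attractor: a solution for all times that stays in it. -/
def IsAttractorTrajectory (L γ : ℝ) (f : ℝ → ℝ) (u : ℝ → ℝ → ℝ) : Prop :=
  IsKdVSolutionOn L γ f univ u ∧ ∀ s, u s ∈ globalAttractor L γ f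

/-! ### The bounding expressions -/

/-- The numbers, other than `μ` and `m`, on which the bounding expressions depend:
`fL2 = |f|`, `fInf = |f|_∞`, `fH2 = |f|_{H²}`; `ε` is the parameter of the parabolic
regularization and `c` the constant that goes with it. -/
structure BoundData where
  L : ℝ
  γ : ℝ
  ρ : ℝ
  fL2 : ℝ
  fInf : ℝ
  fH2 : ℝ
  c : ℝ
  ε : ℝ
  α : ℝ
  β : ℝ

namespace BoundData

variable (D : BoundData) (μ : ℝ) (m : ℕ)

/-- `R̃₀` -/
def R0t : ℝ := (D.fL2 + D.γ ^ (1 / 2 : ℝ) * μ ^ (1 / 2 : ℝ) * D.ρ) / D.γ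

/-- `R₁` with two tildes -/
def R1tt : ℝ := Real.sqrt
  (2 * ((D.γ + μ) ^ (4 / 3 : ℝ) + D.γ ^ (4 / 3 : ℝ)) / D.γ ^ (4 / 3 : ℝ)
      * D.R0t μ ^ (10 / 3 : ℝ)
    + 2 / D.γ * ((D.fInf + μ * D.ρ) * D.R0t μ ^ 2 + 2 * (D.fH2 + μ * D.ρ) * D.R0t μ
      + D.c * D.ε * D.R0t μ ^ 6))

/-- `R₀` -/
def R0 : ℝ := D.fL2 / D.γ + D.ρ + μ ^ ((D.α - 1) / 2)

/-- `R̃₁` -/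
def R1t : ℝ := Real.sqrt
  (2 / D.γ * (((D.γ + μ) ^ (4 / 3 : ℝ) / D.γ ^ (1 / 3 : ℝ) + D.γ) * D.R0 μ ^ (10 / 3 : ℝ)
    + (D.fInf + μ * D.ρ) * D.R0 μ ^ 2 + 2 * (D.fH2 + μ * D.ρ) * D.R0 μ
    + D.c * D.ε * D.R0t μ ^ 6))

/-- `C₁` (and `C̃₁`) as a function of the `H¹` bound `r`. -/
def C1 (r : ℝ) : ℝ :=
  3 * D.γ * D.R0 μ ^ (3 / 2 : ℝ) * r ^ (1 / 2 : ℝ) + 3 * (D.fInf + μ * D.ρ) * D.R0 μ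
    + 9 / 2 * μ * D.R0 μ ^ (3 / 2 : ℝ) * r ^ (1 / 2 : ℝ)
    + 18 / 5 * (D.fH2 + μ * D.ρ) + 6 * (D.fH2 + μ * D.ρ) * D.R0 μ

/-- `C₂` (and `C̃₂`) as a function of the `H¹` bound `r`. -/
def C2 (r : ℝ) : ℝ :=
  3 / 2 * D.R0 μ ^ (3 / 2 : ℝ) * r ^ (1 / 2 : ℝ) * (D.fH2 + μ * D.ρ)
    + (D.fH2 + μ * D.ρ) * D.R0 μ ^ (5 / 2 : ℝ) * r ^ (1 / 2 : ℝ)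
    + μ * D.R0 μ ^ 3 * r

/-- The `H²` bound as a function of the `H¹` bound `r`. -/
def R2Of (r : ℝ) : ℝ := Real.sqrt
  (5 / (36 * D.γ ^ 2) * D.C1 μ r ^ 2 + 1 / D.γ * D.C2 μ r
    + D.ε * D.c * D.R0 μ ^ (22 / 3 : ℝ) / D.γ + 45 / 64 * D.R0 μ ^ 3 * r)

/-- `R̃₂` -/
def R2t : ℝ := D.R2Of μ (D.R1t μ)

/-- `R₁` -/
def R1 : ℝ := Real.sqrt
  (2 / (D.γ + μ) * (((D.γ + μ) ^ (4 / 3 : ℝ) / D.γ ^ (1 / 3 : ℝ) + (D.γ + μ))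
      * D.R0 μ ^ (10 / 3 : ℝ))
    + 2 / (D.γ + μ) * ((D.fH2 + μ * D.ρ) * D.R0 μ ^ 2 + (2 * D.fH2 + 2 * μ * D.ρ) * D.R0 μ
      + D.c * D.ε * D.R0 μ ^ 6 + μ ^ D.β))

/-- `R₂` -/
def R2 : ℝ := D.R2Of μ (D.R1 μ)

/-- `R_∞` -/
def Rinf : ℝ := D.R0 μ ^ (1 / 2 : ℝ) * D.R1 μ ^ (1 / 2 : ℝ)

/-- `R'`, the bound for the time derivative -/
def Rprime : ℝ :=
  1 / 2 * D.R0 μ ^ (3 / 2 : ℝ) * D.R1 μ ^ (1 / 2 : ℝ) + D.R2 μ + (D.γ + μ) * D.R0 μ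
    + D.fL2 + μ * D.ρ

/-- `C₃`; its value at `μ = 0` is `C₃⁰`. -/
def C3 : ℝ := D.R1 μ ^ (1 / 2 : ℝ) * D.R2 μ ^ (1 / 2 : ℝ)

/-- `m` is so large that the `L²` bound can be improved. -/
def Condition1 : Prop :=
  μ * D.L ^ 2 / (2 * Real.pi ^ 2 * ((m : ℝ) + 1) ^ 2) * D.R1tt μ ^ 2 ≤ μ ^ D.α

/-- `m` is so large that the `H¹` bound can be improved. -/
def Condition2 : Prop :=
  μ * D.L ^ 2 * D.R2t μ ^ 2 / (4 * Real.pi ^ 2 * ((m : ℝ) + 1) ^ 2) ≤ μ ^ D.β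

/-- `μ` dominates the constant `C₃⁰`. -/
def Condition3' : Prop := D.C3 0 ≤ μ

/-- `m` is so large that the difference of two bounded solutions is controlled. -/
def Condition4 : Prop :=
  D.C3 μ * D.L ^ 2 / (8 * Real.pi ^ 2 * ((m : ℝ) + 1) ^ 2) * (1 / D.γ ^ 2)
      * ((2 * D.γ + 2 * μ) * D.Rinf μ + 2 * D.Rprime μ ^ 4 * D.γ ^ (-3 : ℝ)) ≤ 1 / 2

end BoundData

/-- The data for the forcing `f`, with the exponents `α = 1` and `β = 4/3`. -/
def boundData (L γ ρ c ε : ℝ) (f : ℝ → ℝ) : BoundData where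
  L := L
  γ := γ
  ρ := ρ
  fL2 := l2Norm L f
  fInf := supNorm L f
  fH2 := h2Norm L f
  c := c
  ε := ε
  α := 1
  β := 4 / 3

end

end DampedKdV

open DampedKdV

/-! If `v = P_m w`, the nudging term vanishes and (2) becomes (1). Hence a trajectory `u` in the
attractor solves (2) with `v = P_m u`, and no existence theory for (2) is needed. Two facts remain:
no other bounded solution belongs to `P_m u` (`IsBoundedSolution.eq_of_bound`), and every complete
solution of (1) that is bounded in `H²` lies in the attractor
(`IsKdVSolutionOn.isAttractorTrajectory`).

Both rest on two estimates for the difference `δ` of two complete bounded solutions. In `L²`, the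
only term of the energy law without a good sign is `∫ u_x δ²`. Its low modes are absorbed by the
nudging or estimated separately, and its high modes are a small multiple of `|δ_x|²`
(`KdVPair.sq_le_of_low_modes`). In `H¹`, the Hamiltonian `|δ_x|² - ∫ u δ² - (1/3) ∫ δ³` evolves
without the flux of `δ`, so `|δ_x|` is bounded by terms that carry factors `|δ|` or `|δ|_∞`
(`KdVPair.deriv_sq_le`). Since everything is bounded for all past times, a damped differential
inequality leaves no trace of initial data (`le_of_forall_hasDerivAt_le`).

Uniqueness: with `a = |f|/γ + 4R + 1`, the hypotheses supply `a ≤ μ` and the smallness of `L/(m+1)`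
against powers of `a`, `γ` and `μ`. The two estimates then combine to `sup |δ_x|² ≤ (3/4) sup
|δ_x|²`, so `δ = 0`.

Attractor: the same estimates, without nudging, are applied to `δ = u(· + τ) - u`. Finitely many low
modes are `O(|τ|)` by the equation, and the damping controls the rest, so `u` is Lipschitz in time
with values in `H¹` (`exists_lipschitz_H1`). The equation, solved for `u_xxx`, then gives Fourier
coefficients of size `O(k⁻⁴)`, uniformly over all solutions with a given `H²` bound
(`exists_coef_decay`). This decay is compactness in `H²`. Together with continuous dependence in
`L²` in both time directions it makes the values of complete solutions bounded by `M` a compact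
invariant set.

Solutions have only `H²` regularity, so the energy laws are derived from a weak evolution equation,
by moving test functions and by truncated Fourier series. -/

namespace DampedKdV

/-! ### Square integrable functions on `[0, L]` -/

/-- The `L²(0, L)` inner product. -/
noncomputable def ip (L : ℝ) (f g : ℝ → ℝ) : ℝ := ∫ x in (0 : ℝ)..L, f x * g x

/-- Square integrability on `(0, L]`. -/
abbrev IsL2 (L : ℝ) (f : ℝ → ℝ) : Prop := MemLp f 2 (volume.restrict (Ioc 0 L))

section L2

variable {L : ℝ} {f g h : ℝ → ℝ}

theorem ip_comm (L : ℝ) (f g : ℝ → ℝ) : ip L f g = ip L g f := by simp [ip, mul_comm]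

theorem IsL2.integrable_mul (hL : 0 < L) (hf : IsL2 L f) (hg : IsL2 L g) :
    IntervalIntegrable (fun x => f x * g x) volume 0 L := by
  rw [intervalIntegrable_iff_integrableOn_Ioc_of_le hL.le]
  exact MemLp.integrable_mul hf hg

theorem IsL2.intervalIntegrable (hL : 0 < L) (hf : IsL2 L f) :
    IntervalIntegrable f volume 0 L := by
  rw [intervalIntegrable_iff_integrableOn_Ioc_of_le hL.le]
  exact hf.integrable (by norm_num)

theorem _root_.ContinuousOn.isL2 (hf : ContinuousOn f (Icc 0 L)) : IsL2 L f := by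
  obtain ⟨C, hC⟩ := isCompact_Icc.exists_bound_of_continuousOn hf
  refine MemLp.of_bound ((hf.mono Ioc_subset_Icc_self).aestronglyMeasurable measurableSet_Ioc) C ?_
  filter_upwards [ae_restrict_mem measurableSet_Ioc] with x hx
  exact hC x (Ioc_subset_Icc_self hx)

theorem _root_.Continuous.isL2 (hf : Continuous f) : IsL2 L f := hf.continuousOn.isL2

theorem IsL2.mul_continuous (hg : IsL2 L g) (hf : Continuous f) : IsL2 L (f * g) := by
  obtain ⟨C, hC⟩ := isCompact_Icc.exists_bound_of_continuousOn (hf.continuousOn (s := Icc 0 L))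
  refine MemLp.of_le_mul (c := C) hg
    (hf.aestronglyMeasurable.mul hg.aestronglyMeasurable) ?_
  filter_upwards [ae_restrict_mem measurableSet_Ioc] with x hx
  simp only [Pi.mul_apply, norm_mul]
  exact mul_le_mul_of_nonneg_right (hC x (Ioc_subset_Icc_self hx)) (norm_nonneg _)

theorem ip_add_left (hL : 0 < L) (hf : IsL2 L f) (hg : IsL2 L g) (hh : IsL2 L h) :
    ip L (f + g) h = ip L f h + ip L g h := by
  simp only [ip, Pi.add_apply, add_mul]
  exact intervalIntegral.integral_add (hf.integrable_mul hL hh) (hg.integrable_mul hL hh)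

theorem ip_sub_left (hL : 0 < L) (hf : IsL2 L f) (hg : IsL2 L g) (hh : IsL2 L h) :
    ip L (f - g) h = ip L f h - ip L g h := by
  simp only [ip, Pi.sub_apply, sub_mul]
  exact intervalIntegral.integral_sub (hf.integrable_mul hL hh) (hg.integrable_mul hL hh)

theorem ip_add_right (hL : 0 < L) (hf : IsL2 L f) (hg : IsL2 L g) (hh : IsL2 L h) :
    ip L h (f + g) = ip L h f + ip L h g := by
  rw [ip_comm, ip_add_left hL hf hg hh, ip_comm L f, ip_comm L g]

theorem ip_sub_right (hL : 0 < L) (hf : IsL2 L f) (hg : IsL2 L g) (hh : IsL2 L h) :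
    ip L h (f - g) = ip L h f - ip L h g := by
  rw [ip_comm, ip_sub_left hL hf hg hh, ip_comm L f, ip_comm L g]

theorem ip_smul_left (L c : ℝ) (f g : ℝ → ℝ) : ip L (c • f) g = c * ip L f g := by
  simp only [ip, Pi.smul_apply, smul_eq_mul, mul_assoc]
  exact intervalIntegral.integral_const_mul _ _

theorem ip_smul_right (L c : ℝ) (f g : ℝ → ℝ) : ip L f (c • g) = c * ip L f g := by
  rw [ip_comm, ip_smul_left, ip_comm]

theorem ip_neg_left (L : ℝ) (f g : ℝ → ℝ) : ip L (-f) g = -ip L f g := by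
  simp [ip]

theorem ip_congr_left (hL : 0 < L) (h : f =ᵐ[volume.restrict (Ioc 0 L)] g) (k : ℝ → ℝ) :
    ip L f k = ip L g k := by
  refine intervalIntegral.integral_congr_ae_restrict ?_
  rw [uIoc_of_le hL.le]
  filter_upwards [h] with x hx
  rw [hx]

theorem ip_self_nonneg (hL : 0 < L) (f : ℝ → ℝ) : 0 ≤ ip L f f :=
  intervalIntegral.integral_nonneg hL.le fun x _ => mul_self_nonneg (f x)

theorem l2Norm_eq_sqrt_ip (L : ℝ) (f : ℝ → ℝ) : l2Norm L f = Real.sqrt (ip L f f) := by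
  simp [l2Norm, ip, pow_two]

theorem l2Norm_nonneg (L : ℝ) (f : ℝ → ℝ) : 0 ≤ l2Norm L f := Real.sqrt_nonneg _

theorem l2Norm_sq (hL : 0 < L) (f : ℝ → ℝ) : l2Norm L f ^ 2 = ip L f f := by
  rw [l2Norm_eq_sqrt_ip, Real.sq_sqrt (ip_self_nonneg hL f)]

theorem l2Norm_congr (hL : 0 < L) (h : f =ᵐ[volume.restrict (Ioc 0 L)] g) :
    l2Norm L f = l2Norm L g := by
  rw [l2Norm_eq_sqrt_ip, l2Norm_eq_sqrt_ip, ip_congr_left hL h, ip_comm, ip_congr_left hL h]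

theorem l2Norm_le_of_sq_le {c : ℝ} (hL : 0 < L) (hc : 0 ≤ c) (h : ip L f f ≤ c ^ 2) :
    l2Norm L f ≤ c :=
  (le_abs_self _).trans (abs_le_of_sq_le_sq (by rwa [l2Norm_sq hL]) hc)

theorem ip_smul_add_self (hL : 0 < L) (hf : IsL2 L f) (hg : IsL2 L g) (t : ℝ) :
    ip L (t • f + g) (t • f + g) = ip L f f * (t * t) + 2 * ip L f g * t + ip L g g := by
  have h1 : IsL2 L (t • f) := hf.const_smul t
  rw [ip_add_left hL h1 hg (h1.add hg), ip_add_right hL h1 hg h1, ip_add_right hL h1 hg hg,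
    ip_smul_left, ip_smul_right, ip_smul_left, ip_smul_right, ip_comm L g f]
  ring

/-- The Cauchy-Schwarz inequality. -/
theorem abs_ip_le (hL : 0 < L) (hf : IsL2 L f) (hg : IsL2 L g) :
    |ip L f g| ≤ l2Norm L f * l2Norm L g := by
  have h : discrim (ip L f f) (2 * ip L f g) (ip L g g) ≤ 0 :=
    discrim_le_zero fun t => by
      rw [← ip_smul_add_self hL hf hg]; exact ip_self_nonneg hL _
  rw [discrim, ← l2Norm_sq hL, ← l2Norm_sq hL] at h
  exact abs_le_of_sq_le_sq (by nlinarith) (mul_nonneg (l2Norm_nonneg _ _) (l2Norm_nonneg _ _))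

theorem ip_le (hL : 0 < L) (hf : IsL2 L f) (hg : IsL2 L g) :
    ip L f g ≤ l2Norm L f * l2Norm L g := (le_abs_self _).trans (abs_ip_le hL hf hg)

theorem l2Norm_add_le (hL : 0 < L) (hf : IsL2 L f) (hg : IsL2 L g) :
    l2Norm L (f + g) ≤ l2Norm L f + l2Norm L g := by
  refine l2Norm_le_of_sq_le hL (add_nonneg (l2Norm_nonneg _ _) (l2Norm_nonneg _ _)) ?_
  have := ip_smul_add_self hL hf hg 1
  rw [one_smul] at this
  rw [this]
  nlinarith [ip_le hL hf hg, l2Norm_sq hL f, l2Norm_sq hL g]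

theorem l2Norm_smul (L c : ℝ) (f : ℝ → ℝ) : l2Norm L (c • f) = |c| * l2Norm L f := by
  rw [l2Norm_eq_sqrt_ip, ip_smul_left, ip_smul_right, ← mul_assoc, l2Norm_eq_sqrt_ip,
    Real.sqrt_mul (mul_self_nonneg c), Real.sqrt_mul_self_eq_abs]

theorem l2Norm_neg (L : ℝ) (f : ℝ → ℝ) : l2Norm L (-f) = l2Norm L f := by
  simp [l2Norm]

theorem l2Norm_zero (L : ℝ) : l2Norm L 0 = 0 := by
  simp [l2Norm]

theorem l2Norm_sub_le (hL : 0 < L) (hf : IsL2 L f) (hg : IsL2 L g) :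
    l2Norm L (f - g) ≤ l2Norm L f + l2Norm L g := by
  rw [sub_eq_add_neg, ← l2Norm_neg L g]; exact l2Norm_add_le hL hf hg.neg

theorem l2Norm_sub_comm (L : ℝ) (f g : ℝ → ℝ) : l2Norm L (f - g) = l2Norm L (g - f) := by
  rw [← l2Norm_neg, neg_sub]

theorem abs_l2Norm_sub_le (hL : 0 < L) (hf : IsL2 L f) (hg : IsL2 L g) :
    |l2Norm L f - l2Norm L g| ≤ l2Norm L (f - g) := by
  have h1 := l2Norm_add_le hL (hf.sub hg) hg
  have h2 := l2Norm_add_le hL (hg.sub hf) hf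
  rw [sub_add_cancel] at h1 h2
  rw [l2Norm_sub_comm] at h2
  rw [abs_le]; constructor <;> linarith

theorem l2Norm_mul_le (hL : 0 < L) {B : ℝ} (hg : IsL2 L g) (hfc : Continuous f)
    (hB : ∀ x, |f x| ≤ B) : l2Norm L (f * g) ≤ B * l2Norm L g := by
  have hB0 : 0 ≤ B := (abs_nonneg _).trans (hB 0)
  refine l2Norm_le_of_sq_le hL (mul_nonneg hB0 (l2Norm_nonneg _ _)) ?_
  have h2 : IsL2 L (f * g) := hg.mul_continuous hfc
  rw [mul_pow, l2Norm_sq hL, ip, ip, ← intervalIntegral.integral_const_mul]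
  refine intervalIntegral.integral_mono_on hL.le (h2.integrable_mul hL h2)
    ((hg.integrable_mul hL hg).const_mul _) fun x _ => ?_
  have := sq_le_sq' (abs_le.1 (hB x)).1 (abs_le.1 (hB x)).2
  simp only [Pi.mul_apply]
  nlinarith [mul_le_mul_of_nonneg_right this (mul_self_nonneg (g x))]

variable {ι : Type*} {l : Filter ι}

theorem tendsto_ip (hL : 0 < L) {F G : ι → ℝ → ℝ} (hf : IsL2 L f) (hg : IsL2 L g)
    (hF : ∀ᶠ i in l, IsL2 L (F i)) (hG : ∀ᶠ i in l, IsL2 L (G i))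
    (hFf : Tendsto (fun i => l2Norm L (F i - f)) l (𝓝 0))
    (hGg : Tendsto (fun i => l2Norm L (G i - g)) l (𝓝 0)) :
    Tendsto (fun i => ip L (F i) (G i)) l (𝓝 (ip L f g)) := by
  have key : Tendsto (fun i => l2Norm L (F i - f) * l2Norm L (G i - g)
      + l2Norm L (F i - f) * l2Norm L g + l2Norm L f * l2Norm L (G i - g)) l (𝓝 0) := by
    simpa using ((hFf.mul hGg).add (hFf.mul_const (l2Norm L g))).add (hGg.const_mul (l2Norm L f))
  refine tendsto_iff_dist_tendsto_zero.2 (squeeze_zero' (Eventually.of_forall fun _ => dist_nonneg)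
    ?_ key)
  filter_upwards [hF, hG] with i hFi hGi
  have e : ip L (F i) (G i) - ip L f g
      = ip L (F i - f) (G i - g) + ip L (F i - f) g + ip L f (G i - g) := by
    rw [ip_sub_right hL hGi hg (hFi.sub hf), ip_sub_left hL hFi hf hGi,
      ip_sub_left hL hFi hf hg, ip_sub_right hL hGi hg hf]
    ring
  rw [Real.dist_eq, e]
  refine (abs_add_le _ _).trans (add_le_add ((abs_add_le _ _).trans (add_le_add ?_ ?_)) ?_)
  · exact abs_ip_le hL (hFi.sub hf) (hGi.sub hg)
  · exact abs_ip_le hL (hFi.sub hf) hg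
  · exact abs_ip_le hL hf (hGi.sub hg)

end L2

/-! ### Periodic functions and integration by parts -/

/-- Functions that are absolutely continuous on `[0, L]` with equal boundary values. -/
structure PerAC (L : ℝ) (f : ℝ → ℝ) : Prop where
  ac : AbsolutelyContinuousOnInterval f 0 L
  bdry : f L = f 0

/-- Continuously differentiable `L`-periodic functions. -/
structure PerC1 (L : ℝ) (f : ℝ → ℝ) : Prop where
  contDiff : ContDiff ℝ 1 f
  periodic : Function.Periodic f L

section Per

variable {L : ℝ} {f g : ℝ → ℝ}

theorem PerAC.ip_deriv (hf : PerAC L f) (hg : PerAC L g) :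
    ip L f (deriv g) = -ip L (deriv f) g := by
  have := hf.ac.integral_mul_deriv_eq_deriv_mul hg.ac
  simp only [hf.bdry, hg.bdry] at this
  rw [ip, ip, this]; ring

theorem PerAC.integral_deriv (hf : PerAC L f) : ∫ x in (0 : ℝ)..L, deriv f x = 0 := by
  rw [hf.ac.integral_deriv_eq_sub, hf.bdry, sub_self]

theorem PerC1.perAC (hf : PerC1 L f) : PerAC L f :=
  ⟨hf.contDiff.contDiffOn.absolutelyContinuousOnInterval, by simpa using hf.periodic 0⟩

theorem PerC1.continuous (hf : PerC1 L f) : Continuous f := hf.contDiff.continuous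

theorem PerC1.continuous_deriv (hf : PerC1 L f) : Continuous (deriv f) :=
  hf.contDiff.continuous_deriv le_rfl

theorem PerC1.differentiable (hf : PerC1 L f) : Differentiable ℝ f :=
  hf.contDiff.differentiable (by norm_num)

theorem PerC1.isL2 (hf : PerC1 L f) : IsL2 L f := hf.continuous.isL2

theorem PerC1.deriv_isL2 (hf : PerC1 L f) : IsL2 L (deriv f) := hf.continuous_deriv.isL2

theorem PerC1.add (hf : PerC1 L f) (hg : PerC1 L g) : PerC1 L (f + g) :=
  ⟨hf.contDiff.add hg.contDiff, hf.periodic.add hg.periodic⟩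

theorem PerC1.sub (hf : PerC1 L f) (hg : PerC1 L g) : PerC1 L (f - g) :=
  ⟨hf.contDiff.sub hg.contDiff, hf.periodic.sub hg.periodic⟩

theorem PerC1.mul (hf : PerC1 L f) (hg : PerC1 L g) : PerC1 L (f * g) :=
  ⟨hf.contDiff.mul hg.contDiff, hf.periodic.mul hg.periodic⟩

theorem PerC1.smul (hf : PerC1 L f) (c : ℝ) : PerC1 L (c • f) :=
  ⟨contDiff_const.smul hf.contDiff, hf.periodic.smul c⟩

theorem PerC1.deriv_add (hf : PerC1 L f) (hg : PerC1 L g) :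
    deriv (f + g) = deriv f + deriv g :=
  funext fun x => _root_.deriv_add (hf.differentiable x) (hg.differentiable x)

theorem PerC1.deriv_sub (hf : PerC1 L f) (hg : PerC1 L g) :
    deriv (f - g) = deriv f - deriv g :=
  funext fun x => _root_.deriv_sub (hf.differentiable x) (hg.differentiable x)

theorem PerC1.deriv_mul (hf : PerC1 L f) (hg : PerC1 L g) :
    deriv (f * g) = deriv f * g + f * deriv g :=
  funext fun x => _root_.deriv_mul (hf.differentiable x) (hg.differentiable x)

theorem PerC1.deriv_smul (hf : PerC1 L f) (c : ℝ) : deriv (c • f) = c • deriv f :=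
  funext fun x => deriv_const_smul c (hf.differentiable x)

theorem ip_deriv_self (hf : PerAC L f) : ip L f (deriv f) = 0 := by
  have := hf.ip_deriv hf
  rw [ip_comm L (deriv f)] at this
  linarith

theorem _root_.Function.Periodic.exists_mem_Icc (hL : 0 < L) (hf : Function.Periodic f L) (x : ℝ) :
    ∃ y ∈ Icc 0 L, f x = f y := by
  obtain ⟨y, hy, h⟩ := hf.exists_mem_Ico₀ hL x
  exact ⟨y, ⟨hy.1, hy.2.le⟩, h⟩

/-- A function with vanishing `L²` norm vanishes. -/
theorem eq_zero_of_l2Norm_eq_zero (hL : 0 < L) (hf : PerC1 L f) (h : l2Norm L f = 0) : f = 0 := by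
  have h1 : ∫ x in (0 : ℝ)..L, f x * f x = 0 := by
    have := l2Norm_sq hL f
    rw [h] at this
    simpa [ip] using this.symm
  have hcont : Continuous fun x => f x * f x := hf.continuous.mul hf.continuous
  by_contra hne
  obtain ⟨x, hx⟩ : ∃ x, f x ≠ 0 := by
    by_contra hcon; push Not at hcon; exact hne (funext hcon)
  obtain ⟨y, hy, hxy⟩ := hf.periodic.exists_mem_Icc hL x
  have : 0 < ∫ x in (0 : ℝ)..L, f x * f x :=
    intervalIntegral.integral_pos hL hcont.continuousOn (fun x _ => mul_self_nonneg _)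
      ⟨y, hy, by rw [← hxy]; exact mul_self_pos.2 hx⟩
  linarith

/-- Agmon's inequality for absolutely continuous functions with zero mean. -/
theorem PerAC.sq_le_l2Norm_mul (hL : 0 < L) (hf : PerAC L f) (hfc : Continuous f)
    (hfp : Function.Periodic f L) (hfd : IsL2 L (deriv f)) (h0 : ∫ x in (0 : ℝ)..L, f x = 0) (x : ℝ) :
    f x ^ 2 ≤ l2Norm L f * l2Norm L (deriv f) := by
  obtain ⟨y, hy, hxy⟩ := hfp.exists_mem_Icc hL x
  obtain ⟨z, hz, hz0⟩ : ∃ z ∈ Icc 0 L, f z = 0 := by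
    by_contra hcon
    push Not at hcon
    have hc := hfc.continuousOn (s := Icc 0 L)
    by_cases hpos : 0 < f 0
    · have : ∀ x ∈ Icc 0 L, 0 < f x := fun x hx => by
        by_contra hneg
        obtain ⟨w, hw, hw0⟩ := isPreconnected_Icc.intermediate_value₂ hx
          (left_mem_Icc.2 hL.le) hc continuousOn_const (not_lt.1 hneg) hpos.le
        exact hcon w hw hw0
      exact (intervalIntegral.integral_pos hL hc (fun x hx => (this x (Ioc_subset_Icc_self hx)).le)
        ⟨0, left_mem_Icc.2 hL.le, hpos⟩).ne' h0
    · have : ∀ x ∈ Icc 0 L, f x < 0 := fun x hx => by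
        by_contra hneg
        obtain ⟨w, hw, hw0⟩ := isPreconnected_Icc.intermediate_value₂ (left_mem_Icc.2 hL.le) hx
           hc continuousOn_const (not_lt.1 hpos) (not_lt.1 hneg)
        exact hcon w hw hw0
      have h1 := (intervalIntegral.integral_pos hL hc.neg
        (fun x hx => neg_nonneg.2 (this x (Ioc_subset_Icc_self hx)).le)
        ⟨0, left_mem_Icc.2 hL.le, neg_pos.2 (this 0 (left_mem_Icc.2 hL.le))⟩).ne'
      simp only [Pi.neg_apply] at h1
      rw [intervalIntegral.integral_neg, h0, neg_zero] at h1
      exact h1 rfl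
  have ftc : ∀ a b : ℝ, 0 ≤ a → a ≤ b → b ≤ L →
      ∫ x in a..b, f x * deriv f x = (f b ^ 2 - f a ^ 2) / 2 := fun a b ha hab hb => by
    have hm := hf.ac.mono (c := a) (d := b) (by
      rw [uIcc_of_le hab, uIcc_of_le hL.le]; exact Icc_subset_Icc ha hb)
    have h1 := hm.integral_mul_deriv_eq_deriv_mul hm
    have h2 : ∫ x in a..b, deriv f x * f x = ∫ x in a..b, f x * deriv f x := by
      simp only [mul_comm]
    rw [h2] at h1
    linarith
  have hint : ∀ a b : ℝ, 0 ≤ a → a ≤ b → b ≤ L →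
      IntervalIntegrable (fun x => |f x * deriv f x|) volume a b := fun a b ha hab hb =>
    (hfc.isL2.integrable_mul hL hfd).abs.mono_set (by
      rw [uIcc_of_le hab, uIcc_of_le hL.le]; exact Icc_subset_Icc ha hb)
  -- The increment of `f²` between two points is the same, up to sign, along both arcs of the
  -- circle. Adding the bounds over the two arcs gives the constant one.
  have split : ∀ a b : ℝ, 0 ≤ a → a ≤ b → b ≤ L → |f b ^ 2 - f a ^ 2| ≤
      ∫ x in (0 : ℝ)..L, |f x * deriv f x| := fun a b ha hab hb => by
    have h1 := ftc a b ha hab hb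
    have h2 := ftc 0 a le_rfl ha (hab.trans hb)
    have h3 := ftc b L (ha.trans hab) hb le_rfl
    have e0 : f L = f 0 := hf.bdry
    have i1 := intervalIntegral.abs_integral_le_integral_abs (f := fun x => f x * deriv f x)
      (μ := volume) hab
    have i2 := intervalIntegral.abs_integral_le_integral_abs (f := fun x => f x * deriv f x)
      (μ := volume) ha
    have i3 := intervalIntegral.abs_integral_le_integral_abs (f := fun x => f x * deriv f x)
      (μ := volume) hb
    rw [← intervalIntegral.integral_add_adjacent_intervals 
      (hint 0 a le_rfl ha (hab.trans hb)) (hint a L ha (hab.trans hb) le_rfl),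
      ← intervalIntegral.integral_add_adjacent_intervals 
      (hint a b ha hab hb) (hint b L (ha.trans hab) hb le_rfl)]
    rw [h1] at i1; rw [h2] at i2; rw [h3, e0] at i3
    rw [abs_le] at i1 i2 i3 ⊢
    constructor <;> linarith [i1.1, i1.2, i2.1, i2.2, i3.1, i3.2]
  have hle : f y ^ 2 ≤ ∫ x in (0 : ℝ)..L, |f x * deriv f x| := by
    rcases le_total z y with hzy | hzy
    · have := split z y hz.1 hzy hy.2
      rw [hz0] at this
      have := (le_abs_self _).trans this
      simpa using this
    · have := split y z hy.1 hzy hz.2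
      rw [hz0] at this
      have := (neg_abs_le _).trans' (neg_le_neg this)
      simpa using this
  rw [hxy]
  refine hle.trans ?_
  have habs : ∀ {g : ℝ → ℝ}, l2Norm L (fun x => |g x|) = l2Norm L g := by
    intro g; simp [l2Norm, sq_abs]
  have hcs := ip_le hL (f := fun x => |f x|) (g := fun x => |deriv f x|) hfc.abs.isL2 hfd.abs
  rw [habs, habs] at hcs
  simpa only [ip, ← abs_mul] using hcs

/-- Agmon's inequality for functions with zero mean. -/
theorem sq_le_l2Norm_mul (hL : 0 < L) (hf : PerC1 L f) (h0 : ∫ x in (0 : ℝ)..L, f x = 0) (x : ℝ) :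
    f x ^ 2 ≤ l2Norm L f * l2Norm L (deriv f) :=
  hf.perAC.sq_le_l2Norm_mul hL hf.continuous hf.periodic hf.deriv_isL2 h0 x

end Per

/-! ### Zero-mean `H²` functions -/

section H2

variable {L : ℝ} {u v : ℝ → ℝ}

theorem IsH2dot.perC1 (hu : IsH2dot L u) : PerC1 L u := ⟨hu.contDiff, hu.periodic⟩

theorem _root_.Function.Periodic.deriv' (hu : Function.Periodic u L) :
    Function.Periodic (deriv u) L := fun x => by
  rw [← deriv_comp_add_const]
  congr 1
  exact funext hu

theorem IsH2dot.perAC_deriv (hu : IsH2dot L u) : PerAC L (deriv u) :=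
  ⟨hu.absolutelyContinuous, by simpa using hu.periodic.deriv' 0⟩

theorem IsH2dot.isL2 (hu : IsH2dot L u) : IsL2 L u := hu.perC1.isL2
theorem IsH2dot.deriv_isL2 (hu : IsH2dot L u) : IsL2 L (deriv u) := hu.perC1.deriv_isL2

theorem PerC1.intervalIntegrable (hu : PerC1 L u) (a b : ℝ) : IntervalIntegrable u volume a b :=
  hu.continuous.intervalIntegrable a b

theorem deriv_deriv_lin (hL : 0 < L) (hu : IsH2dot L u) (hv : IsH2dot L v) (c : ℝ) :
    deriv (deriv (u + c • v)) =ᵐ[volume.restrict (Ioc 0 L)]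
      deriv (deriv u) + c • deriv (deriv v) := by
  rw [hu.perC1.deriv_add (hv.perC1.smul c), hv.perC1.deriv_smul, EventuallyEq,
    ae_restrict_iff' measurableSet_Ioc]
  filter_upwards [hu.absolutelyContinuous.ae_differentiableAt,
    hv.absolutelyContinuous.ae_differentiableAt] with x h1 h2 hx
  have hx' : x ∈ uIcc 0 L := by rw [uIcc_of_le hL.le]; exact Ioc_subset_Icc_self hx
  have := _root_.deriv_add (h1 hx') ((h2 hx').const_smul c)
  rw [this, deriv_const_smul c (h2 hx')]; rfl

theorem IsH2dot.add_smul (hL : 0 < L) (hu : IsH2dot L u) (hv : IsH2dot L v) (c : ℝ) :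
    IsH2dot L (u + c • v) where
  periodic := (hu.perC1.add (hv.perC1.smul c)).periodic
  mean_zero := by
    simp only [Pi.add_apply, Pi.smul_apply, smul_eq_mul]
    rw [intervalIntegral.integral_add (hu.perC1.intervalIntegrable _ _)
      ((hv.perC1.intervalIntegrable _ _).const_mul c), intervalIntegral.integral_const_mul,
      hu.mean_zero, hv.mean_zero]
    simp
  contDiff := (hu.perC1.add (hv.perC1.smul c)).contDiff
  absolutelyContinuous := by
    rw [hu.perC1.deriv_add (hv.perC1.smul c), hv.perC1.deriv_smul]
    exact hu.absolutelyContinuous.add (hv.absolutelyContinuous.const_mul c)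
  memLp := (hu.memLp.add (hv.memLp.const_smul c)).ae_eq (deriv_deriv_lin hL hu hv c).symm

theorem IsH2dot.sub (hL : 0 < L) (hu : IsH2dot L u) (hv : IsH2dot L v) : IsH2dot L (u - v) := by
  simpa [sub_eq_add_neg] using hu.add_smul hL hv (-1)

theorem deriv_deriv_sub (hL : 0 < L) (hu : IsH2dot L u) (hv : IsH2dot L v) :
    deriv (deriv (u - v)) =ᵐ[volume.restrict (Ioc 0 L)] deriv (deriv u) - deriv (deriv v) := by
  simpa [sub_eq_add_neg] using deriv_deriv_lin hL hu hv (-1)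

theorem h2Norm_eq (L : ℝ) (u : ℝ → ℝ) : h2Norm L u = l2Norm L (deriv (deriv u)) := rfl

theorem h2Norm_nonneg (L : ℝ) (u : ℝ → ℝ) : 0 ≤ h2Norm L u := l2Norm_nonneg _ _

theorem h2Norm_sub (hL : 0 < L) (hu : IsH2dot L u) (hv : IsH2dot L v) :
    h2Norm L (u - v) = l2Norm L (deriv (deriv u) - deriv (deriv v)) :=
  l2Norm_congr hL (deriv_deriv_sub hL hu hv)

theorem h2Norm_sub_le (hL : 0 < L) (hu : IsH2dot L u) (hv : IsH2dot L v) :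
    h2Norm L (u - v) ≤ h2Norm L u + h2Norm L v := by
  rw [h2Norm_sub hL hu hv]; exact l2Norm_sub_le hL hu.memLp hv.memLp

theorem abs_h2Norm_sub_le (hL : 0 < L) (hu : IsH2dot L u) (hv : IsH2dot L v) :
    |h2Norm L u - h2Norm L v| ≤ h2Norm L (u - v) := by
  rw [h2Norm_sub hL hu hv]; exact abs_l2Norm_sub_le hL hu.memLp hv.memLp

/-- The interpolation inequality `|u_x|² ≤ |u| |u_xx|`. -/
theorem IsH2dot.l2Norm_deriv_sq_le (hL : 0 < L) (hu : IsH2dot L u) :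
    l2Norm L (deriv u) ^ 2 ≤ l2Norm L u * h2Norm L u := by
  rw [l2Norm_sq hL, ip_comm, ← neg_neg (ip L _ _), ← ip_comm,
    ← (hu.perC1.perAC.ip_deriv hu.perAC_deriv)]
  exact (neg_le_abs _).trans (abs_ip_le hL hu.isL2 hu.memLp)

/-- Agmon's inequality for `u_x`, which is absolutely continuous but need not be `C¹`. This is why
`PerAC` is kept apart from `PerC1`. -/
theorem IsH2dot.deriv_sq_le (hL : 0 < L) (hu : IsH2dot L u) (x : ℝ) :
    deriv u x ^ 2 ≤ l2Norm L (deriv u) * h2Norm L u :=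
  hu.perAC_deriv.sq_le_l2Norm_mul hL hu.perC1.continuous_deriv hu.periodic.deriv' hu.memLp
    hu.perC1.perAC.integral_deriv x

theorem IsH2dot.integral_deriv (hu : IsH2dot L u) : ∫ x in (0 : ℝ)..L, deriv u x = 0 :=
  hu.perC1.perAC.integral_deriv

end H2

/-! ### Real Fourier coefficients -/

/-- The wave number `2πk/L`. -/
noncomputable def waveNum (L : ℝ) (k : ℕ) : ℝ := 2 * Real.pi * k / L

/-- The `k`-th cosine mode. -/
noncomputable def cosMode (L : ℝ) (k : ℕ) : ℝ → ℝ := fun x => Real.cos (2 * Real.pi * k * x / L)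

/-- The `k`-th sine mode. -/
noncomputable def sinMode (L : ℝ) (k : ℕ) : ℝ → ℝ := fun x => Real.sin (2 * Real.pi * k * x / L)

/-- The cosine coefficient `∫ g cos`. -/
noncomputable def cosCoef (L : ℝ) (k : ℕ) (g : ℝ → ℝ) : ℝ := ip L g (cosMode L k)

/-- The sine coefficient `∫ g sin`. -/
noncomputable def sinCoef (L : ℝ) (k : ℕ) (g : ℝ → ℝ) : ℝ := ip L g (sinMode L k)

section Fourier

variable {L : ℝ} {f g : ℝ → ℝ}

theorem waveNum_nonneg (hL : 0 < L) (k : ℕ) : 0 ≤ waveNum L k := by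
  unfold waveNum; positivity

theorem waveNum_pos (hL : 0 < L) {k : ℕ} (hk : 1 ≤ k) : 0 < waveNum L k := by
  have : (0 : ℝ) < k := by exact_mod_cast hk
  unfold waveNum; positivity

theorem waveNum_mono (hL : 0 < L) {j k : ℕ} (h : j ≤ k) : waveNum L j ≤ waveNum L k := by
  unfold waveNum; gcongr

theorem hasDerivAt_arg (L : ℝ) (k : ℕ) (x : ℝ) :
    HasDerivAt (fun x : ℝ => 2 * Real.pi * k * x / L) (waveNum L k) x := by
  have := ((hasDerivAt_id x).const_mul (2 * Real.pi * k)).div_const L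
  simpa [waveNum] using this

theorem hasDerivAt_cosMode (L : ℝ) (k : ℕ) (x : ℝ) :
    HasDerivAt (cosMode L k) (-(waveNum L k) * sinMode L k x) x := by
  refine ((hasDerivAt_arg L k x).cos).congr_deriv ?_
  simp [sinMode]; ring

theorem hasDerivAt_sinMode (L : ℝ) (k : ℕ) (x : ℝ) :
    HasDerivAt (sinMode L k) (waveNum L k * cosMode L k x) x := by
  refine ((hasDerivAt_arg L k x).sin).congr_deriv ?_
  simp [cosMode]; ring

theorem deriv_cosMode (L : ℝ) (k : ℕ) : deriv (cosMode L k) = -(waveNum L k) • sinMode L k :=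
  funext fun x => (hasDerivAt_cosMode L k x).deriv

theorem deriv_sinMode (L : ℝ) (k : ℕ) : deriv (sinMode L k) = waveNum L k • cosMode L k :=
  funext fun x => (hasDerivAt_sinMode L k x).deriv

theorem contDiff_cosMode (L : ℝ) (k : ℕ) {n : WithTop ℕ∞} : ContDiff ℝ n (cosMode L k) :=
  Real.contDiff_cos.comp ((contDiff_const.mul contDiff_id).div_const _)

theorem contDiff_sinMode (L : ℝ) (k : ℕ) {n : WithTop ℕ∞} : ContDiff ℝ n (sinMode L k) :=
  Real.contDiff_sin.comp ((contDiff_const.mul contDiff_id).div_const _)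

theorem periodic_cosMode (hL : 0 < L) (k : ℕ) : Function.Periodic (cosMode L k) L := fun x => by
  have : 2 * Real.pi * k * (x + L) / L = 2 * Real.pi * k * x / L + k * (2 * Real.pi) := by
    field_simp
  simp only [cosMode, this, Real.cos_add_nat_mul_two_pi]

theorem periodic_sinMode (hL : 0 < L) (k : ℕ) : Function.Periodic (sinMode L k) L := fun x => by
  have : 2 * Real.pi * k * (x + L) / L = 2 * Real.pi * k * x / L + k * (2 * Real.pi) := by
    field_simp
  simp only [sinMode, this, Real.sin_add_nat_mul_two_pi]

theorem perC1_cosMode (hL : 0 < L) (k : ℕ) : PerC1 L (cosMode L k) :=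
  ⟨contDiff_cosMode L k, periodic_cosMode hL k⟩

theorem perC1_sinMode (hL : 0 < L) (k : ℕ) : PerC1 L (sinMode L k) :=
  ⟨contDiff_sinMode L k, periodic_sinMode hL k⟩

theorem isL2_cosMode (L : ℝ) (k : ℕ) : IsL2 L (cosMode L k) :=
  (contDiff_cosMode L k (n := 0)).continuous.isL2

theorem isL2_sinMode (L : ℝ) (k : ℕ) : IsL2 L (sinMode L k) :=
  (contDiff_sinMode L k (n := 0)).continuous.isL2

theorem cosCoef_deriv (hL : 0 < L) (hf : PerAC L f) (k : ℕ) :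
    cosCoef L k (deriv f) = waveNum L k * sinCoef L k f := by
  have := hf.ip_deriv (perC1_cosMode hL k).perAC
  rw [deriv_cosMode, ip_smul_right] at this
  rw [cosCoef, sinCoef]; linarith

theorem sinCoef_deriv (hL : 0 < L) (hf : PerAC L f) (k : ℕ) :
    sinCoef L k (deriv f) = -(waveNum L k * cosCoef L k f) := by
  have := hf.ip_deriv (perC1_sinMode hL k).perAC
  rw [deriv_sinMode, ip_smul_right] at this
  rw [cosCoef, sinCoef]; linarith

theorem cosCoef_add (hL : 0 < L) (hf : IsL2 L f) (hg : IsL2 L g) (k : ℕ) :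
    cosCoef L k (f + g) = cosCoef L k f + cosCoef L k g := ip_add_left hL hf hg (isL2_cosMode L k)

theorem sinCoef_add (hL : 0 < L) (hf : IsL2 L f) (hg : IsL2 L g) (k : ℕ) :
    sinCoef L k (f + g) = sinCoef L k f + sinCoef L k g := ip_add_left hL hf hg (isL2_sinMode L k)

theorem cosCoef_sub (hL : 0 < L) (hf : IsL2 L f) (hg : IsL2 L g) (k : ℕ) :
    cosCoef L k (f - g) = cosCoef L k f - cosCoef L k g := ip_sub_left hL hf hg (isL2_cosMode L k)

theorem sinCoef_sub (hL : 0 < L) (hf : IsL2 L f) (hg : IsL2 L g) (k : ℕ) :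
    sinCoef L k (f - g) = sinCoef L k f - sinCoef L k g := ip_sub_left hL hf hg (isL2_sinMode L k)

theorem intervalIntegral_ofReal {a b : ℝ} (hf : IntervalIntegrable f volume a b) :
    IntervalIntegrable (fun x => (f x : ℂ)) volume a b := ⟨hf.1.ofReal, hf.2.ofReal⟩

/-- By Euler's formula, with the sign `σ` covering the frequencies `k` and `-k` at once: a real
function has coefficients of equal modulus there. -/
theorem fourierCoeffOn_ofReal (hL : 0 < L) (hf : IsL2 L f) (n : ℤ) (k : ℕ) (hn : n = k ∨ n = -k) :
    ‖fourierCoeffOn hL (fun x => (f x : ℂ)) n‖ ^ 2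
      = (1 / L) ^ 2 * (cosCoef L k f ^ 2 + sinCoef L k f ^ 2) := by
  have key : ∀ σ : ℝ, (n : ℝ) = σ * k → σ ^ 2 = 1 →
      fourierCoeffOn hL (fun x => (f x : ℂ)) n
        = ((1 / L * cosCoef L k f : ℝ) : ℂ) + ((-σ * (1 / L) * sinCoef L k f : ℝ) : ℂ) * Complex.I := by
    intro σ hσ hσ2
    have hσ' : σ = 1 ∨ σ = -1 := by simpa using hσ2
    rw [fourierCoeffOn_eq_integral]
    have e : ∀ x : ℝ, fourier (-n) (x : AddCircle (L - 0)) • (f x : ℂ)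
        = ((f x * cosMode L k x : ℝ) : ℂ) + ((-σ * (f x * sinMode L k x) : ℝ) : ℂ) * Complex.I := by
      intro x
      rw [fourier_coe_apply]
      have e1 : 2 * (Real.pi : ℂ) * Complex.I * ((-n : ℤ) : ℂ) * x / ((L - 0 : ℝ) : ℂ)
          = ((-σ * (2 * Real.pi * k * x / L) : ℝ) : ℂ) * Complex.I := by
        have : ((n : ℤ) : ℂ) = ((σ * k : ℝ) : ℂ) := by rw [← hσ]; simp
        rw [Int.cast_neg, this]; push_cast
        simp only [sub_zero]; ring
      rw [e1, Complex.exp_mul_I, ← Complex.ofReal_cos, ← Complex.ofReal_sin]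
      have c1 : Real.cos (-σ * (2 * Real.pi * k * x / L)) = cosMode L k x := by
        rcases hσ' with h | h <;> simp [h, cosMode]
      have c2 : Real.sin (-σ * (2 * Real.pi * k * x / L)) = -σ * sinMode L k x := by
        rcases hσ' with h | h <;> simp [h, sinMode]
      rw [c1, c2, smul_eq_mul]; push_cast; ring
    simp_rw [e]
    have i1 := hf.integrable_mul hL (isL2_cosMode L k)
    have i2 := (hf.integrable_mul hL (isL2_sinMode L k)).const_mul (-σ)
    rw [intervalIntegral.integral_add (intervalIntegral_ofReal i1)
      ((intervalIntegral_ofReal i2).mul_const _),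
      intervalIntegral.integral_mul_const, intervalIntegral.integral_ofReal,
      intervalIntegral.integral_ofReal, intervalIntegral.integral_const_mul]
    simp only [cosCoef, sinCoef, ip, sub_zero, Complex.real_smul]
    push_cast; ring
  have fin : ∀ σ : ℝ, (n : ℝ) = σ * k → σ ^ 2 = 1 → ‖fourierCoeffOn hL (fun x => (f x : ℂ)) n‖ ^ 2
      = (1 / L) ^ 2 * (cosCoef L k f ^ 2 + sinCoef L k f ^ 2) := by
    intro σ h1 h2
    rw [key σ h1 h2, ← Complex.normSq_eq_norm_sq, Complex.normSq_add_mul_I]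
    linear_combination ((1 / L) ^ 2 * sinCoef L k f ^ 2) * h2
  rcases hn with h | h
  · exact fin 1 (by simp [h]) (by norm_num)
  · exact fin (-1) (by simp [h]) (by norm_num)

theorem cosMode_zero (L : ℝ) : cosMode L 0 = fun _ => 1 := by funext x; simp [cosMode]

theorem sinMode_zero (L : ℝ) : sinMode L 0 = fun _ => 0 := by funext x; simp [sinMode]

/-- Parseval's identity. -/
theorem hasSum_sq_coef (hL : 0 < L) (hf : IsL2 L f) :
    HasSum (fun k : ℕ => 2 / L * (cosCoef L (k + 1) f ^ 2 + sinCoef L (k + 1) f ^ 2))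
      (ip L f f - 1 / L * (∫ x in (0 : ℝ)..L, f x) ^ 2) := by
  have h0 := hasSum_sq_fourierCoeffOn hL (f := fun x => (f x : ℂ)) hf.ofReal
  have h1 := h0.nat_add_neg
  have e : ∀ n : ℕ, ‖fourierCoeffOn hL (fun x => (f x : ℂ)) n‖ ^ 2
      + ‖fourierCoeffOn hL (fun x => (f x : ℂ)) (-n : ℤ)‖ ^ 2
      = 2 * (1 / L) ^ 2 * (cosCoef L n f ^ 2 + sinCoef L n f ^ 2) := fun n => by
    rw [fourierCoeffOn_ofReal hL hf n n (Or.inl rfl),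
      fourierCoeffOn_ofReal hL hf (-n : ℤ) n (Or.inr rfl)]; ring
  simp_rw [e] at h1
  rw [fourierCoeffOn_ofReal hL hf 0 0 (Or.inl rfl)] at h1
  -- Pairing `n` with `-n` counts frequency zero once too often; removing the index zero leaves
  -- minus one copy of it, which is the term with the mean.
  have h2 := (hasSum_nat_add_iff' 1).2 h1
  have h3 := h2.mul_left L
  have e0 : cosCoef L 0 f = ∫ x in (0 : ℝ)..L, f x := by simp [cosCoef, ip, cosMode_zero]
  have e1 : sinCoef L 0 f = 0 := by simp [sinCoef, ip, sinMode_zero]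
  have e2 : ∫ x in (0 : ℝ)..L, ‖(f x : ℂ)‖ ^ 2 = ip L f f := by
    simp [ip, pow_two]
  rw [e2, Finset.sum_range_one, e0, e1] at h3
  convert! h3 using 1
  · funext k; field_simp
  · simp only [sub_zero, smul_eq_mul]; field_simp; ring

theorem integral_add_isL2 (hL : 0 < L) (hf : IsL2 L f) (hg : IsL2 L g) :
    ∫ x in (0 : ℝ)..L, (f + g) x = (∫ x in (0 : ℝ)..L, f x) + ∫ x in (0 : ℝ)..L, g x :=
  intervalIntegral.integral_add (hf.intervalIntegrable hL) (hg.intervalIntegrable hL)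

theorem integral_sub_isL2 (hL : 0 < L) (hf : IsL2 L f) (hg : IsL2 L g) :
    ∫ x in (0 : ℝ)..L, (f - g) x = (∫ x in (0 : ℝ)..L, f x) - ∫ x in (0 : ℝ)..L, g x :=
  intervalIntegral.integral_sub (hf.intervalIntegrable hL) (hg.intervalIntegrable hL)

/-- Parseval's identity for the inner product with a function of zero mean. -/
theorem hasSum_mul_coef (hL : 0 < L) (hf : IsL2 L f) (hg : IsL2 L g)
    (h0 : ∫ x in (0 : ℝ)..L, f x = 0) :
    HasSum (fun k : ℕ => 2 / L * (cosCoef L (k + 1) f * cosCoef L (k + 1) g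
      + sinCoef L (k + 1) f * sinCoef L (k + 1) g)) (ip L f g) := by
  -- Polarization. As `f` has zero mean, the squared means of `f + g` and `f - g` agree and cancel.
  have h1 := hasSum_sq_coef hL (hf.add hg)
  have h2 := hasSum_sq_coef hL (hf.sub hg)
  have h3 := (h1.sub h2).mul_left (1 / 4)
  convert! h3 using 1
  · funext k
    rw [cosCoef_add hL hf hg, sinCoef_add hL hf hg, cosCoef_sub hL hf hg, sinCoef_sub hL hf hg]
    ring
  · rw [integral_add_isL2 hL hf hg, integral_sub_isL2 hL hf hg, h0,
      ip_add_left hL hf hg (hf.add hg), ip_sub_left hL hf hg (hf.sub hg),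
      ip_add_right hL hf hg hf, ip_add_right hL hf hg hg, ip_sub_right hL hf hg hf,
      ip_sub_right hL hf hg hg, ip_comm L g f]
    ring

theorem hasSum_sq_coef_of_mean_zero (hL : 0 < L) (hf : IsL2 L f)
    (h0 : ∫ x in (0 : ℝ)..L, f x = 0) :
    HasSum (fun k : ℕ => 2 / L * (cosCoef L (k + 1) f ^ 2 + sinCoef L (k + 1) f ^ 2))
      (ip L f f) := by
  simpa [h0] using hasSum_sq_coef hL hf

/-- Bessel's inequality. -/
theorem sum_sq_coef_le (hL : 0 < L) (hf : IsL2 L f) (N : ℕ) :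
    ∑ k ∈ Finset.range N, 2 / L * (cosCoef L (k + 1) f ^ 2 + sinCoef L (k + 1) f ^ 2)
      ≤ ip L f f := by
  refine (sum_le_hasSum _ (fun k _ => by positivity) (hasSum_sq_coef hL hf)).trans ?_
  have : 0 ≤ 1 / L * (∫ x in (0 : ℝ)..L, f x) ^ 2 := by positivity
  linarith

/-- The bound does not depend on `N`: it supplies the majorant when truncated energy laws are
integrated in time and `N → ∞`. -/
theorem abs_sum_mul_coef_le (hL : 0 < L) (hf : IsL2 L f) (hg : IsL2 L g) (N : ℕ) :
    |∑ k ∈ Finset.range N, 2 / L * (cosCoef L (k + 1) f * cosCoef L (k + 1) g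
      + sinCoef L (k + 1) f * sinCoef L (k + 1) g)| ≤ (ip L f f + ip L g g) / 2 := by
  refine (Finset.abs_sum_le_sum_abs _ _).trans ?_
  have h1 := sum_sq_coef_le hL hf N
  have h2 := sum_sq_coef_le hL hg N
  refine le_trans (Finset.sum_le_sum (g := fun k => (2 / L * (cosCoef L (k + 1) f ^ 2
    + sinCoef L (k + 1) f ^ 2) + 2 / L * (cosCoef L (k + 1) g ^ 2 + sinCoef L (k + 1) g ^ 2)) / 2)
    fun k _ => ?_) ?_
  · have hL' : 0 < 2 / L := by positivity
    rw [abs_mul, abs_of_pos hL', ← mul_add, mul_div_assoc]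
    refine mul_le_mul_of_nonneg_left ?_ hL'.le
    rw [abs_le]
    constructor <;> nlinarith [sq_nonneg (cosCoef L (k + 1) f - cosCoef L (k + 1) g),
      sq_nonneg (sinCoef L (k + 1) f - sinCoef L (k + 1) g),
      sq_nonneg (cosCoef L (k + 1) f + cosCoef L (k + 1) g),
      sq_nonneg (sinCoef L (k + 1) f + sinCoef L (k + 1) g)]
  · rw [← Finset.sum_div, Finset.sum_add_distrib]; linarith

/-! ### The projection `P_m` -/

theorem sum_Icc_eq_sum_range (F : ℕ → ℝ) (m : ℕ) :
    ∑ k ∈ Finset.Icc 1 m, F k = ∑ k ∈ Finset.range m, F (k + 1) := by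
  rw [Finset.range_eq_Ico, Finset.sum_Ico_add' F 0 m 1]
  rfl

theorem proj_eq (L : ℝ) (m : ℕ) (g : ℝ → ℝ) :
    proj L m g = ∑ k ∈ Finset.range m, ((2 / L * cosCoef L (k + 1) g) • cosMode L (k + 1)
      + (2 / L * sinCoef L (k + 1) g) • sinMode L (k + 1)) := by
  funext x
  rw [proj, sum_Icc_eq_sum_range fun k : ℕ =>
    ((2 / L * ∫ y in (0 : ℝ)..L, g y * Real.cos (2 * Real.pi * k * y / L)) *
        Real.cos (2 * Real.pi * k * x / L) +
      (2 / L * ∫ y in (0 : ℝ)..L, g y * Real.sin (2 * Real.pi * k * y / L)) *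
        Real.sin (2 * Real.pi * k * x / L))]
  simp [cosCoef, sinCoef, ip, cosMode, sinMode, Finset.sum_apply]

theorem contDiff_proj (L : ℝ) (m : ℕ) (g : ℝ → ℝ) {n : WithTop ℕ∞} :
    ContDiff ℝ n (proj L m g) := by
  rw [proj_eq]
  induction m with
  | zero => simpa using! (contDiff_const (c := (0 : ℝ)) : ContDiff ℝ n fun _ : ℝ => (0 : ℝ))
  | succ m ih =>
    rw [Finset.sum_range_succ]
    exact ih.add ((contDiff_const.smul (contDiff_cosMode L _)).add
      (contDiff_const.smul (contDiff_sinMode L _)))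

theorem periodic_proj (hL : 0 < L) (m : ℕ) (g : ℝ → ℝ) : Function.Periodic (proj L m g) L := by
  rw [proj_eq]
  induction m with
  | zero => intro x; simp
  | succ m ih =>
    rw [Finset.sum_range_succ]
    exact ih.add (((periodic_cosMode hL _).smul _).add ((periodic_sinMode hL _).smul _))

theorem perC1_proj (hL : 0 < L) (m : ℕ) (g : ℝ → ℝ) : PerC1 L (proj L m g) :=
  ⟨contDiff_proj L m g, periodic_proj hL m g⟩

theorem isL2_proj (L : ℝ) (m : ℕ) (g : ℝ → ℝ) : IsL2 L (proj L m g) :=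
  (contDiff_proj L m g (n := 0)).continuous.isL2

theorem proj_sub (hL : 0 < L) (hf : IsL2 L f) (hg : IsL2 L g) (m : ℕ) :
    proj L m (f - g) = proj L m f - proj L m g := by
  rw [proj_eq, proj_eq, proj_eq, ← Finset.sum_sub_distrib]
  refine Finset.sum_congr rfl fun k _ => ?_
  rw [cosCoef_sub hL hf hg, sinCoef_sub hL hf hg]
  funext x
  simp only [Pi.add_apply, Pi.sub_apply, Pi.smul_apply, smul_eq_mul]; ring

theorem deriv_proj (hL : 0 < L) (hf : PerAC L f) (m : ℕ) :
    deriv (proj L m f) = proj L m (deriv f) := by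
  induction m with
  | zero => rw [proj_eq, proj_eq]; funext x; simp
  | succ m ih =>
    have step : ∀ g, proj L (m + 1) g = proj L m g + ((2 / L * cosCoef L (m + 1) g)
        • cosMode L (m + 1) + (2 / L * sinCoef L (m + 1) g) • sinMode L (m + 1)) := fun g => by
      rw [proj_eq, proj_eq, Finset.sum_range_succ]
    rw [step, step, (perC1_proj hL m f).deriv_add (((perC1_cosMode hL _).smul _).add
      ((perC1_sinMode hL _).smul _)), ((perC1_cosMode hL _).smul _).deriv_add
      ((perC1_sinMode hL _).smul _), (perC1_cosMode hL _).deriv_smul, (perC1_sinMode hL _).deriv_smul,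
      ih, deriv_cosMode, deriv_sinMode, cosCoef_deriv hL hf, sinCoef_deriv hL hf]
    funext x
    simp only [Pi.add_apply, Pi.smul_apply, smul_eq_mul]; ring

theorem ip_proj_right (hL : 0 < L) (hf : IsL2 L f) (g : ℝ → ℝ) (m : ℕ) :
    ip L f (proj L m g) = ∑ k ∈ Finset.range m, 2 / L * (cosCoef L (k + 1) f * cosCoef L (k + 1) g
      + sinCoef L (k + 1) f * sinCoef L (k + 1) g) := by
  induction m with
  | zero => rw [proj_eq]; simp [ip]
  | succ m ih =>
    have step : proj L (m + 1) g = proj L m g + ((2 / L * cosCoef L (m + 1) g)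
        • cosMode L (m + 1) + (2 / L * sinCoef L (m + 1) g) • sinMode L (m + 1)) := by
      rw [proj_eq, proj_eq, Finset.sum_range_succ]
    rw [step, ip_add_right hL (isL2_proj _ _ _) (((isL2_cosMode _ _).const_smul _).add
      ((isL2_sinMode _ _).const_smul _)) hf, ip_add_right hL ((isL2_cosMode _ _).const_smul _)
      ((isL2_sinMode _ _).const_smul _) hf, ih, Finset.sum_range_succ, ip_smul_right,
      ip_smul_right, ← cosCoef, ← sinCoef]
    ring

theorem integral_cos_nat_mul (hL : 0 < L) {n : ℤ} (hn : n ≠ 0) :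
    ∫ x in (0 : ℝ)..L, Real.cos (2 * Real.pi * n * x / L) = 0 := by
  have hn' : (n : ℝ) ≠ 0 := by exact_mod_cast hn
  have hc : 2 * Real.pi * n / L ≠ 0 := by
    have := Real.pi_ne_zero; positivity
  have e : ∀ x : ℝ, 2 * Real.pi * n * x / L = (2 * Real.pi * n / L) * x := fun x => by ring
  simp_rw [e]
  rw [intervalIntegral.integral_comp_mul_left (fun x => Real.cos x) hc, integral_cos]
  have : 2 * Real.pi * n / L * L = n * (2 * Real.pi) := by field_simp
  rw [this]
  have := Real.sin_periodic.int_mul n 0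
  simp only [zero_add] at this
  simp [this]

theorem integral_sin_nat_mul (hL : 0 < L) (n : ℤ) :
    ∫ x in (0 : ℝ)..L, Real.sin (2 * Real.pi * n * x / L) = 0 := by
  by_cases hn : n = 0
  · simp [hn]
  have hn' : (n : ℝ) ≠ 0 := by exact_mod_cast hn
  have hc : 2 * Real.pi * n / L ≠ 0 := by
    have := Real.pi_ne_zero; positivity
  have e : ∀ x : ℝ, 2 * Real.pi * n * x / L = (2 * Real.pi * n / L) * x := fun x => by ring
  simp_rw [e]
  rw [intervalIntegral.integral_comp_mul_left (fun x => Real.sin x) hc, integral_sin]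
  have : 2 * Real.pi * n / L * L = n * (2 * Real.pi) := by field_simp
  rw [this, Real.cos_int_mul_two_pi]
  simp

theorem integral_cosMode (hL : 0 < L) {k : ℕ} (hk : 1 ≤ k) :
    ∫ x in (0 : ℝ)..L, cosMode L k x = 0 := by
  simpa using! integral_cos_nat_mul hL (n := k) (by omega)

theorem integral_sinMode (hL : 0 < L) (k : ℕ) : ∫ x in (0 : ℝ)..L, sinMode L k x = 0 := by
  simpa using! integral_sin_nat_mul hL k

theorem cont_cos_int (L : ℝ) (n : ℤ) : Continuous fun x : ℝ => Real.cos (2 * Real.pi * n * x / L) := by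
  fun_prop

theorem cont_sin_int (L : ℝ) (n : ℤ) : Continuous fun x : ℝ => Real.sin (2 * Real.pi * n * x / L) := by
  fun_prop

theorem cosCoef_cosMode (hL : 0 < L) {j k : ℕ} (hk : 1 ≤ k) :
    cosCoef L j (cosMode L k) = if j = k then L / 2 else 0 := by
  have e : ∀ x, cosMode L k x * cosMode L j x = 1 / 2 * (Real.cos (2 * Real.pi * ((k : ℤ) - j : ℤ) * x / L)
      + Real.cos (2 * Real.pi * ((k : ℤ) + j : ℤ) * x / L)) := fun x => by
    have a1 : 2 * Real.pi * ((k : ℤ) - j : ℤ) * x / L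
      = 2 * Real.pi * k * x / L - 2 * Real.pi * j * x / L := by push_cast; ring
    have a2 : 2 * Real.pi * ((k : ℤ) + j : ℤ) * x / L
      = 2 * Real.pi * k * x / L + 2 * Real.pi * j * x / L := by push_cast; ring
    rw [a1, a2, Real.cos_add, Real.cos_sub, cosMode, cosMode]; ring
  rw [cosCoef, ip]
  simp_rw [e]
  rw [intervalIntegral.integral_const_mul, intervalIntegral.integral_add
    ((cont_cos_int L _).intervalIntegrable _ _) ((cont_cos_int L _).intervalIntegrable _ _),
    integral_cos_nat_mul hL (n := (k : ℤ) + j) (by omega)]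
  split_ifs with h
  · subst h; simp; ring
  · rw [integral_cos_nat_mul hL (n := (k : ℤ) - j) (by omega)]; simp

theorem sinCoef_sinMode (hL : 0 < L) {j k : ℕ} (hk : 1 ≤ k) :
    sinCoef L j (sinMode L k) = if j = k then L / 2 else 0 := by
  have e : ∀ x, sinMode L k x * sinMode L j x = 1 / 2 * (Real.cos (2 * Real.pi * ((k : ℤ) - j : ℤ) * x / L)
      - Real.cos (2 * Real.pi * ((k : ℤ) + j : ℤ) * x / L)) := fun x => by
    have a1 : 2 * Real.pi * ((k : ℤ) - j : ℤ) * x / L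
      = 2 * Real.pi * k * x / L - 2 * Real.pi * j * x / L := by push_cast; ring
    have a2 : 2 * Real.pi * ((k : ℤ) + j : ℤ) * x / L
      = 2 * Real.pi * k * x / L + 2 * Real.pi * j * x / L := by push_cast; ring
    rw [a1, a2, Real.cos_add, Real.cos_sub, sinMode, sinMode]; ring
  rw [sinCoef, ip]
  simp_rw [e]
  rw [intervalIntegral.integral_const_mul, intervalIntegral.integral_sub
    ((cont_cos_int L _).intervalIntegrable _ _) ((cont_cos_int L _).intervalIntegrable _ _),
    integral_cos_nat_mul hL (n := (k : ℤ) + j) (by omega)]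
  split_ifs with h
  · subst h; simp; ring
  · rw [integral_cos_nat_mul hL (n := (k : ℤ) - j) (by omega)]; simp

theorem sinCoef_cosMode (hL : 0 < L) (j k : ℕ) : sinCoef L j (cosMode L k) = 0 := by
  have e : ∀ x, cosMode L k x * sinMode L j x = 1 / 2 * (Real.sin (2 * Real.pi * ((j : ℤ) + k : ℤ) * x / L)
      + Real.sin (2 * Real.pi * ((j : ℤ) - k : ℤ) * x / L)) := fun x => by
    have a1 : 2 * Real.pi * ((j : ℤ) - k : ℤ) * x / L
      = 2 * Real.pi * j * x / L - 2 * Real.pi * k * x / L := by push_cast; ring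
    have a2 : 2 * Real.pi * ((j : ℤ) + k : ℤ) * x / L
      = 2 * Real.pi * j * x / L + 2 * Real.pi * k * x / L := by push_cast; ring
    rw [a1, a2, Real.sin_add, Real.sin_sub, sinMode, cosMode]; ring
  rw [sinCoef, ip]
  simp_rw [e]
  rw [intervalIntegral.integral_const_mul, intervalIntegral.integral_add
    ((cont_sin_int L _).intervalIntegrable _ _) ((cont_sin_int L _).intervalIntegrable _ _),
    integral_sin_nat_mul hL, integral_sin_nat_mul hL]
  simp

theorem cosCoef_sinMode (hL : 0 < L) (j k : ℕ) : cosCoef L j (sinMode L k) = 0 := by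
  rw [cosCoef, ip_comm]; exact sinCoef_cosMode hL k j

theorem ip_proj_left (hL : 0 < L) (hg : IsL2 L g) (f : ℝ → ℝ) (m : ℕ) :
    ip L (proj L m f) g = ∑ k ∈ Finset.range m, 2 / L * (cosCoef L (k + 1) f * cosCoef L (k + 1) g
      + sinCoef L (k + 1) f * sinCoef L (k + 1) g) := by
  rw [ip_comm, ip_proj_right hL hg]
  exact Finset.sum_congr rfl fun k _ => by ring

theorem ip_proj_comm (hL : 0 < L) (hf : IsL2 L f) (hg : IsL2 L g) (m : ℕ) :
    ip L f (proj L m g) = ip L (proj L m f) g := by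
  rw [ip_proj_left hL hg, ip_proj_right hL hf]

theorem cosCoef_proj (hL : 0 < L) (f : ℝ → ℝ) {j m : ℕ} (hj : j < m) :
    cosCoef L (j + 1) (proj L m f) = cosCoef L (j + 1) f := by
  rw [cosCoef, ip_proj_left hL (isL2_cosMode _ _), Finset.sum_eq_single j]
  · rw [cosCoef_cosMode hL (by omega), sinCoef_cosMode hL]; simp; field_simp
  · intro k _ hk
    rw [cosCoef_cosMode hL (by omega), sinCoef_cosMode hL, if_neg (by omega)]; simp
  · intro h; exact absurd (Finset.mem_range.2 hj) h

theorem sinCoef_proj (hL : 0 < L) (f : ℝ → ℝ) {j m : ℕ} (hj : j < m) :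
    sinCoef L (j + 1) (proj L m f) = sinCoef L (j + 1) f := by
  rw [sinCoef, ip_proj_left hL (isL2_sinMode _ _), Finset.sum_eq_single j]
  · rw [sinCoef_sinMode hL (by omega), cosCoef_sinMode hL]; simp; field_simp
  · intro k _ hk
    rw [sinCoef_sinMode hL (by omega), cosCoef_sinMode hL, if_neg (by omega)]; simp
  · intro h; exact absurd (Finset.mem_range.2 hj) h

theorem ip_proj_proj (hL : 0 < L) (f : ℝ → ℝ) (m : ℕ) :
    ip L (proj L m f) (proj L m f)
      = ∑ k ∈ Finset.range m, 2 / L * (cosCoef L (k + 1) f ^ 2 + sinCoef L (k + 1) f ^ 2) := by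
  rw [ip_proj_left hL (isL2_proj _ _ _)]
  refine Finset.sum_congr rfl fun k hk => ?_
  rw [cosCoef_proj hL f (Finset.mem_range.1 hk), sinCoef_proj hL f (Finset.mem_range.1 hk)]; ring

theorem ip_self_proj (hL : 0 < L) (hf : IsL2 L f) (m : ℕ) :
    ip L f (proj L m f) = l2Norm L (proj L m f) ^ 2 := by
  rw [l2Norm_sq hL, ip_proj_proj hL, ip_proj_right hL hf]
  exact Finset.sum_congr rfl fun k _ => by ring

theorem l2Norm_proj_le (hL : 0 < L) (hf : IsL2 L f) (m : ℕ) :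
    l2Norm L (proj L m f) ≤ l2Norm L f :=
  l2Norm_le_of_sq_le hL (l2Norm_nonneg _ _) (by
    rw [ip_proj_proj hL, l2Norm_sq hL]; exact sum_sq_coef_le hL hf m)

/-- The high modes are controlled by the derivative. -/
theorem l2Norm_sq_le_proj (hL : 0 < L) (hf : PerC1 L f) (h0 : ∫ x in (0 : ℝ)..L, f x = 0) (m : ℕ) :
    l2Norm L f ^ 2 ≤ l2Norm L (proj L m f) ^ 2
      + (L / (2 * Real.pi * (m + 1))) ^ 2 * l2Norm L (deriv f) ^ 2 := by
  rw [l2Norm_sq hL, l2Norm_sq hL, l2Norm_sq hL, ip_proj_proj hL]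
  have h1 := hasSum_sq_coef_of_mean_zero hL hf.isL2 h0
  have h2 := hasSum_sq_coef_of_mean_zero hL hf.deriv_isL2 hf.perAC.integral_deriv
  have h3 := (hasSum_nat_add_iff' m).2 h1
  have h4 := (hasSum_nat_add_iff' m).2 h2
  have h5 := h4.mul_left ((L / (2 * Real.pi * (m + 1))) ^ 2)
  have h6 := hasSum_le (fun k => ?_) h3 h5
  · have : 0 ≤ ∑ k ∈ Finset.range m, 2 / L * (cosCoef L (k + 1) (deriv f) ^ 2
        + sinCoef L (k + 1) (deriv f) ^ 2) := Finset.sum_nonneg fun k _ => by positivity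
    have := mul_nonneg (sq_nonneg (L / (2 * Real.pi * (m + 1)))) this
    linarith
  · rw [cosCoef_deriv hL hf.perAC, sinCoef_deriv hL hf.perAC]
    -- The remaining modes have index at least `m + 1`, so their wave numbers are at least `2π(m +
    -- 1)/L`.
    have hw : 1 ≤ (L / (2 * Real.pi * (m + 1)) * waveNum L (k + m + 1)) ^ 2 := by
      have hp := Real.pi_pos
      have : L / (2 * Real.pi * (m + 1)) * waveNum L (k + m + 1) = (k + m + 1) / (m + 1) := by
        rw [waveNum]; push_cast; field_simp
      rw [this]
      have : (1 : ℝ) ≤ (k + m + 1) / (m + 1) := by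
        rw [le_div_iff₀ (by positivity)]
        have : (0 : ℝ) ≤ k := by positivity
        linarith
      nlinarith
    have hnn : 0 ≤ 2 / L * (cosCoef L (k + m + 1) f ^ 2 + sinCoef L (k + m + 1) f ^ 2) := by
      positivity
    nlinarith [mul_le_mul_of_nonneg_right hw hnn]

theorem l2Norm_le_deriv (hL : 0 < L) (hf : PerC1 L f) (h0 : ∫ x in (0 : ℝ)..L, f x = 0) :
    l2Norm L f ≤ L / (2 * Real.pi) * l2Norm L (deriv f) := by
  have := l2Norm_sq_le_proj hL hf h0 0
  have e : proj L 0 f = 0 := by rw [proj_eq]; simp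
  rw [e, l2Norm_zero] at this
  have hp := Real.pi_pos
  refine (le_abs_self _).trans (abs_le_of_sq_le_sq ?_ (mul_nonneg (by positivity) (l2Norm_nonneg _ _)))
  rw [mul_pow]
  simpa using this

/-- Poincaré's inequality above asks for a `C¹` function, which `u_x` need not be. It is applied to
`u` instead, inside `|u_x|² ≤ |u| |u_xx|`, and one factor `|u_x|` is divided out. -/
theorem IsH2dot.l2Norm_deriv_le (hL : 0 < L) (hf : IsH2dot L f) :
    l2Norm L (deriv f) ≤ L / (2 * Real.pi) * h2Norm L f := by
  have h1 := hf.l2Norm_deriv_sq_le hL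
  have h2 := l2Norm_le_deriv hL hf.perC1 hf.mean_zero
  have h3 := mul_le_mul_of_nonneg_right h2 (h2Norm_nonneg L f)
  rcases (l2Norm_nonneg L (deriv f)).eq_or_lt with h | h
  · rw [← h]; exact mul_nonneg (by have := Real.pi_pos; positivity) (h2Norm_nonneg _ _)
  · nlinarith

theorem IsH2dot.l2Norm_le (hL : 0 < L) (hf : IsH2dot L f) :
    l2Norm L f ≤ (L / (2 * Real.pi)) ^ 2 * h2Norm L f := by
  have h2 := l2Norm_le_deriv hL hf.perC1 hf.mean_zero
  have := mul_le_mul_of_nonneg_left (hf.l2Norm_deriv_le hL)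
    (show 0 ≤ L / (2 * Real.pi) by have := Real.pi_pos; positivity)
  nlinarith

/-- Trigonometric polynomials approximate `C¹` periodic functions in `H¹`. -/
theorem tendsto_l2Norm_sub_proj (hL : 0 < L) (hf : IsL2 L f) :
    Tendsto (fun N => l2Norm L (f - (proj L N f + fun _ => 1 / L * ∫ x in (0 : ℝ)..L, f x)))
      atTop (𝓝 0) := by
  have h := (hasSum_sq_coef hL hf).tendsto_sum_nat
  set M := ∫ x in (0 : ℝ)..L, f x with hM
  set S := fun N => ∑ k ∈ Finset.range N, 2 / L * (cosCoef L (k + 1) f ^ 2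
    + sinCoef L (k + 1) f ^ 2)
  have hc : IsL2 L (fun _ => 1 / L * M) := (continuous_const).isL2
  have e1 : ∀ g : ℝ → ℝ, ip L g (fun _ => 1 / L * M) = 1 / L * M * ∫ x in (0 : ℝ)..L, g x := by
    intro g
    rw [ip, intervalIntegral.integral_mul_const, mul_comm]
  have e2 : ∀ N, ∫ x in (0 : ℝ)..L, proj L N f x = 0 := fun N => by
    have : ip L (proj L N f) (fun _ => 1) = 0 := by
      rw [ip_proj_left hL continuous_const.isL2]
      refine Finset.sum_eq_zero fun k _ => ?_
      have a1 : cosCoef L (k + 1) (fun _ => 1) = 0 := by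
        simpa [cosCoef, ip] using integral_cosMode hL (k := k + 1) (by omega)
      have a2 : sinCoef L (k + 1) (fun _ => 1) = 0 := by
        simpa [sinCoef, ip] using integral_sinMode hL (k + 1)
      rw [a1, a2]; simp
    simpa [ip] using this
  -- The square of the error is the remainder in Parseval's identity; the constant is the mean,
  -- which `proj` removes.
  have key : ∀ N, l2Norm L (f - (proj L N f + fun _ => 1 / L * M)) ^ 2
      = ip L f f - 1 / L * M ^ 2 - S N := fun N => by
    have hp := isL2_proj L N f
    have hs := hp.add hc
    rw [l2Norm_sq hL, ip_sub_left hL hf hs (hf.sub hs), ip_sub_right hL hf hs hf,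
      ip_sub_right hL hf hs hs, ip_add_right hL hp hc hf, ip_add_left hL hp hc hf,
      ip_add_left hL hp hc hs, ip_add_right hL hp hc hp, ip_add_right hL hp hc hc,
      ip_comm L (fun _ => 1 / L * M) f, ip_comm L (fun _ => 1 / L * M) (proj L N f), e1, e1, e1, e2,
      ip_comm L (proj L N f) f, ip_self_proj hL hf, l2Norm_sq hL, ip_proj_proj hL, ← hM]
    simp only [intervalIntegral.integral_const, sub_zero, smul_eq_mul]
    rw [show ∑ k ∈ Finset.range N, 2 / L * (cosCoef L (k + 1) f ^ 2 + sinCoef L (k + 1) f ^ 2)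
      = S N from rfl]
    field_simp; ring_nf
  have h2 : Tendsto (fun N => l2Norm L (f - (proj L N f + fun _ => 1 / L * M)) ^ 2) atTop (𝓝 0) := by
    simp_rw [key]
    have := h.const_sub (ip L f f - 1 / L * M ^ 2)
    rwa [sub_self] at this
  have h3 := (Real.continuous_sqrt.tendsto 0).comp h2
  simp only [Real.sqrt_zero] at h3
  refine h3.congr fun N => ?_
  simp only [Function.comp]
  rw [Real.sqrt_sq (l2Norm_nonneg _ _)]

end Fourier

/-! ### Convergence of curves of periodic functions -/

/-- Uniform convergence together with `L²` convergence of the derivatives. -/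
structure TendstoH1 (L : ℝ) {ι : Type*} (l : Filter ι) (ψ : ι → ℝ → ℝ) (ψ₀ : ℝ → ℝ) : Prop where
  per : ∀ᶠ t in l, PerC1 L (ψ t)
  per₀ : PerC1 L ψ₀
  sup : ∃ b : ι → ℝ, Tendsto b l (𝓝 0) ∧ ∀ᶠ t in l, ∀ x, |ψ t x - ψ₀ x| ≤ b t
  der : Tendsto (fun t => l2Norm L (deriv (ψ t) - deriv ψ₀)) l (𝓝 0)

theorem PerC1.exists_bound {L : ℝ} {f : ℝ → ℝ} (hL : 0 < L) (hf : PerC1 L f) :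
    ∃ C, 0 ≤ C ∧ ∀ x, |f x| ≤ C := by
  obtain ⟨C, hC⟩ := isCompact_Icc.exists_bound_of_continuousOn (hf.continuous.continuousOn
    (s := Icc 0 L))
  have : ∀ x, |f x| ≤ C := fun x => by
    obtain ⟨y, hy, h⟩ := hf.periodic.exists_mem_Icc hL x
    rw [h]; exact hC y hy
  exact ⟨C, (abs_nonneg _).trans (this 0), this⟩

theorem l2Norm_le_of_abs_le {L B : ℝ} {f : ℝ → ℝ} (hL : 0 < L) (hf : Continuous f)
    (hB : ∀ x, |f x| ≤ B) : l2Norm L f ≤ B * Real.sqrt L := by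
  have := l2Norm_mul_le hL (g := fun _ => 1) continuous_const.isL2 hf hB
  have e : l2Norm L (fun _ => 1) = Real.sqrt L := by simp [l2Norm]
  rw [e] at this
  convert! this using 2
  funext x; simp

namespace TendstoH1

variable {L : ℝ} {ι : Type*} {l : Filter ι} {ψ χ : ι → ℝ → ℝ} {ψ₀ χ₀ : ℝ → ℝ}

theorem const (h : PerC1 L ψ₀) : TendstoH1 L l (fun _ => ψ₀) ψ₀ where
  per := Eventually.of_forall fun _ => h
  per₀ := h
  sup := ⟨fun _ => 0, tendsto_const_nhds, Eventually.of_forall fun _ x => by simp⟩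
  der := by simpa [l2Norm_zero] using tendsto_const_nhds

theorem l2 (hL : 0 < L) (h : TendstoH1 L l ψ ψ₀) :
    Tendsto (fun t => l2Norm L (ψ t - ψ₀)) l (𝓝 0) := by
  obtain ⟨b, hb, hle⟩ := h.sup
  refine squeeze_zero' (Eventually.of_forall fun _ => l2Norm_nonneg _ _) ?_
    (by simpa using hb.mul_const (Real.sqrt L))
  filter_upwards [hle, h.per] with t ht hp
  exact l2Norm_le_of_abs_le hL (hp.sub h.per₀).continuous ht

theorem add (hL : 0 < L) (h : TendstoH1 L l ψ ψ₀) (h' : TendstoH1 L l χ χ₀) :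
    TendstoH1 L l (fun t => ψ t + χ t) (ψ₀ + χ₀) where
  per := by filter_upwards [h.per, h'.per] with t h1 h2 using h1.add h2
  per₀ := h.per₀.add h'.per₀
  sup := by
    obtain ⟨b, hb, hle⟩ := h.sup
    obtain ⟨b', hb', hle'⟩ := h'.sup
    refine ⟨fun t => b t + b' t, by simpa using hb.add hb', ?_⟩
    filter_upwards [hle, hle'] with t h1 h2 x
    have : (ψ t + χ t) x - (ψ₀ + χ₀) x = (ψ t x - ψ₀ x) + (χ t x - χ₀ x) := by
      simp only [Pi.add_apply]; ring
    rw [this]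
    exact (abs_add_le _ _).trans (add_le_add (h1 x) (h2 x))
  der := by
    refine squeeze_zero' (Eventually.of_forall fun _ => l2Norm_nonneg _ _) ?_
      (by simpa using h.der.add h'.der)
    filter_upwards [h.per, h'.per] with t h1 h2
    rw [h1.deriv_add h2, h.per₀.deriv_add h'.per₀, add_sub_add_comm]
    exact l2Norm_add_le hL (h1.deriv_isL2.sub h.per₀.deriv_isL2) (h2.deriv_isL2.sub h'.per₀.deriv_isL2)

/-- Uniform convergence belongs to `TendstoH1` for the sake of products: each term in the derivative
of a product is a bounded factor times a square integrable one. -/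
theorem mul (hL : 0 < L) (h : TendstoH1 L l ψ ψ₀) (h' : TendstoH1 L l χ χ₀) :
    TendstoH1 L l (fun t => ψ t * χ t) (ψ₀ * χ₀) := by
  obtain ⟨b, hb, hle⟩ := h.sup
  obtain ⟨b', hb', hle'⟩ := h'.sup
  obtain ⟨B, hB0, hB⟩ := h.per₀.exists_bound hL
  obtain ⟨B', hB0', hB'⟩ := h'.per₀.exists_bound hL
  refine ⟨?_, h.per₀.mul h'.per₀, ⟨fun t => b t * (b' t + B') + B * b' t, ?_, ?_⟩, ?_⟩
  · filter_upwards [h.per, h'.per] with t h1 h2 using h1.mul h2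
  · simpa using (hb.mul (hb'.add_const B')).add (hb'.const_mul B)
  · filter_upwards [hle, hle'] with t h1 h2 x
    have e : (ψ t * χ t) x - (ψ₀ * χ₀) x
        = (ψ t x - ψ₀ x) * ((χ t x - χ₀ x) + χ₀ x) + ψ₀ x * (χ t x - χ₀ x) := by
      simp only [Pi.mul_apply]; ring
    rw [e]
    refine (abs_add_le _ _).trans (add_le_add ?_ ?_)
    · rw [abs_mul]
      exact mul_le_mul (h1 x) ((abs_add_le _ _).trans (add_le_add (h2 x) (hB' x))) (abs_nonneg _)
        ((abs_nonneg _).trans (h1 x))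
    · rw [abs_mul]
      exact mul_le_mul (hB x) (h2 x) (abs_nonneg _) hB0
  · set d := fun t => l2Norm L (deriv (ψ t) - deriv ψ₀)
    set d' := fun t => l2Norm L (deriv (χ t) - deriv χ₀)
    set D := l2Norm L (deriv ψ₀)
    set D' := l2Norm L (deriv χ₀)
    have hlim : Tendsto (fun t => (b' t + B') * d t + b' t * D + (b t + B) * d' t + b t * D')
        l (𝓝 0) := by
      have t1 := (hb'.add_const B').mul h.der
      have t2 := hb'.mul_const D
      have t3 := (hb.add_const B).mul h'.der
      have t4 := hb.mul_const D'
      simpa using ((t1.add t2).add t3).add t4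
    refine squeeze_zero' (Eventually.of_forall fun _ => l2Norm_nonneg _ _) ?_ hlim
    filter_upwards [h.per, h'.per, hle, hle'] with t p1 p2 h1 h2
    have e : deriv (ψ t * χ t) - deriv (ψ₀ * χ₀)
        = (χ t * (deriv (ψ t) - deriv ψ₀) + (χ t - χ₀) * deriv ψ₀)
          + (ψ t * (deriv (χ t) - deriv χ₀) + (ψ t - ψ₀) * deriv χ₀) := by
      rw [p1.deriv_mul p2, h.per₀.deriv_mul h'.per₀]; ring
    have s1 : ∀ x, |χ t x| ≤ b' t + B' := fun x => by
      have : χ t x = (χ t x - χ₀ x) + χ₀ x := by ring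
      rw [this]; exact (abs_add_le _ _).trans (add_le_add (h2 x) (hB' x))
    have s2 : ∀ x, |ψ t x| ≤ b t + B := fun x => by
      have : ψ t x = (ψ t x - ψ₀ x) + ψ₀ x := by ring
      rw [this]; exact (abs_add_le _ _).trans (add_le_add (h1 x) (hB x))
    have q1 : IsL2 L (deriv (ψ t) - deriv ψ₀) := p1.deriv_isL2.sub h.per₀.deriv_isL2
    have q2 : IsL2 L (deriv (χ t) - deriv χ₀) := p2.deriv_isL2.sub h'.per₀.deriv_isL2
    have r1 : IsL2 L (χ t * (deriv (ψ t) - deriv ψ₀)) := q1.mul_continuous p2.continuous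
    have r2 : IsL2 L ((χ t - χ₀) * deriv ψ₀) :=
      h.per₀.deriv_isL2.mul_continuous (p2.sub h'.per₀).continuous
    have r3 : IsL2 L (ψ t * (deriv (χ t) - deriv χ₀)) := q2.mul_continuous p1.continuous
    have r4 : IsL2 L ((ψ t - ψ₀) * deriv χ₀) :=
      h'.per₀.deriv_isL2.mul_continuous (p1.sub h.per₀).continuous
    rw [e]
    have f1 := l2Norm_add_le hL (r1.add r2) (r3.add r4)
    have f2 := l2Norm_add_le hL r1 r2
    have f3 := l2Norm_add_le hL r3 r4
    have g1 := l2Norm_mul_le hL q1 p2.continuous s1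
    have g2 := l2Norm_mul_le hL h.per₀.deriv_isL2 (p2.sub h'.per₀).continuous h2
    have g3 := l2Norm_mul_le hL q2 p1.continuous s2
    have g4 := l2Norm_mul_le hL h'.per₀.deriv_isL2 (p1.sub h.per₀).continuous h1
    simp only [d, d', D, D']
    linarith

theorem smul (hL : 0 < L) (h : TendstoH1 L l ψ ψ₀) (c : ℝ) :
    TendstoH1 L l (fun t => c • ψ t) (c • ψ₀) := by
  have hc : PerC1 L (fun _ => c) := ⟨contDiff_const, fun _ => rfl⟩
  exact (const (l := l) hc).mul hL h

theorem congr (h : TendstoH1 L l ψ ψ₀) {χ : ι → ℝ → ℝ} {χ₀ : ℝ → ℝ} (h1 : ∀ t, χ t = ψ t)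
    (h2 : χ₀ = ψ₀) : TendstoH1 L l χ χ₀ := by
  obtain rfl : χ = ψ := funext h1
  rwa [h2]

end TendstoH1

/-- A bound for the supremum of a zero-mean `H²` function. -/
theorem IsH2dot.abs_le {L : ℝ} {u : ℝ → ℝ} (hL : 0 < L) (hu : IsH2dot L u) (x : ℝ) :
    |u x| ≤ Real.sqrt ((L / (2 * Real.pi)) ^ 3) * h2Norm L u := by
  have hκ : 0 ≤ L / (2 * Real.pi) := by have := Real.pi_pos; positivity
  refine abs_le_of_sq_le_sq ?_ (mul_nonneg (Real.sqrt_nonneg _) (h2Norm_nonneg _ _))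
  rw [mul_pow, Real.sq_sqrt (by positivity)]
  have h1 := sq_le_l2Norm_mul hL hu.perC1 hu.mean_zero x
  have h2 := mul_le_mul (hu.l2Norm_le hL) (hu.l2Norm_deriv_le hL) (l2Norm_nonneg _ _)
    (mul_nonneg (sq_nonneg _) (h2Norm_nonneg _ _))
  calc _ ≤ _ := h1.trans h2
    _ = _ := by ring

theorem tendstoH1_of_h2Norm {L : ℝ} (hL : 0 < L) {ι : Type*} {l : Filter ι} {u : ι → ℝ → ℝ}
    {u₀ : ℝ → ℝ} (hu : ∀ᶠ t in l, IsH2dot L (u t)) (hu₀ : IsH2dot L u₀)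
    (h : Tendsto (fun t => h2Norm L (u t - u₀)) l (𝓝 0)) : TendstoH1 L l u u₀ where
  per := hu.mono fun _ h => h.perC1
  per₀ := hu₀.perC1
  sup := by
    refine ⟨fun t => Real.sqrt ((L / (2 * Real.pi)) ^ 3) * h2Norm L (u t - u₀),
      by simpa using h.const_mul (Real.sqrt ((L / (2 * Real.pi)) ^ 3)), ?_⟩
    filter_upwards [hu] with t ht x
    exact (ht.sub hL hu₀).abs_le hL x
  der := by
    refine squeeze_zero' (Eventually.of_forall fun _ => l2Norm_nonneg _ _) ?_
      (by simpa using h.const_mul (L / (2 * Real.pi)))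
    filter_upwards [hu] with t ht
    rw [← ht.perC1.deriv_sub hu₀.perC1]
    exact (ht.sub hL hu₀).l2Norm_deriv_le hL

/-! ### Weak evolution equations `a_s = G_x - r` -/

/-- The pairing of `G_x - r` with `φ`. -/
noncomputable def weakForm (L : ℝ) (G r φ : ℝ → ℝ) : ℝ := -ip L G (deriv φ) - ip L r φ

/-- The curve `a` solves `a_s = G_x - r` weakly on the open time set `J`. -/
structure WeakEvol (L : ℝ) (J : Set ℝ) (a G r : ℝ → ℝ → ℝ) : Prop where
  isOpen : IsOpen J
  isL2 : ∀ s ∈ J, IsL2 L (a s)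
  flux_isL2 : ∀ s ∈ J, IsL2 L (G s)
  source_isL2 : ∀ s ∈ J, IsL2 L (r s)
  flux_cont : ∀ s ∈ J, Tendsto (fun t => l2Norm L (G t - G s)) (𝓝 s) (𝓝 0)
  source_cont : ∀ s ∈ J, Tendsto (fun t => l2Norm L (r t - r s)) (𝓝 s) (𝓝 0)
  hasDerivAt : ∀ φ : ℝ → ℝ, ContDiff ℝ (⊤ : ℕ∞) φ → Function.Periodic φ L → ∀ s ∈ J,
    HasDerivAt (fun t => ip L (a t) φ) (weakForm L (G s) (r s) φ) s

section Approx

variable {L : ℝ} {φ ψ G r : ℝ → ℝ}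

/-- The approximants are truncated Fourier series plus the mean. Truncation commutes with the
derivative, whose own mean vanishes by periodicity, so one construction serves both limits. -/
theorem exists_smooth_approx (hL : 0 < L) (hψ : PerC1 L ψ) :
    ∃ φ : ℕ → ℝ → ℝ, (∀ n, ContDiff ℝ (⊤ : ℕ∞) (φ n)) ∧ (∀ n, PerC1 L (φ n)) ∧
      Tendsto (fun n => l2Norm L (φ n - ψ)) atTop (𝓝 0) ∧
      Tendsto (fun n => l2Norm L (deriv (φ n) - deriv ψ)) atTop (𝓝 0) := by
  set c := 1 / L * ∫ x in (0 : ℝ)..L, ψ x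
  have hc : PerC1 L (fun _ => c) := ⟨contDiff_const, fun _ => rfl⟩
  refine ⟨fun n => proj L n ψ + fun _ => c, fun n => (contDiff_proj L n ψ).add contDiff_const,
    fun n => (perC1_proj hL n ψ).add hc, ?_, ?_⟩
  · refine (tendsto_l2Norm_sub_proj hL hψ.isL2).congr fun n => ?_
    rw [l2Norm_sub_comm]
  · refine (tendsto_l2Norm_sub_proj hL hψ.deriv_isL2).congr fun n => ?_
    rw [l2Norm_sub_comm, (perC1_proj hL n ψ).deriv_add hc, deriv_proj hL hψ.perAC,
      hψ.perAC.integral_deriv]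
    congr 2
    funext x
    simp

theorem weakForm_sub (hL : 0 < L) (hG : IsL2 L G) (hr : IsL2 L r) (hφ : PerC1 L φ)
    (hψ : PerC1 L ψ) : weakForm L G r (φ - ψ) = weakForm L G r φ - weakForm L G r ψ := by
  rw [weakForm, weakForm, weakForm, hφ.deriv_sub hψ, ip_sub_right hL hφ.deriv_isL2 hψ.deriv_isL2 hG,
    ip_sub_right hL hφ.isL2 hψ.isL2 hr]
  ring

theorem weakForm_add (hL : 0 < L) (hG : IsL2 L G) (hr : IsL2 L r) (hφ : PerC1 L φ)
    (hψ : PerC1 L ψ) : weakForm L G r (φ + ψ) = weakForm L G r φ + weakForm L G r ψ := by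
  rw [weakForm, weakForm, weakForm, hφ.deriv_add hψ, ip_add_right hL hφ.deriv_isL2 hψ.deriv_isL2 hG,
    ip_add_right hL hφ.isL2 hψ.isL2 hr]
  ring

theorem weakForm_smul (L c : ℝ) (G r : ℝ → ℝ) (hφ : PerC1 L φ) :
    weakForm L G r (c • φ) = c * weakForm L G r φ := by
  rw [weakForm, weakForm, hφ.deriv_smul, ip_smul_right, ip_smul_right]
  ring

theorem abs_weakForm_le (hL : 0 < L) (hG : IsL2 L G) (hr : IsL2 L r) (hφ : PerC1 L φ) {C : ℝ}
    (h1 : l2Norm L G ≤ C) (h2 : l2Norm L r ≤ C) :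
    |weakForm L G r φ| ≤ C * (l2Norm L (deriv φ) + l2Norm L φ) := by
  have e1 := (abs_ip_le hL hG hφ.deriv_isL2).trans
    (mul_le_mul_of_nonneg_right h1 (l2Norm_nonneg L (deriv φ)))
  have e2 := (abs_ip_le hL hr hφ.isL2).trans (mul_le_mul_of_nonneg_right h2 (l2Norm_nonneg L φ))
  rw [weakForm]
  rw [abs_le] at e1 e2 ⊢
  constructor <;> linarith

end Approx

/-! ### Calculus of weak evolutions with moving test functions -/

namespace WeakEvol

variable {L : ℝ} {J : Set ℝ} {a G r : ℝ → ℝ → ℝ} {s : ℝ}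

theorem exists_ball (hL : 0 < L) (h : WeakEvol L J a G r) (hs : s ∈ J) :
    ∃ C ε, 0 ≤ C ∧ 0 < ε ∧ Metric.ball s ε ⊆ J ∧
      ∀ t ∈ Metric.ball s ε, l2Norm L (G t) ≤ C ∧ l2Norm L (r t) ≤ C := by
  have e1 := (h.flux_cont s hs).eventually (gt_mem_nhds one_pos)
  have e2 := (h.source_cont s hs).eventually (gt_mem_nhds one_pos)
  have e3 := h.isOpen.mem_nhds hs
  obtain ⟨ε, hε, hb⟩ := Metric.mem_nhds_iff.1 (inter_mem (inter_mem e1 e2) e3)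
  refine ⟨l2Norm L (G s) + l2Norm L (r s) + 1, ε, ?_, hε, fun t ht => (hb ht).2, fun t ht => ?_⟩
  · have := l2Norm_nonneg L (G s); have := l2Norm_nonneg L (r s); linarith
  · obtain ⟨⟨h1, h2⟩, h3⟩ := hb ht
    have h1' : l2Norm L (G t - G s) < 1 := h1
    have h2' : l2Norm L (r t - r s) < 1 := h2
    have f1 := (abs_le.1 (abs_l2Norm_sub_le hL (h.flux_isL2 t h3) (h.flux_isL2 s hs))).2
    have f2 := (abs_le.1 (abs_l2Norm_sub_le hL (h.source_isL2 t h3) (h.source_isL2 s hs))).2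
    have := l2Norm_nonneg L (G s); have := l2Norm_nonneg L (r s)
    constructor <;> linarith

/-- The curve is Lipschitz in time with values in the dual of `H¹`, the constant being the bound for
flux and source. For smooth `ψ` this is the mean value inequality; density in `H¹` does the rest. -/
theorem abs_ip_sub_le (hL : 0 < L) (h : WeakEvol L J a G r) {S : Set ℝ} (hS : Convex ℝ S)
    (hSJ : S ⊆ J) {C : ℝ} (hC : ∀ t ∈ S, l2Norm L (G t) ≤ C ∧ l2Norm L (r t) ≤ C) {s t : ℝ}
    (hs : s ∈ S) (ht : t ∈ S) {ψ : ℝ → ℝ} (hψ : PerC1 L ψ) :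
    |ip L (a t - a s) ψ| ≤ C * (l2Norm L (deriv ψ) + l2Norm L ψ) * |t - s| := by
  obtain ⟨φ, hsm, hper, hl, hl'⟩ := exists_smooth_approx hL hψ
  have step : ∀ n, |ip L (a t - a s) (φ n)|
      ≤ C * (l2Norm L (deriv (φ n)) + l2Norm L (φ n)) * |t - s| := fun n => by
    have := hS.norm_image_sub_le_of_norm_hasDerivWithin_le (f := fun t => ip L (a t) (φ n))
      (fun x hx => (h.hasDerivAt (φ n) (hsm n) (hper n).periodic x (hSJ hx)).hasDerivWithinAt)
      (fun x hx => abs_weakForm_le hL (h.flux_isL2 x (hSJ hx)) (h.source_isL2 x (hSJ hx)) (hper n)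
        (hC x hx).1 (hC x hx).2) hs ht
    rw [ip_sub_left hL (h.isL2 t (hSJ ht)) (h.isL2 s (hSJ hs)) (hper n).isL2]
    exact this
  have norm_lim : ∀ {F : ℕ → ℝ → ℝ} {f : ℝ → ℝ}, (∀ n, IsL2 L (F n)) → IsL2 L f →
      Tendsto (fun n => l2Norm L (F n - f)) atTop (𝓝 0) →
      Tendsto (fun n => l2Norm L (F n)) atTop (𝓝 (l2Norm L f)) := fun hF hf hl => by
    rw [tendsto_iff_dist_tendsto_zero]
    exact squeeze_zero (fun _ => dist_nonneg) (fun n => abs_l2Norm_sub_le hL (hF n) hf) hl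
  have l1 := (tendsto_ip hL ((h.isL2 t (hSJ ht)).sub (h.isL2 s (hSJ hs))) hψ.isL2
    (Eventually.of_forall fun _ => (h.isL2 t (hSJ ht)).sub (h.isL2 s (hSJ hs)))
    (Eventually.of_forall fun n => (hper n).isL2) (by simp [l2Norm_zero]) hl).abs
  have l2 := norm_lim (fun n => (hper n).isL2) hψ.isL2 hl
  have l3 := norm_lim (fun n => (hper n).deriv_isL2) hψ.deriv_isL2 hl'
  exact le_of_tendsto_of_tendsto' l1 (((l3.add l2).const_mul C).mul_const |t - s|) step

/-- Differentiation of the pairing with a moving test function, at the base point. -/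
theorem hasDerivAt_ip_sub (hL : 0 < L) (h : WeakEvol L J a G r) (hs : s ∈ J)
    {ψ : ℝ → ℝ → ℝ} {ψ₀ : ℝ → ℝ} (hψ : TendstoH1 L (𝓝 s) ψ ψ₀) :
    HasDerivAt (fun t => ip L (a t - a s) (ψ t)) (weakForm L (G s) (r s) ψ₀) s := by
  obtain ⟨C, ε, hC0, hε, hball, hC⟩ := h.exists_ball hL hs
  rw [hasDerivAt_iff_isLittleO, Asymptotics.isLittleO_iff]
  intro c hc
  -- No time derivative of `ψ` is needed: increments of `a` are `O(|t - s|)` in the dual of `H¹`,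
  -- while `ψ t - φ n` is small in `H¹`. The error `c` is spent as `c/2` on replacing `ψ t` by the
  -- fixed smooth `φ n`, `c/4` on the derivative for `φ n`, and `c/4` on replacing `φ n` by `ψ₀` in
  -- the limit.
  obtain ⟨φ, hsm, hper, hl, hl'⟩ := exists_smooth_approx hL hψ.per₀
  have hη : 0 < c / (4 * (C + 1)) := by positivity
  obtain ⟨n, hn⟩ := ((hl'.add hl).eventually (gt_mem_nhds (by simpa using hη))).exists
  have hd := h.hasDerivAt (φ n) (hsm n) (hper n).periodic s hs
  rw [hasDerivAt_iff_isLittleO, Asymptotics.isLittleO_iff] at hd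
  have hψl := (hψ.der.add (hψ.l2 hL)).eventually (gt_mem_nhds (by simpa using hη))
  filter_upwards [hd (half_pos (half_pos hc)), hψl, hψ.per, Metric.ball_mem_nhds s hε]
    with t h1 h2 hp ht
  have hsb : s ∈ Metric.ball s ε := Metric.mem_ball_self hε
  have haL := (h.isL2 t (hball ht)).sub (h.isL2 s hs)
  have e1 := h.abs_ip_sub_le hL (convex_ball s ε) hball hC hsb ht (hp.sub (hper n))
  have e2 : l2Norm L (deriv (ψ t - φ n)) + l2Norm L (ψ t - φ n) ≤ 2 * (c / (4 * (C + 1))) := by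
    have i1 := l2Norm_sub_le hL (hp.deriv_isL2.sub hψ.per₀.deriv_isL2)
      ((hper n).deriv_isL2.sub hψ.per₀.deriv_isL2)
    have i2 := l2Norm_sub_le hL (hp.isL2.sub hψ.per₀.isL2) ((hper n).isL2.sub hψ.per₀.isL2)
    rw [sub_sub_sub_cancel_right] at i1 i2
    rw [hp.deriv_sub (hper n)]
    linarith
  have e3 := abs_weakForm_le hL (h.flux_isL2 s hs) (h.source_isL2 s hs) ((hper n).sub hψ.per₀)
    (hC s hsb).1 (hC s hsb).2
  rw [weakForm_sub hL (h.flux_isL2 s hs) (h.source_isL2 s hs) (hper n) hψ.per₀,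
    (hper n).deriv_sub hψ.per₀] at e3
  rw [ip_sub_right hL hp.isL2 (hper n).isL2 haL] at e1
  have hC1 : C * (c / (4 * (C + 1))) ≤ c / 4 := by
    rw [mul_div_assoc', div_le_div_iff₀ (by positivity) (by positivity)]; nlinarith
  have e1' : |ip L (a t - a s) (ψ t) - ip L (a t - a s) (φ n)| ≤ c / 2 * |t - s| := by
    refine e1.trans (mul_le_mul_of_nonneg_right ?_ (abs_nonneg _))
    nlinarith [mul_le_mul_of_nonneg_left e2 hC0]
  have e3' : |weakForm L (G s) (r s) (φ n) - weakForm L (G s) (r s) ψ₀| ≤ c / 4 := by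
    refine e3.trans ((mul_le_mul_of_nonneg_left hn.le hC0).trans hC1)
  have e0 : ip L (a s - a s) (ψ s) = 0 := by rw [sub_self]; simp [ip]
  have e4 : ip L (a t - a s) (φ n) = ip L (a t) (φ n) - ip L (a s) (φ n) :=
    ip_sub_left hL (h.isL2 t (hball ht)) (h.isL2 s hs) (hper n).isL2
  simp only [e0, Real.norm_eq_abs, smul_eq_mul, sub_zero] at h1 ⊢
  rw [← e4] at h1
  have e5 : |(t - s) * (weakForm L (G s) (r s) (φ n) - weakForm L (G s) (r s) ψ₀)|
      ≤ c / 4 * |t - s| := by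
    rw [abs_mul, mul_comm]; exact mul_le_mul_of_nonneg_right e3' (abs_nonneg _)
  rw [abs_le] at h1 e1' e5 ⊢
  constructor <;> nlinarith [h1.1, h1.2, e1'.1, e1'.2, e5.1, e5.2]

theorem sub (hL : 0 < L) {b H q : ℝ → ℝ → ℝ} (h : WeakEvol L J a G r) (h' : WeakEvol L J b H q) :
    WeakEvol L J (fun s => a s - b s) (fun s => G s - H s) (fun s => r s - q s) where
  isOpen := h.isOpen
  isL2 s hs := (h.isL2 s hs).sub (h'.isL2 s hs)
  flux_isL2 s hs := (h.flux_isL2 s hs).sub (h'.flux_isL2 s hs)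
  source_isL2 s hs := (h.source_isL2 s hs).sub (h'.source_isL2 s hs)
  flux_cont s hs := by
    refine squeeze_zero' (Eventually.of_forall fun _ => l2Norm_nonneg _ _) ?_
      (by simpa using (h.flux_cont s hs).add (h'.flux_cont s hs))
    filter_upwards [h.isOpen.mem_nhds hs] with t ht
    rw [sub_sub_sub_comm]
    exact l2Norm_sub_le hL ((h.flux_isL2 t ht).sub (h.flux_isL2 s hs))
      ((h'.flux_isL2 t ht).sub (h'.flux_isL2 s hs))
  source_cont s hs := by
    refine squeeze_zero' (Eventually.of_forall fun _ => l2Norm_nonneg _ _) ?_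
      (by simpa using (h.source_cont s hs).add (h'.source_cont s hs))
    filter_upwards [h.isOpen.mem_nhds hs] with t ht
    rw [sub_sub_sub_comm]
    exact l2Norm_sub_le hL ((h.source_isL2 t ht).sub (h.source_isL2 s hs))
      ((h'.source_isL2 t ht).sub (h'.source_isL2 s hs))
  hasDerivAt φ hφ hp s hs := by
    have hφ1 : PerC1 L φ := ⟨hφ.of_le (by exact_mod_cast le_top), hp⟩
    have := (h.hasDerivAt φ hφ hp s hs).sub (h'.hasDerivAt φ hφ hp s hs)
    refine (this.congr_of_eventuallyEq ?_).congr_deriv ?_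
    · filter_upwards [h.isOpen.mem_nhds hs] with t ht
      exact ip_sub_left hL (h.isL2 t ht) (h'.isL2 t ht) hφ1.isL2
    · rw [weakForm, weakForm, weakForm, ip_sub_left hL (h.flux_isL2 s hs) (h'.flux_isL2 s hs)
        hφ1.deriv_isL2, ip_sub_left hL (h.source_isL2 s hs) (h'.source_isL2 s hs) hφ1.isL2]
      ring

/-- The `L²` energy identity. -/
theorem hasDerivAt_ip_self (hL : 0 < L) (h : WeakEvol L J a G r) (hs : s ∈ J)
    (ha : TendstoH1 L (𝓝 s) a (a s)) :
    HasDerivAt (fun t => ip L (a t) (a t)) (2 * weakForm L (G s) (r s) (a s)) s := by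
  -- A difference of squares: `|a(t)|² - |a(s)|²` is the pairing of `a(t) - a(s)` with the moving
  -- test function `a(t) + a(s)`.
  have h1 := h.hasDerivAt_ip_sub hL hs (ha.add hL (TendstoH1.const ha.per₀))
  rw [weakForm_add hL (h.flux_isL2 s hs) (h.source_isL2 s hs) ha.per₀ ha.per₀, ← two_mul] at h1
  refine (h1.add_const (ip L (a s) (a s))).congr_of_eventuallyEq ?_
  filter_upwards [h.isOpen.mem_nhds hs] with t ht
  have i1 := h.isL2 t ht
  have i2 := h.isL2 s hs
  rw [ip_sub_left hL i1 i2 (i1.add i2), ip_add_right hL i1 i2 i1, ip_add_right hL i1 i2 i2,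
    ip_comm L (a s) (a t)]
  ring

end WeakEvol

/-! ### Evolution of the `H¹` seminorm -/

section H1

variable {L : ℝ} {a G r q : ℝ → ℝ → ℝ}

theorem continuous_ip (hL : 0 < L) {f g : ℝ → ℝ → ℝ} (hf : ∀ s, IsL2 L (f s))
    (hg : ∀ s, IsL2 L (g s)) (hfc : ∀ s, Tendsto (fun t => l2Norm L (f t - f s)) (𝓝 s) (𝓝 0))
    (hgc : ∀ s, Tendsto (fun t => l2Norm L (g t - g s)) (𝓝 s) (𝓝 0)) :
    Continuous fun t => ip L (f t) (g t) :=
  continuous_iff_continuousAt.2 fun s => tendsto_ip hL (hf s) (hg s)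
    (Eventually.of_forall hf) (Eventually.of_forall hg) (hfc s) (hgc s)

theorem WeakEvol.hasDerivAt_cosCoef (hL : 0 < L) {J : Set ℝ} (h : WeakEvol L J a G r) (k : ℕ)
    {s : ℝ} (hs : s ∈ J) : HasDerivAt (fun t => cosCoef L k (a t))
      (waveNum L k * sinCoef L k (G s) - cosCoef L k (r s)) s := by
  refine (h.hasDerivAt _ (contDiff_cosMode L k) (periodic_cosMode hL k) s hs).congr_deriv ?_
  rw [weakForm, deriv_cosMode, ip_smul_right, sinCoef, cosCoef]; ring

theorem WeakEvol.hasDerivAt_sinCoef (hL : 0 < L) {J : Set ℝ} (h : WeakEvol L J a G r) (k : ℕ)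
    {s : ℝ} (hs : s ∈ J) : HasDerivAt (fun t => sinCoef L k (a t))
      (-(waveNum L k * cosCoef L k (G s)) - sinCoef L k (r s)) s := by
  refine (h.hasDerivAt _ (contDiff_sinMode L k) (periodic_sinMode hL k) s hs).congr_deriv ?_
  rw [weakForm, deriv_sinMode, ip_smul_right, sinCoef, cosCoef]

/-- The evolution of `|a_x|²` when `-a_xx = G + q`: the flux pairs only with `q`. -/
theorem WeakEvol.hasDerivAt_ip_deriv_self (hL : 0 < L) (h : WeakEvol L univ a G r)
    (ha : ∀ s, IsH2dot L (a s)) (hac : ∀ s, TendstoH1 L (𝓝 s) a (a s))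
    (hqc : ∀ s, TendstoH1 L (𝓝 s) q (q s)) (hrc : ∀ s, TendstoH1 L (𝓝 s) r (r s))
    (hG : ∀ s, deriv (deriv (a s)) =ᵐ[volume.restrict (Ioc 0 L)] -(G s + q s)) (s : ℝ) :
    HasDerivAt (fun t => ip L (deriv (a t)) (deriv (a t)))
      (-2 * ip L (deriv (q s)) (G s) - 2 * ip L (deriv (a s)) (deriv (r s))) s := by
  have hGL := fun s => h.flux_isL2 s (mem_univ s)
  have hGc := fun s => h.flux_cont s (mem_univ s)
  have hq := fun s => (hqc s).per₀
  have hr := fun s => (hrc s).per₀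
  have hap := fun s => (ha s).perC1
  -- Formally the derivative is `-2⟨a_xx, a_s⟩ = 2⟨G + q, G_x - r⟩`, where `⟨G, G_x⟩ = 0`. As `G` is
  -- only square integrable, the computation is made for the first `N` Fourier modes. There the
  -- products of the two coefficients of `G` cancel exactly.
  set S : ℕ → (ℝ → ℝ) → (ℝ → ℝ) → ℝ := fun N f g => ∑ k ∈ Finset.range N,
    2 / L * (cosCoef L (k + 1) f * cosCoef L (k + 1) g + sinCoef L (k + 1) f * sinCoef L (k + 1) g)
    with hS
  set X : ℕ → ℝ → ℝ := fun N t => ∑ k ∈ Finset.range N,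
    2 / L * (cosCoef L (k + 1) (deriv (a t)) ^ 2 + sinCoef L (k + 1) (deriv (a t)) ^ 2) with hX
  set D : ℕ → ℝ → ℝ := fun N t => -2 * S N (deriv (q t)) (G t) - 2 * S N (deriv (a t)) (deriv (r t))
    with hD
  have hXd : ∀ N t, HasDerivAt (X N) (D N t) t := fun N t => by
    have h1 : ∀ k ∈ Finset.range N, HasDerivAt
        (fun t => 2 / L * (cosCoef L (k + 1) (deriv (a t)) ^ 2 + sinCoef L (k + 1) (deriv (a t)) ^ 2))
        (-2 * (2 / L * (cosCoef L (k + 1) (deriv (q t)) * cosCoef L (k + 1) (G t)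
          + sinCoef L (k + 1) (deriv (q t)) * sinCoef L (k + 1) (G t)))
        - 2 * (2 / L * (cosCoef L (k + 1) (deriv (a t)) * cosCoef L (k + 1) (deriv (r t))
          + sinCoef L (k + 1) (deriv (a t)) * sinCoef L (k + 1) (deriv (r t))))) t := fun k _ => by
      have dc := h.hasDerivAt_cosCoef hL (k + 1) (mem_univ t)
      have ds := h.hasDerivAt_sinCoef hL (k + 1) (mem_univ t)
      have e1 : ∀ t, 2 / L * (cosCoef L (k + 1) (deriv (a t)) ^ 2
          + sinCoef L (k + 1) (deriv (a t)) ^ 2) = 2 / L * waveNum L (k + 1) ^ 2 *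
          (sinCoef L (k + 1) (a t) ^ 2 + cosCoef L (k + 1) (a t) ^ 2) := fun t => by
        rw [cosCoef_deriv hL (hap t).perAC, sinCoef_deriv hL (hap t).perAC]; ring
      simp_rw [e1]
      refine (((ds.pow 2).add (dc.pow 2)).const_mul _).congr_deriv ?_
      have c2 : -(waveNum L (k + 1) ^ 2 * cosCoef L (k + 1) (a t))
          = -(cosCoef L (k + 1) (G t) + cosCoef L (k + 1) (q t)) := by
        rw [← cosCoef_add hL (hGL t) (hq t).isL2, cosCoef, cosCoef, ← ip_neg_left,
          ← ip_congr_left hL (hG t), ← cosCoef, ← cosCoef, cosCoef_deriv hL (ha t).perAC_deriv,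
          sinCoef_deriv hL (hap t).perAC]
        ring
      have s2 : -(waveNum L (k + 1) ^ 2 * sinCoef L (k + 1) (a t))
          = -(sinCoef L (k + 1) (G t) + sinCoef L (k + 1) (q t)) := by
        rw [← sinCoef_add hL (hGL t) (hq t).isL2, sinCoef, sinCoef, ← ip_neg_left,
          ← ip_congr_left hL (hG t), ← sinCoef, ← sinCoef, sinCoef_deriv hL (ha t).perAC_deriv,
          cosCoef_deriv hL (hap t).perAC]
        ring
      rw [cosCoef_deriv hL (hq t).perAC, sinCoef_deriv hL (hq t).perAC,
        cosCoef_deriv hL (hap t).perAC, sinCoef_deriv hL (hap t).perAC,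
        cosCoef_deriv hL (hr t).perAC, sinCoef_deriv hL (hr t).perAC]
      push_cast
      linear_combination (4 / L * waveNum L (k + 1)) * cosCoef L (k + 1) (G t) * s2
        - (4 / L * waveNum L (k + 1)) * sinCoef L (k + 1) (G t) * c2
    have h2 := HasDerivAt.sum h1
    refine (h2.congr_of_eventuallyEq (Eventually.of_forall fun t => ?_)).congr_deriv ?_
    · simp [hX, Finset.sum_apply]
    · simp only [hD, hS, Finset.mul_sum, Finset.sum_sub_distrib]
  have hcoefc : ∀ {f : ℝ → ℝ → ℝ}, (∀ s, IsL2 L (f s)) →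
      (∀ s, Tendsto (fun t => l2Norm L (f t - f s)) (𝓝 s) (𝓝 0)) →
      ∀ k, Continuous (fun t => cosCoef L k (f t)) ∧ Continuous (fun t => sinCoef L k (f t)) :=
    fun hf hfc k => ⟨continuous_ip hL hf (fun _ => isL2_cosMode L k) hfc (by simp [l2Norm_zero]),
      continuous_ip hL hf (fun _ => isL2_sinMode L k) hfc (by simp [l2Norm_zero])⟩
  have cq := hcoefc (fun s => (hq s).deriv_isL2) (fun s => (hqc s).der)
  have cG := hcoefc hGL hGc
  have ca := hcoefc (fun s => (hap s).deriv_isL2) (fun s => (hac s).der)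
  have cr := hcoefc (fun s => (hr s).deriv_isL2) (fun s => (hrc s).der)
  have hDc : ∀ N, Continuous (D N) := fun N => by
    refine (continuous_const.mul (continuous_finsetSum _ fun k _ => ?_)).sub
      (continuous_const.mul (continuous_finsetSum _ fun k _ => ?_))
    · exact continuous_const.mul (((cq (k + 1)).1.mul (cG (k + 1)).1).add
        ((cq (k + 1)).2.mul (cG (k + 1)).2))
    · exact continuous_const.mul (((ca (k + 1)).1.mul (cr (k + 1)).1).add
        ((ca (k + 1)).2.mul (cr (k + 1)).2))
  set E : ℝ → ℝ := fun t => -2 * ip L (deriv (q t)) (G t) - 2 * ip L (deriv (a t)) (deriv (r t))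
  have hEc : Continuous E :=
    (continuous_const.mul (continuous_ip hL (fun s => (hq s).deriv_isL2) hGL
      (fun s => (hqc s).der) hGc)).sub (continuous_const.mul (continuous_ip hL
      (fun s => (hap s).deriv_isL2) (fun s => (hr s).deriv_isL2) (fun s => (hac s).der)
      (fun s => (hrc s).der)))
  set B : ℝ → ℝ := fun t => ip L (deriv (q t)) (deriv (q t)) + ip L (G t) (G t)
    + (ip L (deriv (a t)) (deriv (a t)) + ip L (deriv (r t)) (deriv (r t)))
  have hBc : Continuous B :=
    ((continuous_ip hL (fun s => (hq s).deriv_isL2) (fun s => (hq s).deriv_isL2)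
      (fun s => (hqc s).der) (fun s => (hqc s).der)).add (continuous_ip hL hGL hGL hGc hGc)).add
    ((continuous_ip hL (fun s => (hap s).deriv_isL2) (fun s => (hap s).deriv_isL2)
      (fun s => (hac s).der) (fun s => (hac s).der)).add
     (continuous_ip hL (fun s => (hr s).deriv_isL2) (fun s => (hr s).deriv_isL2)
      (fun s => (hrc s).der) (fun s => (hrc s).der)))
  have hXlim : ∀ t, Tendsto (fun N => X N t) atTop (𝓝 (ip L (deriv (a t)) (deriv (a t)))) :=
    fun t => (hasSum_sq_coef_of_mean_zero hL (hap t).deriv_isL2 (ha t).integral_deriv).tendsto_sum_nat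
  have hDlim : ∀ t, Tendsto (fun N => D N t) atTop (𝓝 (E t)) := fun t =>
    (((hasSum_mul_coef hL (hq t).deriv_isL2 (hGL t)
      (hq t).perAC.integral_deriv).tendsto_sum_nat).const_mul (-2)).sub
    (((hasSum_mul_coef hL (hap t).deriv_isL2 (hr t).deriv_isL2
      (ha t).integral_deriv).tendsto_sum_nat).const_mul 2)
  have hDB : ∀ N t, |D N t| ≤ B t := fun N t => by
    have b1 := abs_le.1 (abs_sum_mul_coef_le hL (hq t).deriv_isL2 (hGL t) N)
    have b2 := abs_le.1 (abs_sum_mul_coef_le hL (hap t).deriv_isL2 (hr t).deriv_isL2 N)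
    simp only [hD, B, hS]
    rw [abs_le]
    constructor <;> linarith [b1.1, b1.2, b2.1, b2.2]
  -- The limit `N → ∞` is taken in the integrated law; the continuity of `E` then permits
  -- differentiation.
  have hint : ∀ t, ip L (deriv (a t)) (deriv (a t))
      = ip L (deriv (a s)) (deriv (a s)) + ∫ τ in s..t, E τ := fun t => by
    have l1 : Tendsto (fun N => ∫ τ in s..t, D N τ) atTop (𝓝 (∫ τ in s..t, E τ)) :=
      intervalIntegral.tendsto_integral_filter_of_dominated_convergence B
        (Eventually.of_forall fun N => (hDc N).aestronglyMeasurable)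
        (Eventually.of_forall fun N => Eventually.of_forall fun τ _ => hDB N τ)
        (hBc.intervalIntegrable _ _) (Eventually.of_forall fun τ _ => hDlim τ)
    have l2 : ∀ N, ∫ τ in s..t, D N τ = X N t - X N s := fun N =>
      intervalIntegral.integral_eq_sub_of_hasDerivAt (fun τ _ => hXd N τ)
        ((hDc N).intervalIntegrable _ _)
    simp_rw [l2] at l1
    have := tendsto_nhds_unique l1 ((hXlim t).sub (hXlim s))
    linarith
  have hfin : HasDerivAt (fun t => ip L (deriv (a s)) (deriv (a s)) + ∫ τ in s..t, E τ) (E s) s :=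
    (hEc.integral_hasStrictDerivAt s s).hasDerivAt.const_add _
  exact hfin.congr_of_eventuallyEq (Eventually.of_forall hint)

end H1

/-! ### Pairs of solutions -/

/-- The flux `-u_xx - u²/2`. -/
noncomputable def flux (u : ℝ → ℝ) : ℝ → ℝ := -deriv (deriv u) - (1 / 2 : ℝ) • (u * u)

section

variable {L γ μ : ℝ} {m : ℕ} {J : Set ℝ} {u w ru rw : ℝ → ℝ → ℝ} {g : ℝ → ℝ → ℝ}

theorem IsH2dot.flux_isL2 {u : ℝ → ℝ} (hu : IsH2dot L u) : IsL2 L (flux u) :=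
  hu.memLp.neg.sub ((hu.perC1.mul hu.perC1).isL2.const_smul _)

theorem ContinuousH2On.tendstoH1 (hL : 0 < L) (hu : ∀ s ∈ J, IsH2dot L (u s))
    (h : ContinuousH2On L J u) {s : ℝ} (hs : J ∈ 𝓝 s) : TendstoH1 L (𝓝 s) u (u s) := by
  have h0 := h s (mem_of_mem_nhds hs)
  rw [nhdsWithin_eq_nhds.2 hs] at h0
  exact tendstoH1_of_h2Norm hL (by filter_upwards [hs] with t ht using hu t ht)
    (hu s (mem_of_mem_nhds hs)) h0

theorem tendsto_flux (hL : 0 < L) (hu : ∀ s ∈ J, IsH2dot L (u s))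
    (h : ContinuousH2On L J u) {s : ℝ} (hs : J ∈ 𝓝 s) :
    Tendsto (fun t => l2Norm L (flux (u t) - flux (u s))) (𝓝 s) (𝓝 0) := by
  have h1 := h.tendstoH1 hL hu hs
  have h2 := ((h1.mul hL h1).smul hL (1 / 2)).l2 hL
  have hs' := mem_of_mem_nhds hs
  have h0 := h s hs'
  rw [nhdsWithin_eq_nhds.2 hs] at h0
  have hlim := h0.add h2
  rw [add_zero] at hlim
  refine squeeze_zero' (Eventually.of_forall fun _ => l2Norm_nonneg _ _) ?_ hlim
  filter_upwards [hs] with t ht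
  have a1 := hu t ht
  have a2 := hu s hs'
  have e : flux (u t) - flux (u s) = -(deriv (deriv (u t)) - deriv (deriv (u s)))
      - ((1 / 2 : ℝ) • (u t * u t) - (1 / 2 : ℝ) • (u s * u s)) := by
    rw [flux, flux]; abel
  rw [e, h2Norm_sub hL a1 a2, ← l2Norm_neg L (deriv (deriv (u t)) - deriv (deriv (u s)))]
  exact l2Norm_sub_le hL (a1.memLp.sub a2.memLp).neg
    (((a1.perC1.mul a1.perC1).smul _).isL2.sub ((a2.perC1.mul a2.perC1).smul _).isL2)

theorem iteratedDeriv_three (φ : ℝ → ℝ) : iteratedDeriv 3 φ = deriv (deriv (deriv φ)) := by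
  simp [iteratedDeriv_succ]

theorem integral_test_eq (hL : 0 < L) (γ : ℝ) {u g φ : ℝ → ℝ} (a : PerC1 L u) (hg : IsL2 L g)
    (p0 : PerC1 L φ) (p1 : PerC1 L (deriv φ)) (p2 : PerC1 L (deriv (deriv φ))) :
    (∫ x in (0 : ℝ)..L, (u x ^ 2 / 2 * deriv φ x + u x * iteratedDeriv 3 φ x
        - γ * u x * φ x + g x * φ x))
      = 1 / 2 * ip L (u * u) (deriv φ) + ip L u (deriv (deriv (deriv φ)))
        - γ * ip L u φ + ip L g φ := by
  have i0 := (a.mul a).isL2.integrable_mul hL p1.isL2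
  have i1 := a.isL2.integrable_mul hL p2.deriv_isL2
  have i2 := a.isL2.integrable_mul hL p0.isL2
  have i3 := hg.integrable_mul hL p0.isL2
  rw [ip, ip, ip, ip, ← intervalIntegral.integral_const_mul, ← intervalIntegral.integral_const_mul,
    ← intervalIntegral.integral_add (i0.const_mul _) i1,
    ← intervalIntegral.integral_sub ((i0.const_mul _).add i1) (i2.const_mul _),
    ← intervalIntegral.integral_add (((i0.const_mul _).add i1).sub (i2.const_mul _)) i3]
  refine intervalIntegral.integral_congr fun x _ => ?_
  simp only [iteratedDeriv_three, Pi.mul_apply]; ring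

/-- Solutions in the sense of distributions are weak evolutions. -/
theorem weakEvol_of_solvesOn (hL : 0 < L) (hJ : IsOpen J) (hu : ∀ s ∈ J, IsH2dot L (u s))
    (hc : ContinuousH2On L J u) (hg : ∀ s ∈ J, IsL2 L (g s))
    (hgc : ∀ s ∈ J, Tendsto (fun t => l2Norm L (g t - g s)) (𝓝 s) (𝓝 0))
    (h : SolvesOn L γ g J u) :
    WeakEvol L J u (fun s => flux (u s)) (fun s => γ • u s - g s) where
  isOpen := hJ
  isL2 s hs := (hu s hs).isL2
  flux_isL2 s hs := (hu s hs).flux_isL2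
  source_isL2 s hs := ((hu s hs).isL2.const_smul γ).sub (hg s hs)
  flux_cont s hs := tendsto_flux hL hu hc (hJ.mem_nhds hs)
  source_cont s hs := by
    have h1 := ((hc.tendstoH1 hL hu (hJ.mem_nhds hs)).smul hL γ).l2 hL
    refine squeeze_zero' (Eventually.of_forall fun _ => l2Norm_nonneg _ _) ?_
      (by simpa using h1.add (hgc s hs))
    filter_upwards [hJ.mem_nhds hs] with t ht
    rw [sub_sub_sub_comm]
    exact l2Norm_sub_le hL (((hu t ht).isL2.const_smul γ).sub ((hu s hs).isL2.const_smul γ))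
      ((hg t ht).sub (hg s hs))
  hasDerivAt φ hφ hp s hs := by
    have h1 := (h φ hφ hp s hs).hasDerivAt (hJ.mem_nhds hs)
    refine h1.congr_deriv ?_
    have a := hu s hs
    have p0 : PerC1 L φ := ⟨hφ.of_le (by exact_mod_cast le_top), hp⟩
    have hφ1 : ContDiff ℝ (⊤ : ℕ∞) (deriv φ) :=
      (contDiff_infty_iff_deriv.1 hφ).2
    have hφ2 : ContDiff ℝ (⊤ : ℕ∞) (deriv (deriv φ)) := (contDiff_infty_iff_deriv.1 hφ1).2
    have p1 : PerC1 L (deriv φ) := ⟨hφ1.of_le (by exact_mod_cast le_top), hp.deriv'⟩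
    have p2 : PerC1 L (deriv (deriv φ)) := ⟨hφ2.of_le (by exact_mod_cast le_top), hp.deriv'.deriv'⟩
    -- Two of the three derivatives go back to `u`, as many as its regularity allows; the third
    -- stays on `φ`, in agreement with the flux form.
    have e1 : ip L (u s) (deriv (deriv (deriv φ))) = ip L (deriv (deriv (u s))) (deriv φ) := by
      rw [a.perC1.perAC.ip_deriv p2.perAC, a.perAC_deriv.ip_deriv p1.perAC, neg_neg]
    rw [integral_test_eq hL γ a.perC1 (hg s hs) p0 p1 p2, e1, weakForm, flux, ip_sub_left hL a.memLp.neg ((a.perC1.mul a.perC1).smul _).isL2 p1.isL2,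
      ip_sub_left hL (a.perC1.smul γ).isL2 (hg s hs) p0.isL2, ip_neg_left, ip_smul_left, ip_smul_left]
    ring

/-- Two solutions whose sources differ by damping and nudging of the difference. -/
structure KdVPair (L γ μ : ℝ) (m : ℕ) (J : Set ℝ) (u w ru rw : ℝ → ℝ → ℝ) : Prop where
  fst : WeakEvol L J u (fun s => flux (u s)) ru
  snd : WeakEvol L J w (fun s => flux (w s)) rw
  fst_mem : ∀ s ∈ J, IsH2dot L (u s)
  snd_mem : ∀ s ∈ J, IsH2dot L (w s)
  fst_cont : ∀ s ∈ J, TendstoH1 L (𝓝 s) u (u s)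
  snd_cont : ∀ s ∈ J, TendstoH1 L (𝓝 s) w (w s)
  source : ∀ s ∈ J, rw s - ru s = γ • (w s - u s) + μ • proj L m (w s - u s)

namespace KdVPair

/-- The nonlinear part of the flux of the difference. -/
noncomputable def nl (u w : ℝ → ℝ) : ℝ → ℝ := u * (w - u) + (1 / 2 : ℝ) • ((w - u) * (w - u))

theorem perC1_nl {u w : ℝ → ℝ} (hu : PerC1 L u) (hw : PerC1 L w) : PerC1 L (nl u w) :=
  (hu.mul (hw.sub hu)).add (((hw.sub hu).mul (hw.sub hu)).smul _)

/-- This is the structure `-a_xx = G + q` required by `WeakEvol.hasDerivAt_ip_deriv_self`, with a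
`C¹` function `q`. -/
theorem flux_sub (hL : 0 < L) {u w : ℝ → ℝ} (hu : IsH2dot L u) (hw : IsH2dot L w) :
    deriv (deriv (w - u)) =ᵐ[volume.restrict (Ioc 0 L)] -((flux w - flux u) + nl u w) := by
  filter_upwards [deriv_deriv_sub hL hw hu] with x hx
  rw [hx]
  simp only [flux, nl, Pi.sub_apply, Pi.neg_apply, Pi.add_apply, Pi.smul_apply, Pi.mul_apply,
    smul_eq_mul]
  ring

theorem diff (h : KdVPair L γ μ m J u w ru rw) (hL : 0 < L) : WeakEvol L J (fun s => w s - u s)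
    (fun s => flux (w s) - flux (u s)) (fun s => rw s - ru s) := h.snd.sub hL h.fst

theorem diff_cont (h : KdVPair L γ μ m J u w ru rw) (hL : 0 < L) {s : ℝ} (hs : s ∈ J) :
    TendstoH1 L (𝓝 s) (fun t => w t - u t) (w s - u s) :=
  ((h.snd_cont s hs).add hL ((h.fst_cont s hs).smul hL (-1))).congr
    (fun t => by simp [sub_eq_add_neg]) (by simp [sub_eq_add_neg])

theorem mem (h : KdVPair L γ μ m J u w ru rw) (hL : 0 < L) {s : ℝ} (hs : s ∈ J) : IsH2dot L (w s - u s) :=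
  (h.snd_mem s hs).sub hL (h.fst_mem s hs)

end KdVPair

end

/-! ### Energy estimates for the difference of two solutions -/

section

variable {L : ℝ} {f g : ℝ → ℝ}

theorem ip_mul_assoc (L : ℝ) (f g h : ℝ → ℝ) : ip L (f * g) h = ip L f (g * h) := by
  simp [ip, mul_assoc]

theorem ip_mul_self_deriv (hf : PerC1 L f) : ip L (f * f) (deriv f) = 0 := by
  have h1 := (hf.mul (hf.mul hf)).perAC.integral_deriv
  rw [hf.deriv_mul (hf.mul hf), hf.deriv_mul hf] at h1
  have e : ∫ x in (0 : ℝ)..L, (deriv f * (f * f) + f * (deriv f * f + f * deriv f)) x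
      = 3 * ip L (f * f) (deriv f) := by
    rw [ip, ← intervalIntegral.integral_const_mul]
    refine intervalIntegral.integral_congr fun x _ => ?_
    simp only [Pi.add_apply, Pi.mul_apply]; ring
  rw [e] at h1; linarith

theorem ip_mul_deriv (hf : PerC1 L f) (hg : PerC1 L g) :
    ip L (g * f) (deriv f) = -(1 / 2) * ip L (deriv g) (f * f) := by
  have h1 := hg.perAC.ip_deriv (hf.mul hf).perAC
  rw [hf.deriv_mul hf] at h1
  have e : ip L g (deriv f * f + f * deriv f) = 2 * ip L (g * f) (deriv f) := by
    rw [ip, ip, ← intervalIntegral.integral_const_mul]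
    refine intervalIntegral.integral_congr fun x _ => ?_
    simp only [Pi.add_apply, Pi.mul_apply]; ring
  rw [e] at h1; linarith

end

namespace KdVPair

variable {L γ μ : ℝ} {m : ℕ} {J : Set ℝ} {u w ru rw : ℝ → ℝ → ℝ}

/-- The self-interaction `δ² δ_x` is a total derivative, so only `u_x` survives. Hence the `L²`
estimate of the difference needs no bound for `w_x`. -/
theorem ip_nl_deriv (hL : 0 < L) {u w : ℝ → ℝ} (hu : PerC1 L u) (hw : PerC1 L w) :
    ip L (nl u w) (deriv (w - u)) = -(1 / 2) * ip L (deriv u) ((w - u) * (w - u)) := by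
  have hd := hw.sub hu
  rw [nl, ip_add_left hL (hu.mul hd).isL2 ((hd.mul hd).smul _).isL2 hd.deriv_isL2, ip_smul_left,
    ip_mul_self_deriv hd, ip_mul_deriv hd hu]
  ring

/-- The `L²` energy of the difference. -/
theorem hasDerivAt_l2 (h : KdVPair L γ μ m J u w ru rw) (hL : 0 < L) {s : ℝ} (hs : s ∈ J) :
    HasDerivAt (fun t => ip L (w t - u t) (w t - u t))
      (-ip L (deriv (u s)) ((w s - u s) * (w s - u s)) - 2 * γ * ip L (w s - u s) (w s - u s)
        - 2 * μ * l2Norm L (proj L m (w s - u s)) ^ 2) s := by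
  refine ((h.diff hL).hasDerivAt_ip_self hL hs (h.diff_cont hL hs)).congr_deriv ?_
  have hu := h.fst_mem s hs
  have hw := h.snd_mem s hs
  have hd := h.mem hL hs
  have hn := perC1_nl hu.perC1 hw.perC1
  have hG := (h.diff hL).flux_isL2 s hs
  have e1 : ip L (flux (w s) - flux (u s)) (deriv (w s - u s))
      = 1 / 2 * ip L (deriv (u s)) ((w s - u s) * (w s - u s)) := by
    have h1 := ip_congr_left hL (flux_sub hL hu hw) (deriv (w s - u s))
    rw [ip_neg_left, ip_add_left hL hG hn.isL2 hd.deriv_isL2, ip_nl_deriv hL hu.perC1 hw.perC1,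
      ip_comm L (deriv (deriv (w s - u s))), ip_deriv_self hd.perAC_deriv] at h1
    linarith
  rw [weakForm, e1, h.source s hs, ip_add_left hL (hd.isL2.const_smul γ)
    ((isL2_proj L m _).const_smul μ) hd.isL2, ip_smul_left, ip_smul_left,
    ip_comm L (proj L m _), ip_self_proj hL hd.isL2]
  ring

/-- The cubic part of the Hamiltonian of the difference. -/
theorem hasDerivAt_cubic (h : KdVPair L γ μ m J u w ru rw) (hL : 0 < L) {s : ℝ} (hs : s ∈ J) :
    HasDerivAt (fun t => ip L (u t) ((w t - u t) * (w t - u t))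
        + 1 / 3 * ip L (w t - u t) ((w t - u t) * (w t - u t)))
      (weakForm L (flux (u s)) (ru s) ((w s - u s) * (w s - u s))
        + 2 * weakForm L (flux (w s) - flux (u s)) (rw s - ru s) (nl (u s) (w s))) s := by
  have hdc := h.diff_cont hL hs
  have hu := (h.fst_mem s hs).perC1
  have hd := (h.mem hL hs).perC1
  have hE := h.diff hL
  -- The increment of the cubic expression splits into one increment of `u`, tested with `δ(t)²`,
  -- and increments of `δ`, tested with `u(s)(δ(t) + δ(s))` and with `δ(t)² + δ(t)δ(s) + δ(s)²`.
  -- Each is covered by the rule for moving test functions.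
  have d1 := h.fst.hasDerivAt_ip_sub hL hs (hdc.mul hL hdc)
  have d2 := hE.hasDerivAt_ip_sub hL hs
    ((TendstoH1.const hu).mul hL (hdc.add hL (TendstoH1.const hd)))
  have d3 := hE.hasDerivAt_ip_sub hL hs ((hdc.mul hL hdc).add hL
    ((hdc.mul hL (TendstoH1.const hd)).add hL (TendstoH1.const (hd.mul hd))))
  have d := ((d1.add d2).add (d3.const_mul (1 / 3))).add_const
    (ip L (u s) ((w s - u s) * (w s - u s)) + 1 / 3 * ip L (w s - u s) ((w s - u s) * (w s - u s)))
  refine (d.congr_of_eventuallyEq ?_).congr_deriv ?_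
  · filter_upwards [h.fst.isOpen.mem_nhds hs] with t ht
    have hut := (h.fst_mem t ht).perC1
    have hdt := (h.mem hL ht).perC1
    simp only [Pi.add_apply]
    have k1 : ip L (u t - u s) ((w t - u t) * (w t - u t))
        = ip L (u t) ((w t - u t) * (w t - u t)) - ip L (u s) ((w t - u t) * (w t - u t)) :=
      ip_sub_left hL hut.isL2 hu.isL2 (hdt.mul hdt).isL2
    have k2 : ip L (w t - u t - (w s - u s)) (u s * (w t - u t + (w s - u s)))
        = ip L (u s) ((w t - u t) * (w t - u t)) - ip L (u s) ((w s - u s) * (w s - u s)) := by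
      rw [← ip_sub_right hL (hdt.mul hdt).isL2 (hd.mul hd).isL2 hu.isL2]
      refine intervalIntegral.integral_congr fun x _ => ?_
      simp only [Pi.add_apply, Pi.mul_apply, Pi.sub_apply]; ring
    have k3 : ip L (w t - u t - (w s - u s)) ((w t - u t) * (w t - u t)
          + ((w t - u t) * (w s - u s) + (w s - u s) * (w s - u s)))
        = ip L (w t - u t) ((w t - u t) * (w t - u t))
          - ip L (w s - u s) ((w s - u s) * (w s - u s)) := by
      rw [ip, ip, ip, ← intervalIntegral.integral_sub (hdt.isL2.integrable_mul hL (hdt.mul hdt).isL2)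
        (hd.isL2.integrable_mul hL (hd.mul hd).isL2)]
      refine intervalIntegral.integral_congr fun x _ => ?_
      simp only [Pi.add_apply, Pi.mul_apply, Pi.sub_apply]; ring
    rw [k1, k2, k3]; ring
  · have hGL := hE.flux_isL2 s hs
    have hrL := hE.source_isL2 s hs
    set A := weakForm L (flux (w s) - flux (u s)) (rw s - ru s) with hA
    have a1 : A (u s * (w s - u s + (w s - u s))) = 2 * A (u s * (w s - u s)) := by
      rw [hA, ← weakForm_smul L 2 _ _ (hu.mul hd)]
      congr 1; funext x
      simp only [Pi.add_apply, Pi.mul_apply, Pi.sub_apply, Pi.smul_apply, smul_eq_mul]; ring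
    have a2 : A ((w s - u s) * (w s - u s)
        + ((w s - u s) * (w s - u s) + (w s - u s) * (w s - u s)))
        = 3 * A ((w s - u s) * (w s - u s)) := by
      rw [hA, ← weakForm_smul L 3 _ _ (hd.mul hd)]
      congr 1; funext x
      simp only [Pi.add_apply, Pi.mul_apply, Pi.sub_apply, Pi.smul_apply, smul_eq_mul]; ring
    have a3 : A (nl (u s) (w s)) = A (u s * (w s - u s)) + 1 / 2 * A ((w s - u s) * (w s - u s)) := by
      rw [hA, ← weakForm_smul L (1 / 2) _ _ (hd.mul hd)]
      exact weakForm_add hL hGL hrL (hu.mul hd) ((hd.mul hd).smul _)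
    rw [a1, a2, a3]; ring

/-- The Hamiltonian of the difference, whose evolution does not contain the flux. -/
noncomputable def ham (L : ℝ) (u w : ℝ → ℝ) : ℝ :=
  ip L (deriv (w - u)) (deriv (w - u)) - (ip L u ((w - u) * (w - u))
    + 1 / 3 * ip L (w - u) ((w - u) * (w - u)))

/-- The variational derivative of the cubic part with respect to `δ` is `2 nl`. Therefore the
quadratic and the cubic part both pair the flux of `δ` with the derivative of `nl`, and these
pairings cancel. What is left involves `δ`, its derivative, the sources and the flux of `u`, so no
`H²` norm of `δ` is needed to bound it. -/
theorem hasDerivAt_ham (h : KdVPair L γ μ m univ u w ru rw) (hL : 0 < L) (s : ℝ) :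
    HasDerivAt (fun t => ham L (u t) (w t))
      (-weakForm L (flux (u s)) (ru s) ((w s - u s) * (w s - u s))
        - 2 * ip L (deriv (w s - u s)) (deriv (rw s - ru s))
        + 2 * ip L (rw s - ru s) (nl (u s) (w s))) s := by
  have hcu := fun s => h.fst_cont s (mem_univ s)
  have hcd := fun s => h.diff_cont hL (mem_univ s)
  have hnl : ∀ s, TendstoH1 L (𝓝 s) (fun t => nl (u t) (w t)) (nl (u s) (w s)) := fun s =>
    ((hcu s).mul hL (hcd s)).add hL (((hcd s).mul hL (hcd s)).smul hL (1 / 2))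
  have hsrc : ∀ s, TendstoH1 L (𝓝 s) (fun t => rw t - ru t) (rw s - ru s) := fun s => by
    have hmem := fun s => h.mem hL (mem_univ s)
    -- Only finitely many modes occur, so uniform convergence follows from that of the coefficients.
    have hp : TendstoH1 L (𝓝 s) (fun t => proj L m (w t - u t)) (proj L m (w s - u s)) := by
      have hpd : ∀ t, IsL2 L (w t - u t) := fun t => (hmem t).isL2
      refine ⟨Eventually.of_forall fun t => perC1_proj hL m _, perC1_proj hL m _, ?_, ?_⟩
      · have hb : ∀ t x, |proj L m (w t - u t) x - proj L m (w s - u s) x|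
            ≤ ∑ k ∈ Finset.range m, 2 / L * (|cosCoef L (k + 1) (w t - u t - (w s - u s))|
              + |sinCoef L (k + 1) (w t - u t - (w s - u s))|) := fun t x => by
          rw [← Pi.sub_apply, ← proj_sub hL (hpd t) (hpd s), proj_eq, Finset.sum_apply]
          refine (Finset.abs_sum_le_sum_abs _ _).trans (Finset.sum_le_sum fun k _ => ?_)
          have hL2 : 0 ≤ 2 / L := by positivity
          simp only [Pi.add_apply, Pi.smul_apply, smul_eq_mul]
          refine (abs_add_le _ _).trans ?_
          rw [abs_mul, abs_mul, abs_mul, abs_mul, abs_of_nonneg hL2, mul_add]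
          have c1 : |cosMode L (k + 1) x| ≤ 1 := Real.abs_cos_le_one _
          have c2 : |sinMode L (k + 1) x| ≤ 1 := Real.abs_sin_le_one _
          exact add_le_add (mul_le_of_le_one_right (by positivity) c1)
            (mul_le_of_le_one_right (by positivity) c2)
        refine ⟨_, ?_, Eventually.of_forall hb⟩
        have hz := (hcd s).l2 hL
        have h0 : ∀ k, Tendsto (fun t => 2 / L * (|cosCoef L (k + 1) (w t - u t - (w s - u s))|
              + |sinCoef L (k + 1) (w t - u t - (w s - u s))|)) (𝓝 s) (𝓝 0) := fun k => by
          have z1 : Tendsto (fun t => cosCoef L (k + 1) (w t - u t - (w s - u s))) (𝓝 s) (𝓝 0) := by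
            have := tendsto_ip hL (l := 𝓝 s) (F := fun t => w t - u t - (w s - u s))
              (f := 0) (MemLp.zero) (isL2_cosMode L (k + 1))
              (Eventually.of_forall fun t => (hpd t).sub (hpd s))
              (Eventually.of_forall fun _ => isL2_cosMode L (k + 1)) (by simpa using hz)
              (by simp [l2Norm_zero])
            simpa [ip] using! this
          have z2 : Tendsto (fun t => sinCoef L (k + 1) (w t - u t - (w s - u s))) (𝓝 s) (𝓝 0) := by
            have := tendsto_ip hL (l := 𝓝 s) (F := fun t => w t - u t - (w s - u s))
              (f := 0) (MemLp.zero) (isL2_sinMode L (k + 1))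
              (Eventually.of_forall fun t => (hpd t).sub (hpd s))
              (Eventually.of_forall fun _ => isL2_sinMode L (k + 1)) (by simpa using hz)
              (by simp [l2Norm_zero])
            simpa [ip] using! this
          simpa using (z1.abs.add z2.abs).const_mul (2 / L)
        simpa using tendsto_finsetSum (Finset.range m) fun k _ => h0 k
      · refine squeeze_zero (fun _ => l2Norm_nonneg _ _) (fun t => ?_) (hcd s).der
        rw [deriv_proj hL (hmem t).perC1.perAC, deriv_proj hL (hmem s).perC1.perAC,
          ← proj_sub hL (hmem t).deriv_isL2 (hmem s).deriv_isL2]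
        exact l2Norm_proj_le hL ((hmem t).deriv_isL2.sub (hmem s).deriv_isL2) m
    exact (((hcd s).smul hL γ).add hL (hp.smul hL μ)).congr
      (fun t => h.source t (mem_univ t)) (h.source s (mem_univ s))
  have d1 := (h.diff hL).hasDerivAt_ip_deriv_self hL (fun s => h.mem hL (mem_univ s)) hcd hnl hsrc
    (fun s => flux_sub hL (h.fst_mem s (mem_univ s)) (h.snd_mem s (mem_univ s))) s
  refine (d1.sub (h.hasDerivAt_cubic hL (mem_univ s))).congr_deriv ?_
  rw [weakForm, weakForm, ip_comm L (deriv (nl (u s) (w s)))]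
  ring

/-- The damped evolution inequality for the Hamiltonian of the difference. -/
theorem ham_deriv_le (h : KdVPair L γ μ m univ u w ru rw) (hL : 0 < L) (hγ : 0 < γ) (hμ : 0 ≤ μ)
    (s : ℝ) {D₀ D₁ d U b₁ b₀ : ℝ} (hd : 0 ≤ d) (hU : 0 ≤ U) (hD₀ : l2Norm L (w s - u s) ≤ D₀)
    (hD₁ : l2Norm L (deriv (w s - u s)) ≤ D₁) (hdx : ∀ x, |(w s - u s) x| ≤ d)
    (hUx : ∀ x, |u s x| ≤ U) (hb₁ : l2Norm L (flux (u s)) ≤ b₁) (hb₀ : l2Norm L (ru s) ≤ b₀) :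
    -weakForm L (flux (u s)) (ru s) ((w s - u s) * (w s - u s))
        - 2 * ip L (deriv (w s - u s)) (deriv (rw s - ru s))
        + 2 * ip L (rw s - ru s) (nl (u s) (w s))
      ≤ -(2 * γ) * ham L (u s) (w s) + (2 * b₁ * d * D₁ + b₀ * d * D₀ + γ / 3 * (d * D₀ ^ 2)
        + 2 * μ * ((U + d / 2) * D₀ ^ 2)) := by
  have hs := mem_univ s
  have hu := (h.fst_mem s hs)
  have hδ := h.mem hL hs
  have hp := hδ.perC1
  set δ := w s - u s with hδdef
  have hsq := hp.mul hp
  have n0 := l2Norm_nonneg L δ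
  have n1 := l2Norm_nonneg L (deriv δ)
  have m1 : l2Norm L (δ * δ) ≤ d * D₀ := (l2Norm_mul_le hL hp.isL2 hp.continuous hdx).trans (by gcongr)
  have m2 : l2Norm L (δ * deriv δ) ≤ d * D₁ :=
    (l2Norm_mul_le hL hp.deriv_isL2 hp.continuous hdx).trans (by gcongr)
  have m3 : l2Norm L (u s * δ) ≤ U * D₀ :=
    (l2Norm_mul_le hL hp.isL2 hu.perC1.continuous hUx).trans (by gcongr)
  have m4 : l2Norm L (nl (u s) (w s)) ≤ (U + d / 2) * D₀ := by
    refine (l2Norm_add_le hL (hu.perC1.mul hp).isL2 (hsq.smul _).isL2).trans ?_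
    rw [l2Norm_smul, abs_of_pos (by norm_num : (0 : ℝ) < 1 / 2)]
    linarith
  have hfl := h.fst.flux_isL2 s hs
  have hrl := h.fst.source_isL2 s hs
  have hbb1 := (l2Norm_nonneg L _).trans hb₁
  have hbb0 := (l2Norm_nonneg L _).trans hb₀
  -- Here `u_s` is paired with `δ²`. Through the flux this costs one derivative of `δ²` and only the
  -- `H²` bound for `u`.
  have t1 : -weakForm L (flux (u s)) (ru s) (δ * δ) ≤ 2 * b₁ * d * D₁ + b₀ * d * D₀ := by
    have e : deriv (δ * δ) = (2 : ℝ) • (δ * deriv δ) := by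
      rw [hp.deriv_mul hp]; funext x
      simp only [Pi.add_apply, Pi.mul_apply, Pi.smul_apply, smul_eq_mul]; ring
    rw [weakForm, e, ip_smul_right]
    have i1 := ip_le hL hfl (hp.deriv_isL2.mul_continuous hp.continuous)
    have i2 := ip_le hL hrl hsq.isL2
    have i3 := mul_le_mul hb₁ m2 (l2Norm_nonneg _ _) hbb1
    have i4 := mul_le_mul hb₀ m1 (l2Norm_nonneg _ _) hbb0
    nlinarith
  have hP := isL2_proj L m δ
  have t2 : ip L (deriv δ) (deriv (rw s - ru s))
      = γ * ip L (deriv δ) (deriv δ) + μ * l2Norm L (proj L m (deriv δ)) ^ 2 := by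
    rw [h.source s hs, (hp.smul γ).deriv_add ((perC1_proj hL m δ).smul μ), hp.deriv_smul,
      (perC1_proj hL m δ).deriv_smul, deriv_proj hL hp.perAC,
      ip_add_right hL (hp.deriv_isL2.const_smul γ) ((isL2_proj L m _).const_smul μ) hp.deriv_isL2,
      ip_smul_right, ip_smul_right, ip_self_proj hL hp.deriv_isL2]
  have hn := perC1_nl hu.perC1 (h.snd_mem s hs).perC1
  have t3 : ip L (rw s - ru s) (nl (u s) (w s))
      = γ * (ip L (u s) (δ * δ) + 1 / 2 * ip L δ (δ * δ)) + μ * ip L (proj L m δ) (nl (u s) (w s)) := by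
    rw [h.source s hs, ip_add_left hL (hp.isL2.const_smul γ) (hP.const_smul μ) hn.isL2,
      ip_smul_left, ip_smul_left]
    have : ip L δ (nl (u s) (w s)) = ip L (u s) (δ * δ) + 1 / 2 * ip L δ (δ * δ) := by
      rw [nl, ip_add_right hL (hu.perC1.mul hp).isL2 (hsq.smul _).isL2 hp.isL2,
        ip_smul_right, ip_comm L δ (u s * δ), ip_mul_assoc]
    rw [this]
  have t4 : ip L (proj L m δ) (nl (u s) (w s)) ≤ (U + d / 2) * D₀ ^ 2 := by
    have i1 := ip_le hL hP hn.isL2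
    have i2 := mul_le_mul ((l2Norm_proj_le hL hp.isL2 m).trans hD₀) m4 (l2Norm_nonneg _ _)
      (n0.trans hD₀)
    nlinarith
  have t5 : ip L δ (δ * δ) ≤ d * D₀ ^ 2 := by
    have i1 := ip_le hL hp.isL2 hsq.isL2
    have i2 := mul_le_mul hD₀ m1 (l2Norm_nonneg _ _) (n0.trans hD₀)
    nlinarith
  -- Once `-2γ` times the Hamiltonian is split off, the damping leaves `2γ(1/2 - 1/3) ∫ δ³`, hence
  -- the coefficient `γ/3`. The nudging of `δ_x` has a favourable sign and is dropped (`q3`).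
  rw [t2, t3, ham, ← hδdef]
  have q1 := mul_le_mul_of_nonneg_left t4 hμ
  have q2 := mul_le_mul_of_nonneg_left t5 hγ.le
  have q3 : 0 ≤ μ * l2Norm L (proj L m (deriv δ)) ^ 2 := by positivity
  nlinarith

end KdVPair

/-! ### Damped inequalities on the whole time axis and the resulting bounds -/

/-- A bounded quantity that is damped for all times is controlled by the forcing. -/
theorem le_of_forall_hasDerivAt_le {E E' : ℝ → ℝ} {k B : ℝ} (hk : 0 < k)
    (hE : ∀ s, HasDerivAt E (E' s) s) (hle : ∀ s, E' s ≤ -k * E s + B)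
    (hbd : BddAbove (range E)) (s : ℝ) : E s ≤ B / k := by
  by_contra hcon
  push Not at hcon
  obtain ⟨M, hM⟩ := hbd
  have hM' : ∀ t, E t ≤ M := fun t => hM (mem_range_self t)
  -- `F` is nonincreasing. If it is positive at `s`, then `E - B/k` must grow at least like `exp (k
  -- (s - t))` as `t → -∞`, against the boundedness of `E`.
  set F : ℝ → ℝ := fun t => (E t - B / k) * Real.exp (k * t)
  have hF : ∀ t, HasDerivAt F ((E' t + k * (E t - B / k)) * Real.exp (k * t)) t := fun t => by
    have h1 := ((hE t).sub_const (B / k)).mul (((hasDerivAt_id t).const_mul k).exp)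
    refine h1.congr_deriv ?_
    simp; ring
  have hanti : Antitone F := antitone_of_hasDerivAt_nonpos hF fun t => by
    refine mul_nonpos_of_nonpos_of_nonneg ?_ (Real.exp_pos _).le
    have : k * (B / k) = B := by field_simp
    have := hle t
    nlinarith
  have hc : 0 < E s - B / k := by linarith
  have hMpos : 0 < M - B / k := by linarith [hM' s]
  have hlim : Tendsto (fun T : ℝ => (M - B / k) * Real.exp (k * (s - T))) atTop (𝓝 0) := by
    have h1 : Tendsto (fun T : ℝ => k * (s - T)) atTop atBot :=
      Tendsto.const_mul_atBot hk (tendsto_atBot_add_const_left _ s tendsto_neg_atTop_atBot)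
    simpa using (Real.tendsto_exp_atBot.comp h1).const_mul (M - B / k)
  have hlow : ∀ᶠ T : ℝ in atTop, (E s - B / k) * Real.exp (k * s)
      ≤ (M - B / k) * Real.exp (k * (s - T)) := by
    filter_upwards [eventually_ge_atTop 0] with T hT
    have h1 := hanti (show s - T ≤ s by linarith)
    refine h1.trans (mul_le_mul_of_nonneg_right ?_ (Real.exp_pos _).le)
    linarith [hM' (s - T)]
  have := ge_of_tendsto hlim hlow
  have h2 : 0 < (E s - B / k) * Real.exp (k * s) := mul_pos hc (Real.exp_pos _)
  linarith

namespace KdVPair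

variable {L γ μ : ℝ} {m : ℕ} {u w ru rw : ℝ → ℝ → ℝ}

/-- The `H¹` estimate for the difference of two bounded complete solutions. -/
theorem deriv_sq_le (h : KdVPair L γ μ m univ u w ru rw) (hL : 0 < L) (hγ : 0 < γ) (hμ : 0 ≤ μ)
    {D₀ D₁ d U b₁ b₀ : ℝ} (hd : 0 ≤ d) (hU : 0 ≤ U) (hD₀ : ∀ s, l2Norm L (w s - u s) ≤ D₀)
    (hD₁ : ∀ s, l2Norm L (deriv (w s - u s)) ≤ D₁) (hdx : ∀ s x, |(w s - u s) x| ≤ d)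
    (hUx : ∀ s x, |u s x| ≤ U) (hb₁ : ∀ s, l2Norm L (flux (u s)) ≤ b₁)
    (hb₀ : ∀ s, l2Norm L (ru s) ≤ b₀) (s : ℝ) :
    l2Norm L (deriv (w s - u s)) ^ 2 ≤ (2 * b₁ * d * D₁ + b₀ * d * D₀ + γ / 3 * (d * D₀ ^ 2)
        + 2 * μ * ((U + d / 2) * D₀ ^ 2)) / (2 * γ) + (U + d / 3) * D₀ ^ 2 := by
  have hcub : ∀ s, |ip L (u s) ((w s - u s) * (w s - u s))
      + 1 / 3 * ip L (w s - u s) ((w s - u s) * (w s - u s))| ≤ (U + d / 3) * D₀ ^ 2 := fun s => by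
    have hs := mem_univ s
    have hp := (h.mem hL hs).perC1
    have hu := (h.fst_mem s hs).perC1
    have n0 := l2Norm_nonneg L (w s - u s)
    have m1 : l2Norm L ((w s - u s) * (w s - u s)) ≤ d * D₀ :=
      (l2Norm_mul_le hL hp.isL2 hp.continuous (hdx s)).trans
        (mul_le_mul_of_nonneg_left (hD₀ s) hd)
    have m3 : l2Norm L (u s * (w s - u s)) ≤ U * D₀ :=
      (l2Norm_mul_le hL hp.isL2 hu.continuous (hUx s)).trans
        (mul_le_mul_of_nonneg_left (hD₀ s) hU)
    have i1 := abs_ip_le hL hp.isL2 (hp.mul hp).isL2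
    have i2 := abs_ip_le hL (hu.mul hp).isL2 hp.isL2
    rw [ip_mul_assoc] at i2
    have j1 := mul_le_mul (hD₀ s) m1 (l2Norm_nonneg _ _) (n0.trans (hD₀ s))
    have j2 := mul_le_mul m3 (hD₀ s) n0 (mul_nonneg hU (n0.trans (hD₀ s)))
    rw [abs_le] at i1 i2 ⊢
    constructor <;> nlinarith [i1.1, i1.2, i2.1, i2.2]
  have hham := le_of_forall_hasDerivAt_le (E := fun t => ham L (u t) (w t)) (k := 2 * γ)
    (by positivity) (h.hasDerivAt_ham hL)
    (fun s => h.ham_deriv_le hL hγ hμ s hd hU (hD₀ s) (hD₁ s) (hdx s) (hUx s) (hb₁ s) (hb₀ s))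
    (by
      refine ⟨D₁ ^ 2 + (U + d / 3) * D₀ ^ 2, ?_⟩
      rintro _ ⟨s, rfl⟩
      have := abs_le.1 (hcub s)
      have h2 : l2Norm L (deriv (w s - u s)) ^ 2 ≤ D₁ ^ 2 :=
        pow_le_pow_left₀ (l2Norm_nonneg _ _) (hD₁ s) 2
      rw [l2Norm_sq hL] at h2
      simp only [ham]
      linarith [this.1]) s
  have := abs_le.1 (hcub s)
  rw [l2Norm_sq hL]
  simp only [ham] at hham
  linarith [this.2]

end KdVPair

/-! ### Solutions of the damped and driven equation and of the nudged equation -/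

section

variable {L γ μ : ℝ} {m : ℕ} {J J' : Set ℝ} {f : ℝ → ℝ} {u w r : ℝ → ℝ → ℝ}

theorem IsKdVSolutionOn.mono (h : IsKdVSolutionOn L γ f J u) (hJ : J' ⊆ J) :
    IsKdVSolutionOn L γ f J' u where
  mem s hs := h.mem s (hJ hs)
  continuous s hs := (h.continuous s (hJ hs)).mono_left (nhdsWithin_mono s hJ)
  solves φ hφ hp s hs := (h.solves φ hφ hp s (hJ hs)).mono hJ

theorem IsKdVSolutionOn.weakEvol (hL : 0 < L) (hf : IsH2dot L f) (hJ : IsOpen J)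
    (h : IsKdVSolutionOn L γ f J u) :
    WeakEvol L J u (fun s => flux (u s)) (fun s => γ • u s - f) :=
  weakEvol_of_solvesOn hL hJ h.mem h.continuous (fun _ _ => hf.isL2)
    (fun _ _ => by simp [l2Norm_zero]) h.solves

/-- Without nudging the sources differ by damping alone; as `μ = 0`, the cut-off is immaterial and
set to zero. -/
theorem IsKdVSolutionOn.kdvPair (hL : 0 < L) (hf : IsH2dot L f) (hJ : IsOpen J)
    (hu : IsKdVSolutionOn L γ f J u) (hw : IsKdVSolutionOn L γ f J w) :
    KdVPair L γ 0 0 J u w (fun s => γ • u s - f) (fun s => γ • w s - f) where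
  fst := hu.weakEvol hL hf hJ
  snd := hw.weakEvol hL hf hJ
  fst_mem := hu.mem
  snd_mem := hw.mem
  fst_cont _ hs := hu.continuous.tendstoH1 hL hu.mem (hJ.mem_nhds hs)
  snd_cont _ hs := hw.continuous.tendstoH1 hL hw.mem (hJ.mem_nhds hs)
  source s _ := by
    funext x
    simp only [Pi.sub_apply, Pi.smul_apply, Pi.add_apply, smul_eq_mul]; ring

theorem IsBoundedSolution.kdvPair (hL : 0 < L) (hf : IsH2dot L f)
    (hu : IsKdVSolutionOn L γ f univ u)
    (hw : IsBoundedSolution L γ μ m f (fun s => proj L m (u s)) w) :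
    KdVPair L γ μ m univ u w (fun s => γ • u s - f)
      (fun s => γ • w s - fun x => f x - μ * (proj L m (w s) x - proj L m (u s) x)) where
  fst := hu.weakEvol hL hf isOpen_univ
  snd := by
    have hwm := fun s => hw.memY.mem s
    have hum := fun s => hu.mem s (mem_univ s)
    refine weakEvol_of_solvesOn hL isOpen_univ (fun s _ => hwm s) hw.memY.continuous
      (fun s _ => ?_) (fun s _ => ?_) hw.solves
    · exact (hf.perC1.continuous.sub (continuous_const.mul ((perC1_proj hL m _).continuous.sub
        (perC1_proj hL m _).continuous))).isL2
    · have c1 := (hu.continuous.tendstoH1 hL hu.mem (univ_mem (f := 𝓝 s))).l2 hL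
      have c2 := (hw.memY.continuous.tendstoH1 hL (fun s _ => hwm s) (univ_mem (f := 𝓝 s))).l2 hL
      have hlim := (c2.add c1).const_mul |μ|
      rw [add_zero, mul_zero] at hlim
      refine squeeze_zero (fun _ => l2Norm_nonneg _ _) (fun t => ?_) hlim
      have e : ((fun x => f x - μ * (proj L m (w t) x - proj L m (u t) x))
          - fun x => f x - μ * (proj L m (w s) x - proj L m (u s) x))
          = (-μ) • (proj L m (w t - w s) - proj L m (u t - u s)) := by
        rw [proj_sub hL (hwm t).isL2 (hwm s).isL2, proj_sub hL (hum t).isL2 (hum s).isL2]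
        funext x
        simp only [Pi.sub_apply, Pi.smul_apply, smul_eq_mul]; ring
      rw [e, l2Norm_smul, abs_neg]
      exact mul_le_mul_of_nonneg_left ((l2Norm_sub_le hL (isL2_proj _ _ _) (isL2_proj _ _ _)).trans
        (add_le_add (l2Norm_proj_le hL ((hwm t).isL2.sub (hwm s).isL2) m)
          (l2Norm_proj_le hL ((hum t).isL2.sub (hum s).isL2) m))) (abs_nonneg _)
  fst_mem := hu.mem
  snd_mem s _ := hw.memY.mem s
  fst_cont s _ := hu.continuous.tendstoH1 hL hu.mem univ_mem
  snd_cont s _ := hw.memY.continuous.tendstoH1 hL (fun s _ => hw.memY.mem s) univ_mem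
  source s _ := by
    rw [proj_sub hL (hw.memY.mem s).isL2 (hu.mem s (mem_univ s)).isL2]
    funext x
    simp only [Pi.sub_apply, Pi.smul_apply, Pi.add_apply, smul_eq_mul]; ring

theorem ip_flux_deriv (hL : 0 < L) {u : ℝ → ℝ} (hu : IsH2dot L u) :
    ip L (flux u) (deriv u) = 0 := by
  rw [flux, ip_sub_left hL hu.memLp.neg ((hu.perC1.mul hu.perC1).smul _).isL2 hu.deriv_isL2,
    ip_neg_left, ip_smul_left, ip_mul_self_deriv hu.perC1, ip_comm, ip_deriv_self hu.perAC_deriv]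
  ring

theorem WeakEvol.hasDerivAt_energy (hL : 0 < L) (h : WeakEvol L J u (fun s => flux (u s)) r)
    (hu : ∀ s ∈ J, IsH2dot L (u s)) (hc : ∀ s ∈ J, TendstoH1 L (𝓝 s) u (u s)) {s : ℝ} (hs : s ∈ J) :
    HasDerivAt (fun t => ip L (u t) (u t)) (-2 * ip L (r s) (u s)) s := by
  refine (h.hasDerivAt_ip_self hL hs (hc s hs)).congr_deriv ?_
  rw [weakForm, ip_flux_deriv hL (hu s hs)]; ring

theorem bddAbove_ip_self (hL : 0 < L) (hu : ∀ s, IsH2dot L (u s))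
    (hb : BddAbove (range fun s => h2Norm L (u s))) : BddAbove (range fun s => ip L (u s) (u s)) := by
  obtain ⟨M, hM⟩ := hb
  refine ⟨((L / (2 * Real.pi)) ^ 2 * M) ^ 2, ?_⟩
  rintro _ ⟨s, rfl⟩
  have h1 := (hu s).l2Norm_le hL
  have h2 : h2Norm L (u s) ≤ M := hM ⟨s, rfl⟩
  have h3 : l2Norm L (u s) ≤ (L / (2 * Real.pi)) ^ 2 * M :=
    h1.trans (mul_le_mul_of_nonneg_left h2 (sq_nonneg _))
  change ip L (u s) (u s) ≤ _
  rw [← l2Norm_sq hL]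
  exact pow_le_pow_left₀ (l2Norm_nonneg _ _) h3 2

/-- The `L²` bound for bounded complete solutions. -/
theorem IsKdVSolutionOn.l2Norm_le (hL : 0 < L) (hγ : 0 < γ) (hf : IsH2dot L f)
    (hu : IsKdVSolutionOn L γ f univ u) (hb : BddAbove (range fun s => h2Norm L (u s))) (s : ℝ) :
    l2Norm L (u s) ≤ l2Norm L f / γ := by
  have hum := fun s => hu.mem s (mem_univ s)
  have hp := hu.kdvPair hL hf isOpen_univ hu
  have hle := le_of_forall_hasDerivAt_le hγ (fun s => hp.fst.hasDerivAt_energy hL hu.mem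
    hp.fst_cont (mem_univ s)) (B := l2Norm L f ^ 2 / γ) (fun s => ?_)
    (bddAbove_ip_self hL hum hb) s
  · rw [div_div, ← l2Norm_sq hL, ← pow_two, ← div_pow] at hle
    exact (le_abs_self _).trans (abs_le_of_sq_le_sq hle (div_nonneg (l2Norm_nonneg _ _) hγ.le))
  · rw [ip_sub_left hL ((hum s).isL2.const_smul γ) hf.isL2 (hum s).isL2, ip_smul_left,
      ← l2Norm_sq hL]
    have h1 := ip_le hL hf.isL2 (hum s).isL2
    have h2 : 2 * (l2Norm L f * l2Norm L (u s)) ≤ l2Norm L f ^ 2 / γ + γ * l2Norm L (u s) ^ 2 := by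
      rw [← sub_nonneg]
      have : l2Norm L f ^ 2 / γ + γ * l2Norm L (u s) ^ 2 - 2 * (l2Norm L f * l2Norm L (u s))
        = (l2Norm L f - γ * l2Norm L (u s)) ^ 2 / γ := by field_simp; ring
      rw [this]; positivity
    linarith

/-- The `L²` bound for bounded complete solutions of the nudged equation. -/
theorem IsBoundedSolution.l2Norm_sq_le (hL : 0 < L) (hγ : 0 < γ) (hμ : 0 ≤ μ) (hf : IsH2dot L f)
    (hu : IsKdVSolutionOn L γ f univ u) (hb : BddAbove (range fun s => h2Norm L (u s)))
    (hw : IsBoundedSolution L γ μ m f (fun s => proj L m (u s)) w) (s : ℝ) :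
    l2Norm L (w s) ^ 2 ≤ (1 + μ / (2 * γ)) * (l2Norm L f / γ) ^ 2 := by
  have hum := fun s => hu.mem s (mem_univ s)
  have hwm := hw.memY.mem
  have hp := hw.kdvPair hL hf hu
  set F := l2Norm L f / γ with hF
  have hle := le_of_forall_hasDerivAt_le hγ (fun s => hp.snd.hasDerivAt_energy hL hp.snd_mem
    hp.snd_cont (mem_univ s)) (B := (γ + μ / 2) * F ^ 2) (fun s => ?_)
    (bddAbove_ip_self hL hwm hw.memY.bounded) s
  · rw [← l2Norm_sq hL] at hle
    refine hle.trans (le_of_eq ?_)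
    field_simp
  · have e : (γ • w s - fun x => f x - μ * (proj L m (w s) x - proj L m (u s) x))
        = (γ • w s - f) + μ • (proj L m (w s) - proj L m (u s)) := by
      funext x
      simp only [Pi.sub_apply, Pi.smul_apply, Pi.add_apply, smul_eq_mul]; ring
    have i1 : IsL2 L (γ • w s) := (hwm s).isL2.const_smul γ
    have i2 := isL2_proj L m (w s)
    have i3 := isL2_proj L m (u s)
    rw [e, ip_add_left hL (i1.sub hf.isL2) ((i2.sub i3).const_smul μ) (hwm s).isL2,
      ip_sub_left hL i1 hf.isL2 (hwm s).isL2, ip_smul_left, ip_smul_left,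
      ip_sub_left hL i2 i3 (hwm s).isL2, ip_comm L (proj L m (w s)), ip_self_proj hL (hwm s).isL2,
      ← ip_proj_comm hL (hum s).isL2 (hwm s).isL2, ← l2Norm_sq hL]
    have h1 := ip_le hL hf.isL2 (hwm s).isL2
    have h2 : 2 * (l2Norm L f * l2Norm L (w s)) ≤ γ * F ^ 2 + γ * l2Norm L (w s) ^ 2 := by
      have : l2Norm L f = γ * F := by rw [hF]; field_simp
      rw [this]
      nlinarith [mul_nonneg hγ.le (sq_nonneg (F - l2Norm L (w s)))]
    have h3 := ip_le hL (hum s).isL2 i2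
    have h4 := mul_le_mul_of_nonneg_right (hu.l2Norm_le hL hγ hf hb s)
      (l2Norm_nonneg L (proj L m (w s)))
    rw [← hF] at h4
    -- Completing the square: the dissipative part of the nudging absorbs the pull towards `P_m u`,
    -- up to `F²/2`.
    have h5 : 2 * (ip L (u s) (proj L m (w s)) - l2Norm L (proj L m (w s)) ^ 2) ≤ F ^ 2 / 2 := by
      nlinarith [sq_nonneg (F - 2 * l2Norm L (proj L m (w s)))]
    have h6 := mul_le_mul_of_nonneg_left h5 hμ
    nlinarith

end

/-! ### The difference estimate in `L²` -/

namespace KdVPair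

variable {L γ μ : ℝ} {m : ℕ} {J : Set ℝ} {u w ru rw : ℝ → ℝ → ℝ}

theorem abs_ip_deriv_mul_le (h : KdVPair L γ μ m J u w ru rw) (hL : 0 < L) {s U : ℝ} (hs : s ∈ J)
    (hU : ∀ x, |deriv (u s) x| ≤ U) :
    |ip L (deriv (u s)) ((w s - u s) * (w s - u s))| ≤ U * l2Norm L (w s - u s) ^ 2 := by
  have hp := (h.mem hL hs).perC1
  have hc := (h.fst_mem s hs).perC1.continuous_deriv
  rw [← ip_mul_assoc]
  refine (abs_ip_le hL (hp.isL2.mul_continuous hc) hp.isL2).trans ?_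
  have := mul_le_mul_of_nonneg_right (l2Norm_mul_le hL hp.isL2 hc hU)
    (l2Norm_nonneg L (w s - u s))
  nlinarith

/-- Control of the difference by low modes and the `H¹` norm. -/
theorem sq_le_of_low_modes (h : KdVPair L γ μ m univ u w ru rw) (hL : 0 < L) (hγ : 0 < γ)
    {U D₁ P : ℝ} {N : ℕ} (hU : ∀ s x, |deriv (u s) x| ≤ U)
    (hb : BddAbove (range fun s => ip L (w s - u s) (w s - u s)))
    (hD₁ : ∀ s, l2Norm L (deriv (w s - u s)) ≤ D₁)
    (hP : ∀ s, U * l2Norm L (proj L N (w s - u s)) ^ 2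
      ≤ 2 * μ * l2Norm L (proj L m (w s - u s)) ^ 2 + P) (s : ℝ) :
    l2Norm L (w s - u s) ^ 2
      ≤ (P + U * (L / (2 * Real.pi * (N + 1))) ^ 2 * D₁ ^ 2) / (2 * γ) := by
  have hU0 : 0 ≤ U := (abs_nonneg _).trans (hU 0 0)
  -- `P` allows for what the low modes contribute beyond the nudging. It is zero when `N = m` and
  -- the nudging dominates, and of order `τ²` for time shifts, where `μ = 0` and `N` is free.
  have hle := le_of_forall_hasDerivAt_le (show 0 < 2 * γ by positivity)
    (fun s => h.hasDerivAt_l2 hL (mem_univ s))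
    (B := P + U * (L / (2 * Real.pi * (N + 1))) ^ 2 * D₁ ^ 2) (fun s => ?_) hb s
  · rwa [← l2Norm_sq hL] at hle
  · have h1 := (neg_le_abs _).trans (h.abs_ip_deriv_mul_le hL (mem_univ s) (hU s))
    have hd := h.mem hL (mem_univ s)
    have h2 := mul_le_mul_of_nonneg_left (l2Norm_sq_le_proj hL hd.perC1 hd.mean_zero N) hU0
    have h3 : l2Norm L (deriv (w s - u s)) ^ 2 ≤ D₁ ^ 2 :=
      pow_le_pow_left₀ (l2Norm_nonneg _ _) (hD₁ s) 2
    have h4 := mul_le_mul_of_nonneg_left h3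
      (mul_nonneg hU0 (sq_nonneg (L / (2 * Real.pi * (N + 1)))))
    have h5 := hP s
    nlinarith

end KdVPair

/-! ### Lower bounds for the bounding expressions -/

section

variable {L γ R c ε μ : ℝ} {m : ℕ} {f : ℝ → ℝ}

theorem supNorm_nonneg (L : ℝ) (f : ℝ → ℝ) : 0 ≤ supNorm L f :=
  Real.sSup_nonneg (by rintro _ ⟨x, _, rfl⟩; exact abs_nonneg _)

/-- With `α = 1` the last summand is `μ ^ 0`, which equals one at `μ = 0` too. So `R₀` does not
depend on `μ`, and a lower bound for `C₃⁰` by `R₀` is a lower bound by the same constant that is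
used for positive `μ`. -/
theorem boundData_R0 : (boundData L γ (4 * R) c ε f).R0 μ = l2Norm L f / γ + 4 * R + 1 := by
  simp [BoundData.R0, boundData]

theorem one_le_boundData_R0 (hγ : 0 < γ) (hR : 0 < R) :
    1 ≤ (boundData L γ (4 * R) c ε f).R0 μ := by
  rw [boundData_R0]
  have : 0 ≤ l2Norm L f / γ := div_nonneg (l2Norm_nonneg _ _) hγ.le
  linarith

/-- The summand with `(γ + μ) R₀^(10/3)` alone contributes `2 R₀^(10/3)` to `R₁²`, and `R₀ ≥ 1`. -/
theorem boundData_R0_le_R1 (hγ : 0 < γ) (hR : 0 < R) (hc : 0 ≤ c) (hε : 0 ≤ ε) (hμ : 0 ≤ μ) :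
    (boundData L γ (4 * R) c ε f).R0 μ ≤ (boundData L γ (4 * R) c ε f).R1 μ := by
  have h1 := one_le_boundData_R0 (L := L) (c := c) (ε := ε) (μ := μ) (f := f) hγ hR
  set D := boundData L γ (4 * R) c ε f with hD
  refine Real.le_sqrt_of_sq_le ?_
  have e1 : D.γ = γ := rfl
  have e2 : D.ρ = 4 * R := rfl
  have e3 : 0 ≤ D.fH2 := h2Norm_nonneg L f
  have e4 : 0 ≤ D.c * D.ε := mul_nonneg hc hε
  rw [e1, e2]
  have hpow : D.R0 μ ^ 2 ≤ D.R0 μ ^ (10 / 3 : ℝ) := by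
    rw [← Real.rpow_natCast]
    exact Real.rpow_le_rpow_of_exponent_le h1 (by norm_num)
  have h0 : 0 ≤ D.R0 μ := zero_le_one.trans h1
  have t1 : 0 ≤ 2 / (γ + μ) * ((D.fH2 + μ * (4 * R)) * D.R0 μ ^ 2
      + (2 * D.fH2 + 2 * μ * (4 * R)) * D.R0 μ + D.c * D.ε * D.R0 μ ^ 6 + μ ^ D.β) := by
    positivity
  have t2 : 0 ≤ 2 / (γ + μ) * ((γ + μ) ^ (4 / 3 : ℝ) / γ ^ (1 / 3 : ℝ) * D.R0 μ ^ (10 / 3 : ℝ)) := by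
    positivity
  have t3 : 2 / (γ + μ) * ((γ + μ) * D.R0 μ ^ (10 / 3 : ℝ)) = 2 * D.R0 μ ^ (10 / 3 : ℝ) := by
    field_simp
  have t4 : 0 ≤ D.R0 μ ^ (10 / 3 : ℝ) := by positivity
  rw [add_mul, mul_add, t3]
  linarith

/-- The square of the first summand of `C₁` contributes `(5/4) R₀³ R₁` to `R₂²`, and `R₁ ≥ R₀`. -/
theorem sq_boundData_R0_le_R2 (hγ : 0 < γ) (hR : 0 < R) (hc : 0 ≤ c) (hε : 0 ≤ ε) (hμ : 0 ≤ μ) :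
    (boundData L γ (4 * R) c ε f).R0 μ ^ 2 ≤ (boundData L γ (4 * R) c ε f).R2 μ := by
  have h1 := one_le_boundData_R0 (L := L) (c := c) (ε := ε) (μ := μ) (f := f) hγ hR
  have h2 := boundData_R0_le_R1 (L := L) (f := f) hγ hR hc hε hμ
  set D := boundData L γ (4 * R) c ε f with hD
  refine Real.le_sqrt_of_sq_le ?_
  have h0 : 0 ≤ D.R0 μ := zero_le_one.trans h1
  have h0' : 0 ≤ D.R1 μ := h0.trans h2
  have e0 : 0 < D.γ := hγ
  have e1 : 0 ≤ D.fH2 + μ * D.ρ := add_nonneg (h2Norm_nonneg L f) (mul_nonneg hμ (by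
    change 0 ≤ 4 * R; linarith))
  have e2 : 0 ≤ D.fInf + μ * D.ρ := add_nonneg (supNorm_nonneg L f) (mul_nonneg hμ (by
    change 0 ≤ 4 * R; linarith))
  have e4 : 0 ≤ D.ε * D.c := mul_nonneg hε hc
  have hC1 : 3 * D.γ * D.R0 μ ^ (3 / 2 : ℝ) * D.R1 μ ^ (1 / 2 : ℝ) ≤ D.C1 μ (D.R1 μ) := by
    rw [BoundData.C1]
    have : 0 ≤ 3 * (D.fInf + μ * D.ρ) * D.R0 μ
      + 9 / 2 * μ * D.R0 μ ^ (3 / 2 : ℝ) * D.R1 μ ^ (1 / 2 : ℝ)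
      + 18 / 5 * (D.fH2 + μ * D.ρ) + 6 * (D.fH2 + μ * D.ρ) * D.R0 μ := by positivity
    linarith
  have hC2 : 0 ≤ D.C2 μ (D.R1 μ) := by
    rw [BoundData.C2]; positivity
  have hp1 : (D.R0 μ ^ (3 / 2 : ℝ)) ^ 2 = D.R0 μ ^ 3 := by
    rw [← Real.rpow_natCast, ← Real.rpow_mul h0, ← Real.rpow_natCast]; norm_num
  have hp2 : (D.R1 μ ^ (1 / 2 : ℝ)) ^ 2 = D.R1 μ := by
    rw [← Real.sqrt_eq_rpow, Real.sq_sqrt h0']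
  have hsq := pow_le_pow_left₀ (by positivity) hC1 2
  have hlow : 5 / 4 * (D.R0 μ ^ 3 * D.R1 μ) ≤ 5 / (36 * D.γ ^ 2) * D.C1 μ (D.R1 μ) ^ 2 := by
    have h3 := mul_le_mul_of_nonneg_left hsq (show 0 ≤ 5 / (36 * D.γ ^ 2) by positivity)
    refine le_trans (le_of_eq ?_) h3
    rw [mul_pow, mul_pow, hp1, hp2]; field_simp; ring
  have hr : 0 ≤ 1 / D.γ * D.C2 μ (D.R1 μ) + D.ε * D.c * D.R0 μ ^ (22 / 3 : ℝ) / D.γ := by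
    positivity
  have hr' : 0 ≤ 45 / 64 * D.R0 μ ^ 3 * D.R1 μ := by positivity
  have h4 : D.R0 μ ^ 3 * D.R0 μ ≤ D.R0 μ ^ 3 * D.R1 μ := by gcongr
  have h5 : 0 ≤ D.R0 μ ^ 3 * D.R1 μ := by positivity
  calc (D.R0 μ ^ 2) ^ 2 = D.R0 μ ^ 3 * D.R0 μ := by ring
    _ ≤ _ := by linarith

theorem boundData_R0_le_C3 (hγ : 0 < γ) (hR : 0 < R) (hc : 0 ≤ c) (hε : 0 ≤ ε) (hμ : 0 ≤ μ) :
    (boundData L γ (4 * R) c ε f).R0 μ ≤ (boundData L γ (4 * R) c ε f).C3 μ := by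
  have h1 := one_le_boundData_R0 (L := L) (c := c) (ε := ε) (μ := μ) (f := f) hγ hR
  have h2 := boundData_R0_le_R1 (L := L) (f := f) hγ hR hc hε hμ
  have h3 := sq_boundData_R0_le_R2 (L := L) (f := f) hγ hR hc hε hμ
  set D := boundData L γ (4 * R) c ε f
  have h0 : 0 ≤ D.R0 μ := zero_le_one.trans h1
  have h4 : D.R0 μ ≤ D.R2 μ := by nlinarith
  rw [BoundData.C3, ← Real.sqrt_eq_rpow, ← Real.sqrt_eq_rpow, ← Real.sqrt_mul (h0.trans h2)]
  refine Real.le_sqrt_of_sq_le ?_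
  rw [pow_two]
  exact mul_le_mul h2 h4 h0 (h0.trans h2)

/-- Since `C₃⁰ ≥ R₀`, the nudging is stronger than the constant `a` in which the norms of `u`, in
particular `|u_x|_∞`, are measured later. -/
theorem le_of_condition3 (hγ : 0 < γ) (hR : 0 < R) (hc : 0 ≤ c) (hε : 0 ≤ ε)
    (h : (boundData L γ (4 * R) c ε f).Condition3' μ) : l2Norm L f / γ + 4 * R + 1 ≤ μ := by
  have := boundData_R0_le_C3 (L := L) (f := f) hγ hR hc hε le_rfl
  rw [boundData_R0] at this
  exact this.trans h

/-- Insert `C₃ ≥ a` and `R' ≥ R₂ + (γ + μ) R₀ ≥ a² + (γ + μ) a`, and drop the nonnegative term with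
`R_∞`. After division by `8γ⁶` and powers of the bracket, the outcome says that the factor in the
high-mode part of the `L²` estimate is at most `p⁴`, with the `p` of `closing_estimate`. -/
theorem le_of_condition4 (hγ : 0 < γ) (hR : 0 < R) (hc : 0 ≤ c) (hε : 0 ≤ ε) (hμ : 0 ≤ μ)
    (h : (boundData L γ (4 * R) c ε f).Condition4 μ m) {a : ℝ}
    (ha : a = l2Norm L f / γ + 4 * R + 1) :
    a * (L / (2 * Real.pi * (m + 1))) ^ 2 * (2 * (a ^ 2 + (γ + μ) * a) ^ 4) ≤ γ ^ 5 := by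
  have h1 := one_le_boundData_R0 (L := L) (c := c) (ε := ε) (μ := μ) (f := f) hγ hR
  have h2 := boundData_R0_le_R1 (L := L) (f := f) hγ hR hc hε hμ
  have h3 := sq_boundData_R0_le_R2 (L := L) (f := f) hγ hR hc hε hμ
  have h4 := boundData_R0_le_C3 (L := L) (f := f) hγ hR hc hε hμ
  have ha' : (boundData L γ (4 * R) c ε f).R0 μ = a := by rw [boundData_R0, ha]
  unfold BoundData.Condition4 at h
  set D := boundData L γ (4 * R) c ε f
  have e1 : D.γ = γ := rfl
  have e2 : D.L = L := rfl
  have e3 : D.ρ = 4 * R := rfl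
  have e4 : 0 ≤ D.fL2 := l2Norm_nonneg L f
  rw [e1, e2] at h
  rw [ha'] at h1 h2 h3 h4
  have h0 : 0 ≤ a := zero_le_one.trans h1
  have hR1 : 0 ≤ D.R1 μ := h0.trans h2
  have hRinf : 0 ≤ D.Rinf μ := by rw [BoundData.Rinf, ha']; positivity
  have hRp : a ^ 2 + (γ + μ) * a ≤ D.Rprime μ := by
    rw [BoundData.Rprime, ha', e1, e3]
    have : 0 ≤ 1 / 2 * a ^ (3 / 2 : ℝ) * D.R1 μ ^ (1 / 2 : ℝ) := by positivity
    have : 0 ≤ μ * (4 * R) := by positivity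
    linarith
  have hpow : γ ^ (-3 : ℝ) = 1 / γ ^ 3 := by
    rw [Real.rpow_neg hγ.le, one_div]; norm_cast
  rw [hpow] at h
  have hπ := Real.pi_pos
  have hp4 : (a ^ 2 + (γ + μ) * a) ^ 4 ≤ D.Rprime μ ^ 4 :=
    pow_le_pow_left₀ (by positivity) hRp 4
  have hfac : D.C3 μ * L ^ 2 / (8 * Real.pi ^ 2 * (m + 1) ^ 2)
      = D.C3 μ * (L / (2 * Real.pi * (m + 1))) ^ 2 / 2 := by
    field_simp; ring
  rw [hfac] at h
  have hmain : a * (L / (2 * Real.pi * (m + 1))) ^ 2 / 2 * (1 / γ ^ 2)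
      * (2 * (a ^ 2 + (γ + μ) * a) ^ 4 * (1 / γ ^ 3)) ≤ 1 / 2 := by
    have hC3 : 0 ≤ D.C3 μ := h0.trans h4
    have hnn : 0 ≤ (2 * γ + 2 * μ) * D.Rinf μ := by positivity
    have hle : 2 * (a ^ 2 + (γ + μ) * a) ^ 4 * (1 / γ ^ 3) ≤ 2 * D.Rprime μ ^ 4 * (1 / γ ^ 3) := by
      gcongr
    refine le_trans ?_ h
    gcongr
    linarith
  have hγ5 : 0 < γ ^ 5 := by positivity
  have := mul_le_mul_of_nonneg_right hmain (show 0 ≤ 2 * γ ^ 5 by positivity)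
  refine le_trans (le_of_eq ?_) (this.trans (le_of_eq (by ring)))
  field_simp

end

/-- The smallness that closes the `H¹` estimate of the difference. -/
theorem closing_estimate {a γ μ D₀ D₁ d p : ℝ} (ha : 1 ≤ a) (hγ : 0 < γ) (hμ : 0 ≤ μ)
    (hD₀ : 0 ≤ D₀) (hD₁ : 0 ≤ D₁) (hp : p = γ / (2 * (a ^ 2 + (γ + μ) * a)))
    (hdD : d ≤ p * D₁) (hDD : D₀ ≤ p ^ 2 * D₁) (hA : D₀ ≤ a * (2 + μ / γ)) :
    (2 * (a ^ 2 / 2) * d * D₁ + 2 * γ * a * d * D₀ + γ / 3 * (d * D₀ ^ 2)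
        + 2 * μ * ((a / 2 + d / 2) * D₀ ^ 2)) / (2 * γ) + (a / 2 + d / 3) * D₀ ^ 2
      ≤ 3 / 4 * D₁ ^ 2 := by
  have ha0 : 0 < a := by linarith
  have hden : 0 < 2 * (a ^ 2 + (γ + μ) * a) := by positivity
  have hp0 : 0 < p := by rw [hp]; positivity
  set y := 1 + μ / γ with hy
  have hy1 : 1 ≤ y := by have : 0 ≤ μ / γ := by positivity
                         linarith
  -- The denominator of `p` is at least `2a²` and at least `2(γ + μ)a`; this yields `f1` and `f2`.
  -- The other bounds follow from `f2`, as `a` and `y` are at least one.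
  have f1 : a ^ 2 * p ≤ γ / 2 := by
    rw [hp, mul_div_assoc', div_le_div_iff₀ hden (by norm_num)]
    nlinarith [mul_nonneg (mul_nonneg (add_nonneg hγ.le hμ) ha0.le) hγ.le]
  have f2 : a * y * p ≤ 1 / 2 := by
    rw [hp, hy, mul_div_assoc', div_le_div_iff₀ hden (by norm_num)]
    have : a * (1 + μ / γ) * γ = a * (γ + μ) := by field_simp
    rw [this]; nlinarith [sq_nonneg a]
  have f3 : y * p ≤ 1 / 2 := by nlinarith [mul_pos (show 0 < y by linarith) hp0]
  have f4 : a * p ≤ 1 / 2 := by nlinarith [mul_pos ha0 hp0]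
  have f5 : p ≤ 1 / 2 := by nlinarith
  have hA' : D₀ ≤ a * (2 * y) := hA.trans (by gcongr; rw [hy]; linarith [show 0 ≤ μ / γ by positivity])
  have hDsq : 0 ≤ D₁ ^ 2 := sq_nonneg _
  -- the individual terms
  have T1 : a ^ 2 * d * D₁ / (2 * γ) ≤ 1 / 4 * D₁ ^ 2 := by
    rw [div_le_iff₀ (by positivity)]
    calc a ^ 2 * d * D₁ ≤ a ^ 2 * (p * D₁) * D₁ := by gcongr
      _ = (a ^ 2 * p) * D₁ ^ 2 := by ring
      _ ≤ γ / 2 * D₁ ^ 2 := by gcongr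
      _ = _ := by ring
  have T2 : a * d * D₀ ≤ 1 / 8 * D₁ ^ 2 := by
    calc a * d * D₀ ≤ a * (p * D₁) * (p ^ 2 * D₁) := by gcongr
      _ = (a * p) * p * p * D₁ ^ 2 := by ring
      _ ≤ 1 / 2 * (1 / 2) * (1 / 2) * D₁ ^ 2 := by gcongr
      _ = _ := by ring
  -- This term is cubic in the difference. One factor `D₀` is estimated by the a priori bound `hA`,
  -- so that the remaining quadratic expression is comparable with `D₁²`.
  have T3 : 1 / 2 * y * (d * D₀ ^ 2) ≤ 1 / 8 * D₁ ^ 2 := by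
    calc 1 / 2 * y * (d * D₀ ^ 2) = 1 / 2 * y * (d * D₀ * D₀) := by ring
      _ ≤ 1 / 2 * y * ((p * D₁) * (p ^ 2 * D₁) * (a * (2 * y))) := by gcongr
      _ = (a * y * p) * (y * p) * p * D₁ ^ 2 := by ring
      _ ≤ 1 / 2 * (1 / 2) * (1 / 2) * D₁ ^ 2 := by gcongr
      _ = _ := by ring
  have T4 : 1 / 2 * a * y * D₀ ^ 2 ≤ 1 / 8 * D₁ ^ 2 := by
    calc 1 / 2 * a * y * D₀ ^ 2 ≤ 1 / 2 * a * y * (p ^ 2 * D₁) ^ 2 := by gcongr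
      _ = 1 / 2 * (a * y * p) * p * p * p * D₁ ^ 2 := by ring
      _ ≤ 1 / 2 * (1 / 2) * (1 / 2) * (1 / 2) * (1 / 2) * D₁ ^ 2 := by gcongr
      _ ≤ _ := by linarith
  have e : (2 * (a ^ 2 / 2) * d * D₁ + 2 * γ * a * d * D₀ + γ / 3 * (d * D₀ ^ 2)
        + 2 * μ * ((a / 2 + d / 2) * D₀ ^ 2)) / (2 * γ) + (a / 2 + d / 3) * D₀ ^ 2
      = a ^ 2 * d * D₁ / (2 * γ) + a * d * D₀ + 1 / 2 * y * (d * D₀ ^ 2)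
        + 1 / 2 * a * y * D₀ ^ 2 := by
    rw [hy]; field_simp; ring
  rw [e]; linarith

/-! ### Uniqueness for the nudged equation -/

section

variable {L γ μ R : ℝ} {m : ℕ} {f : ℝ → ℝ} {u w : ℝ → ℝ → ℝ}

/-- The nudged equation determines the solution. -/
theorem IsBoundedSolution.eq_of_bound (hL : 0 < L) (hγ : 0 < γ) (hf : IsH2dot L f) (hR : 0 < R)
    {a : ℝ} (ha : a = l2Norm L f / γ + 4 * R + 1) (hμ : a ≤ μ)
    (hm : a * (L / (2 * Real.pi * (m + 1))) ^ 2 * (2 * (a ^ 2 + (γ + μ) * a) ^ 4) ≤ γ ^ 5)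
    (hu : IsKdVSolutionOn L γ f univ u) (hb : ∀ s, h2Norm L (u s) ≤ R)
    (hw : IsBoundedSolution L γ μ m f (fun s => proj L m (u s)) w) : w = u := by
  have hum := fun s => hu.mem s (mem_univ s)
  have hub : BddAbove (range fun s => h2Norm L (u s)) := ⟨R, by rintro _ ⟨s, rfl⟩; exact hb s⟩
  have hF0 : 0 ≤ l2Norm L f / γ := div_nonneg (l2Norm_nonneg _ _) hγ.le
  have huF := hu.l2Norm_le hL hγ hf hub
  have hFf : l2Norm L f = γ * (l2Norm L f / γ) := by field_simp
  set F := l2Norm L f / γ with hF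
  have ha1 : 1 ≤ a := by linarith
  have ha0 : 0 < a := by linarith
  have hμ0 : 0 ≤ μ := ha0.le.trans hμ
  have hp := hw.kdvPair hL hf hu
  have hδm := fun s => hp.mem hL (mem_univ s)
  -- bounds for `u`
  have hux1 : ∀ s, l2Norm L (deriv (u s)) ≤ a / 4 := fun s => by
    have h1 := (hum s).l2Norm_deriv_sq_le hL
    have h2 : l2Norm L (u s) * h2Norm L (u s) ≤ F * R :=
      mul_le_mul (huF s) (hb s) (h2Norm_nonneg _ _) hF0
    refine (le_abs_self _).trans (abs_le_of_sq_le_sq ?_ (by positivity))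
    -- `F R ≤ ((F + 4R)/4)²` by the arithmetic-geometric mean inequality; this is where the factor
    -- four in `ρ = 4R` helps.
    nlinarith [sq_nonneg (F - 4 * R)]
  have huinf : ∀ s x, |u s x| ≤ a / 2 := fun s x => by
    refine abs_le_of_sq_le_sq ?_ (by positivity)
    have h1 := sq_le_l2Norm_mul hL (hum s).perC1 (hum s).mean_zero x
    have h2 : l2Norm L (u s) * l2Norm L (deriv (u s)) ≤ F * (a / 4) :=
      mul_le_mul (huF s) (hux1 s) (l2Norm_nonneg _ _) hF0
    nlinarith
  have huxinf : ∀ s x, |deriv (u s) x| ≤ a / 4 := fun s x => by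
    refine abs_le_of_sq_le_sq ?_ (by positivity)
    have h1 := (hum s).deriv_sq_le hL x
    have h2 : l2Norm L (deriv (u s)) * h2Norm L (u s) ≤ a / 4 * R :=
      mul_le_mul (hux1 s) (hb s) (h2Norm_nonneg _ _) (by positivity)
    nlinarith
  have hflux : ∀ s, l2Norm L (flux (u s)) ≤ a ^ 2 / 2 := fun s => by
    have h1 := l2Norm_sub_le hL (hum s).memLp.neg
      (((hum s).perC1.mul (hum s).perC1).smul (1 / 2)).isL2
    rw [l2Norm_neg, l2Norm_smul, abs_of_pos (by norm_num : (0 : ℝ) < 1 / 2)] at h1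
    have h2 := l2Norm_mul_le hL (hum s).isL2 (hum s).perC1.continuous (huinf s)
    have h3 : a / 2 * l2Norm L (u s) ≤ a / 2 * a := by
      gcongr; linarith [huF s]
    have h4 := hb s
    rw [h2Norm_eq] at h4
    refine h1.trans ?_
    nlinarith
  have hsrc : ∀ s, l2Norm L (γ • u s - f) ≤ 2 * γ * a := fun s => by
    refine (l2Norm_sub_le hL ((hum s).isL2.const_smul γ) hf.isL2).trans ?_
    rw [l2Norm_smul, abs_of_pos hγ, hFf]
    have := mul_le_mul_of_nonneg_left (huF s) hγ.le
    nlinarith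
  -- suprema of the difference
  obtain ⟨M, hM⟩ : ∃ M, ∀ s, h2Norm L (w s - u s) ≤ M := by
    obtain ⟨M, hM⟩ := hw.memY.bounded
    refine ⟨M + R, fun s => (h2Norm_sub_le hL (hw.memY.mem s) (hum s)).trans
      (add_le_add (hM ⟨s, rfl⟩) (hb s))⟩
  have hκ : 0 ≤ L / (2 * Real.pi) := by have := Real.pi_pos; positivity
  have bd0 : BddAbove (range fun s => l2Norm L (w s - u s)) := by
    refine ⟨(L / (2 * Real.pi)) ^ 2 * M, ?_⟩
    rintro _ ⟨s, rfl⟩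
    exact ((hδm s).l2Norm_le hL).trans (mul_le_mul_of_nonneg_left (hM s) (sq_nonneg _))
  have bd1 : BddAbove (range fun s => l2Norm L (deriv (w s - u s))) := by
    refine ⟨L / (2 * Real.pi) * M, ?_⟩
    rintro _ ⟨s, rfl⟩
    exact ((hδm s).l2Norm_deriv_le hL).trans (mul_le_mul_of_nonneg_left (hM s) hκ)
  set D₀ := ⨆ s, l2Norm L (w s - u s) with hD₀
  set D₁ := ⨆ s, l2Norm L (deriv (w s - u s)) with hD₁
  have le0 : ∀ s, l2Norm L (w s - u s) ≤ D₀ := fun s => le_ciSup bd0 s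
  have le1 : ∀ s, l2Norm L (deriv (w s - u s)) ≤ D₁ := fun s => le_ciSup bd1 s
  have nn0 : 0 ≤ D₀ := (l2Norm_nonneg _ _).trans (le0 0)
  have nn1 : 0 ≤ D₁ := (l2Norm_nonneg _ _).trans (le1 0)
  -- A crude bound for the size of the difference, needed only for the cubic terms.
  have hA : D₀ ≤ a * (2 + μ / γ) := by
    refine ciSup_le fun s => ?_
    have h1 := l2Norm_sub_le hL (hw.memY.mem s).isL2 (hum s).isL2
    have h2 := hw.l2Norm_sq_le hL hγ hμ0 hf hu hub s
    rw [← hF] at h2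
    have hx : 0 ≤ μ / γ := by positivity
    have h3 : l2Norm L (w s) ≤ (1 + μ / γ) * F := by
      refine (le_abs_self _).trans (abs_le_of_sq_le_sq (h2.trans ?_) (by positivity))
      rw [mul_pow]
      have : μ / (2 * γ) = μ / γ / 2 := by field_simp
      rw [this]
      gcongr
      nlinarith
    have h4 := huF s
    have h5 : (2 + μ / γ) * F ≤ (2 + μ / γ) * a := by gcongr; linarith
    linarith
  -- the `L²` estimate
  have hL2 : D₀ ^ 2 ≤ a / 4 * (L / (2 * Real.pi * (m + 1))) ^ 2 * D₁ ^ 2 / (2 * γ) := by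
    -- Since `|u_x|_∞ ≤ a/4 ≤ 2μ`, the nudging absorbs all low modes, and `P = 0` is allowed.
    have key := hp.sq_le_of_low_modes hL hγ (N := m) (P := 0) huxinf
      (by
        obtain ⟨B, hB⟩ := bd0
        refine ⟨B ^ 2, ?_⟩
        rintro _ ⟨s, rfl⟩
        simp only
        rw [← l2Norm_sq hL]
        exact pow_le_pow_left₀ (l2Norm_nonneg _ _) (hB ⟨s, rfl⟩) 2) le1
      (fun s => by
        rw [add_zero]
        exact mul_le_mul_of_nonneg_right (by linarith) (sq_nonneg _))
    simp only [zero_add] at key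
    have : D₀ ≤ Real.sqrt (a / 4 * (L / (2 * Real.pi * (m + 1))) ^ 2 * D₁ ^ 2 / (2 * γ)) :=
      ciSup_le fun s => Real.le_sqrt_of_sq_le (key s)
    refine (pow_le_pow_left₀ nn0 this 2).trans (le_of_eq ?_)
    exact Real.sq_sqrt (by positivity)
  -- By `hm` the factor of `D₁²` in `hL2` is at most `p⁴`. So `D₀` is at most `p² D₁`, and Agmon's
  -- inequality bounds the supremum of the difference by `√(D₀ D₁) ≤ p D₁`.
  set p := γ / (2 * (a ^ 2 + (γ + μ) * a)) with hpdef
  have hp0 : 0 < p := by positivity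
  have hDD : D₀ ≤ p ^ 2 * D₁ := by
    refine (le_abs_self _).trans (abs_le_of_sq_le_sq (hL2.trans ?_) (by positivity))
    have hp4 : a / 4 * (L / (2 * Real.pi * (m + 1))) ^ 2 / (2 * γ) ≤ (p ^ 2) ^ 2 := by
      rw [hpdef, ← pow_mul, div_pow γ, div_le_div_iff₀ (by positivity) (by positivity)]
      linear_combination 2 * hm
    rw [mul_pow, mul_div_right_comm]
    exact mul_le_mul_of_nonneg_right hp4 (sq_nonneg _)
  have hd0 : 0 ≤ Real.sqrt (D₀ * D₁) := Real.sqrt_nonneg _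
  have hdx : ∀ s x, |(w s - u s) x| ≤ Real.sqrt (D₀ * D₁) := fun s x => by
    refine abs_le_of_sq_le_sq ?_ hd0
    rw [Real.sq_sqrt (mul_nonneg nn0 nn1)]
    exact (sq_le_l2Norm_mul hL (hδm s).perC1 (hδm s).mean_zero x).trans
      (mul_le_mul (le0 s) (le1 s) (l2Norm_nonneg _ _) nn0)
  have hdD : Real.sqrt (D₀ * D₁) ≤ p * D₁ := by
    rw [Real.sqrt_le_left (by positivity)]
    nlinarith
  have hH1 := hp.deriv_sq_le hL hγ hμ0 hd0 (by positivity) le0 le1 hdx huinf hflux hsrc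
  have hcl := closing_estimate ha1 hγ hμ0 nn0 nn1 hpdef hdD hDD hA
  -- The estimates concern suprema over all times, which are finite as both solutions are bounded in
  -- `H²`; a finite number with this property is zero.
  have hD1 : D₁ ^ 2 ≤ 3 / 4 * D₁ ^ 2 := by
    have : D₁ ≤ Real.sqrt (3 / 4 * D₁ ^ 2) :=
      ciSup_le fun s => Real.le_sqrt_of_sq_le ((hH1 s).trans hcl)
    refine (pow_le_pow_left₀ nn1 this 2).trans (le_of_eq ?_)
    exact Real.sq_sqrt (by positivity)
  have hD10 : D₁ = 0 := by nlinarith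
  funext s
  have h0 : l2Norm L (w s - u s) = 0 := by
    have h1 := le0 s
    have h2 := l2Norm_nonneg L (w s - u s)
    rw [hD10, mul_zero] at hDD
    linarith
  exact sub_eq_zero.1 (eq_zero_of_l2Norm_eq_zero hL (hδm s).perC1 h0)

end

/-! ### Regularity of bounded complete solutions -/

section

variable {L : ℝ} {f g : ℝ → ℝ}

theorem l2Norm_cosMode_le (hL : 0 < L) (k : ℕ) : l2Norm L (cosMode L k) ≤ Real.sqrt L := by
  simpa using l2Norm_le_of_abs_le hL (perC1_cosMode hL k).continuous (B := 1)
    fun x => Real.abs_cos_le_one _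

theorem l2Norm_sinMode_le (hL : 0 < L) (k : ℕ) : l2Norm L (sinMode L k) ≤ Real.sqrt L := by
  simpa using l2Norm_le_of_abs_le hL (perC1_sinMode hL k).continuous (B := 1)
    fun x => Real.abs_sin_le_one _

theorem abs_cosCoef_le (hL : 0 < L) (hf : IsL2 L f) (k : ℕ) :
    |cosCoef L k f| ≤ l2Norm L f * Real.sqrt L :=
  (abs_ip_le hL hf (isL2_cosMode L k)).trans
    (mul_le_mul_of_nonneg_left (l2Norm_cosMode_le hL k) (l2Norm_nonneg _ _))

theorem abs_sinCoef_le (hL : 0 < L) (hf : IsL2 L f) (k : ℕ) :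
    |sinCoef L k f| ≤ l2Norm L f * Real.sqrt L :=
  (abs_ip_le hL hf (isL2_sinMode L k)).trans
    (mul_le_mul_of_nonneg_left (l2Norm_sinMode_le hL k) (l2Norm_nonneg _ _))

theorem PerAC.waveNum_mul_abs_cosCoef_le (hL : 0 < L) (hf : PerAC L f) (hd : IsL2 L (deriv f))
    (k : ℕ) : waveNum L k * |cosCoef L k f| ≤ l2Norm L (deriv f) * Real.sqrt L := by
  have h := abs_sinCoef_le hL hd k
  rwa [sinCoef_deriv hL hf, abs_neg, abs_mul, abs_of_nonneg (waveNum_nonneg hL k)] at h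

theorem PerAC.waveNum_mul_abs_sinCoef_le (hL : 0 < L) (hf : PerAC L f) (hd : IsL2 L (deriv f))
    (k : ℕ) : waveNum L k * |sinCoef L k f| ≤ l2Norm L (deriv f) * Real.sqrt L := by
  have h := abs_cosCoef_le hL hd k
  rwa [cosCoef_deriv hL hf, abs_mul, abs_of_nonneg (waveNum_nonneg hL k)] at h

/-- Bernstein's inequality. -/
theorem l2Norm_proj_deriv_le (hL : 0 < L) (hf : PerAC L f) (N : ℕ) :
    l2Norm L (proj L N (deriv f)) ≤ waveNum L N * l2Norm L (proj L N f) := by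
  refine l2Norm_le_of_sq_le hL (mul_nonneg (waveNum_nonneg hL N) (l2Norm_nonneg _ _)) ?_
  rw [mul_pow, l2Norm_sq hL, ip_proj_proj hL, ip_proj_proj hL, Finset.mul_sum]
  refine Finset.sum_le_sum fun k hk => ?_
  rw [cosCoef_deriv hL hf, sinCoef_deriv hL hf]
  have h1 : waveNum L (k + 1) ^ 2 ≤ waveNum L N ^ 2 :=
    pow_le_pow_left₀ (waveNum_nonneg hL _) (waveNum_mono hL (Finset.mem_range.1 hk)) 2
  have h2 : 0 ≤ 2 / L * (cosCoef L (k + 1) f ^ 2 + sinCoef L (k + 1) f ^ 2) := by positivity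
  nlinarith [mul_le_mul_of_nonneg_right h1 h2]

/-- With `d = √(D₀ D₁)` every term on the right has fewer than two powers of `D₁`, so Young's
inequality absorbs them. It turns the `H¹` estimate into a bound of `sup |δ_x|` by `sup |δ|`. -/
theorem young_absorb {D₀ D₁ d β c e : ℝ} (hc : 0 ≤ c) (hd2 : d ^ 2 = D₀ * D₁)
    (h : D₁ ^ 2 ≤ β * d * D₁ + c * d * D₀ + e * D₀ ^ 2) :
    D₁ ^ 2 ≤ 2 * (8 * β ^ 4 + c ^ 2 / 4 + c / 2 + e) * D₀ ^ 2 := by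
  have h1 : β * d * D₁ ≤ 1 / 8 * D₁ ^ 2 + 2 * β ^ 2 * (D₀ * D₁) := by
    rw [← hd2]; nlinarith [sq_nonneg (D₁ - 4 * (β * d))]
  have h2 : 2 * β ^ 2 * (D₀ * D₁) ≤ 1 / 8 * D₁ ^ 2 + 8 * β ^ 4 * D₀ ^ 2 := by
    nlinarith [sq_nonneg (D₁ - 8 * β ^ 2 * D₀)]
  have h3 : c * d * D₀ ≤ c / 2 * (D₀ * D₁) + c / 2 * D₀ ^ 2 := by
    rw [← hd2]; nlinarith [mul_nonneg hc (sq_nonneg (d - D₀))]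
  have h4 : c / 2 * (D₀ * D₁) ≤ 1 / 4 * D₁ ^ 2 + c ^ 2 / 4 * D₀ ^ 2 := by
    nlinarith [sq_nonneg (D₁ - c * D₀)]
  linarith

theorem exists_high_mode (L : ℝ) {A B : ℝ} (hB : 0 < B) :
    ∃ N : ℕ, A * (L / (2 * Real.pi * (N + 1))) ^ 2 ≤ B := by
  have h : Tendsto (fun N : ℕ => A * (L / (2 * Real.pi) * (1 / ((N : ℝ) + 1))) ^ 2) atTop (𝓝 0) := by
    simpa using ((tendsto_one_div_add_atTop_nhds_zero_nat.const_mul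
      (L / (2 * Real.pi))).pow 2).const_mul A
  obtain ⟨N, hN⟩ := (h.eventually (gt_mem_nhds hB)).exists
  refine ⟨N, le_of_eq_of_le ?_ hN.le⟩
  congr 2
  rw [div_mul_div_comm, mul_one]

end

section

variable {L γ M : ℝ} {f : ℝ → ℝ} {u w : ℝ → ℝ → ℝ}

theorem IsKdVSolutionOn.shift (hu : IsKdVSolutionOn L γ f univ u) (τ : ℝ) :
    IsKdVSolutionOn L γ f univ (fun s => u (s + τ)) where
  mem s _ := hu.mem _ (mem_univ _)
  continuous s _ := by
    have h := hu.continuous (s + τ) (mem_univ _)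
    rw [nhdsWithin_univ] at h ⊢
    exact h.comp ((continuous_add_const τ).tendsto s)
  solves φ hφ hp s _ := by
    have h := (hu.solves φ hφ hp (s + τ) (mem_univ _)).hasDerivAt univ_mem
    exact (h.comp_add_const s τ).hasDerivWithinAt

/-- Bounds in terms of the `H²` norm that are used for bounded complete solutions. -/
theorem exists_bounds (hL : 0 < L) (γ : ℝ) (hf : IsH2dot L f) (M : ℝ) (hM : 0 ≤ M) :
    ∃ B, 0 < B ∧ ∀ u, IsH2dot L u → h2Norm L u ≤ M →
      l2Norm L u ≤ B ∧ l2Norm L (deriv u) ≤ B ∧ (∀ x, |u x| ≤ B) ∧ (∀ x, |deriv u x| ≤ B) ∧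
      l2Norm L (flux u) ≤ B ∧ l2Norm L (γ • u - f) ≤ B ∧
      l2Norm L (deriv (u * deriv u)) ≤ B ∧ IsL2 L (deriv (u * deriv u)) := by
  have hκ : 0 ≤ L / (2 * Real.pi) := by have := Real.pi_pos; positivity
  set κ := L / (2 * Real.pi)
  set S := Real.sqrt (κ ^ 3)
  have hS : 0 ≤ S := Real.sqrt_nonneg _
  have hfn := l2Norm_nonneg L f
  refine ⟨1 + κ ^ 2 * M + κ * M + S * M + (κ + 1) * M + (M + 1 / 2 * (S * M * (κ ^ 2 * M)))
    + (|γ| * (κ ^ 2 * M) + l2Norm L f) + ((κ + 1) * M * (κ * M) + S * M * M), by positivity,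
    fun u hu hb => ?_⟩
  have a1 : l2Norm L u ≤ κ ^ 2 * M :=
    (hu.l2Norm_le hL).trans (mul_le_mul_of_nonneg_left hb (sq_nonneg _))
  have a2 : l2Norm L (deriv u) ≤ κ * M :=
    (hu.l2Norm_deriv_le hL).trans (mul_le_mul_of_nonneg_left hb hκ)
  have a3 : ∀ x, |u x| ≤ S * M := fun x => (hu.abs_le hL x).trans (mul_le_mul_of_nonneg_left hb hS)
  have a4 : ∀ x, |deriv u x| ≤ (κ + 1) * M := fun x => by
    refine abs_le_of_sq_le_sq ((hu.deriv_sq_le hL x).trans ?_) (by positivity)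
    have := mul_le_mul a2 hb (h2Norm_nonneg _ _) (by positivity)
    nlinarith [mul_nonneg hκ (sq_nonneg M), sq_nonneg (κ * M), sq_nonneg M]
  have a5 : l2Norm L (flux u) ≤ M + 1 / 2 * (S * M * (κ ^ 2 * M)) := by
    refine (l2Norm_sub_le hL hu.memLp.neg ((hu.perC1.mul hu.perC1).smul (1 / 2)).isL2).trans ?_
    rw [l2Norm_neg, l2Norm_smul, abs_of_pos (by norm_num : (0 : ℝ) < 1 / 2)]
    have h1 := l2Norm_mul_le hL hu.isL2 hu.perC1.continuous a3
    have h2 : S * M * l2Norm L u ≤ S * M * (κ ^ 2 * M) := by gcongr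
    have h3 : l2Norm L (deriv (deriv u)) ≤ M := hb
    linarith
  have a6 : l2Norm L (γ • u - f) ≤ |γ| * (κ ^ 2 * M) + l2Norm L f := by
    refine (l2Norm_sub_le hL (hu.isL2.const_smul γ) hf.isL2).trans ?_
    rw [l2Norm_smul]
    gcongr
  have e : deriv (u * deriv u) =ᵐ[volume.restrict (Ioc 0 L)]
      deriv u * deriv u + u * deriv (deriv u) := by
    rw [EventuallyEq, ae_restrict_iff' measurableSet_Ioc]
    filter_upwards [hu.absolutelyContinuous.ae_differentiableAt] with x h1 hx
    have hx' : x ∈ uIcc 0 L := by rw [uIcc_of_le hL.le]; exact Ioc_subset_Icc_self hx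
    exact _root_.deriv_mul (hu.perC1.differentiable x) (h1 hx')
  have q1 : IsL2 L (deriv u * deriv u) := hu.deriv_isL2.mul_continuous hu.perC1.continuous_deriv
  have q2 : IsL2 L (u * deriv (deriv u)) := IsL2.mul_continuous hu.memLp hu.perC1.continuous
  have a7 : l2Norm L (deriv (u * deriv u)) ≤ (κ + 1) * M * (κ * M) + S * M * M := by
    rw [l2Norm_congr hL e]
    refine (l2Norm_add_le hL q1 q2).trans (add_le_add ?_ ?_)
    · exact (l2Norm_mul_le hL hu.deriv_isL2 hu.perC1.continuous_deriv a4).trans (by gcongr)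
    · refine (l2Norm_mul_le hL hu.memLp hu.perC1.continuous a3).trans ?_
      exact mul_le_mul_of_nonneg_left hb (by positivity)
  have p1 : 0 ≤ κ ^ 2 * M := by positivity
  have p2 : 0 ≤ κ * M := by positivity
  have p3 : 0 ≤ S * M := by positivity
  have p4 : 0 ≤ S * M * (κ ^ 2 * M) := by positivity
  have p5 : 0 ≤ |γ| * (κ ^ 2 * M) := by positivity
  have p6 : 0 ≤ (κ + 1) * M * (κ * M) := by positivity
  have p7 : 0 ≤ S * M * M := by positivity
  have p8 : 0 ≤ (κ + 1) * M := by positivity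
  refine ⟨by linarith, by linarith, fun x => (a3 x).trans (by linarith),
    fun x => (a4 x).trans (by linarith), by linarith, by linarith, by linarith,
    (q1.add q2).ae_eq e.symm⟩

/-- Bounded complete solutions are Lipschitz continuous in time with values in `H¹`. -/
theorem exists_lipschitz_H1 (hL : 0 < L) (hγ : 0 < γ) (hf : IsH2dot L f) (hM : 0 ≤ M) :
    ∃ C, 0 ≤ C ∧ ∀ u, IsKdVSolutionOn L γ f univ u → (∀ s, h2Norm L (u s) ≤ M) →
      ∀ τ s, l2Norm L (deriv (u (s + τ) - u s)) ≤ C * |τ| := by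
  obtain ⟨B, hB0, hB⟩ := exists_bounds hL γ hf M hM
  set K := 2 * (8 * (B / γ) ^ 4 + (B / (2 * γ) + B) ^ 2 / 4 + (B / (2 * γ) + B) / 2 + B) with hK
  have hK0 : 0 < K := by positivity
  -- `N` is so large that the high modes, once `D₁² ≤ K D₀²` is inserted, use up at most half of the
  -- damping `2γ`.
  obtain ⟨N, hN⟩ := exists_high_mode L (A := B * K) hγ
  set P := B * (B * (waveNum L N + 1)) ^ 2 with hP
  have hwn := waveNum_nonneg hL N
  refine ⟨Real.sqrt (K * (P / γ)), Real.sqrt_nonneg _, fun u hu hb τ => ?_⟩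
  have hum := fun s => hu.mem s (mem_univ s)
  have hw := hu.shift τ
  have hp := hu.kdvPair hL hf isOpen_univ hw
  have hδm : ∀ s, IsH2dot L (u (s + τ) - u s) := fun s => hp.mem hL (mem_univ s)
  have hu0 := fun s => (hB (u s) (hum s) (hb s)).1
  have hu1 := fun s => (hB (u s) (hum s) (hb s)).2.1
  have huinf := fun s => (hB (u s) (hum s) (hb s)).2.2.1
  have hux := fun s => (hB (u s) (hum s) (hb s)).2.2.2.1
  have hfl := fun s => (hB (u s) (hum s) (hb s)).2.2.2.2.1
  have hsr := fun s => (hB (u s) (hum s) (hb s)).2.2.2.2.2.1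
  have r0 : ∀ s, l2Norm L (u (s + τ) - u s) ≤ 2 * B := fun s => by
    have := l2Norm_sub_le hL (hum (s + τ)).isL2 (hum s).isL2
    linarith [hu0 s, hu0 (s + τ)]
  have r1 : ∀ s, l2Norm L (deriv (u (s + τ) - u s)) ≤ 2 * B := fun s => by
    rw [(hum (s + τ)).perC1.deriv_sub (hum s).perC1]
    have := l2Norm_sub_le hL (hum (s + τ)).deriv_isL2 (hum s).deriv_isL2
    linarith [hu1 s, hu1 (s + τ)]
  have bd0 : BddAbove (range fun s => l2Norm L (u (s + τ) - u s)) :=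
    ⟨2 * B, by rintro _ ⟨s, rfl⟩; exact r0 s⟩
  have bd1 : BddAbove (range fun s => l2Norm L (deriv (u (s + τ) - u s))) :=
    ⟨2 * B, by rintro _ ⟨s, rfl⟩; exact r1 s⟩
  set D₀ := ⨆ s, l2Norm L (u (s + τ) - u s) with hD₀
  set D₁ := ⨆ s, l2Norm L (deriv (u (s + τ) - u s)) with hD₁
  have le0 : ∀ s, l2Norm L (u (s + τ) - u s) ≤ D₀ := fun s => le_ciSup bd0 s
  have le1 : ∀ s, l2Norm L (deriv (u (s + τ) - u s)) ≤ D₁ := fun s => le_ciSup bd1 s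
  have nn0 : 0 ≤ D₀ := (l2Norm_nonneg _ _).trans (le0 0)
  have nn1 : 0 ≤ D₁ := (l2Norm_nonneg _ _).trans (le1 0)
  have hD0B : D₀ ≤ 2 * B := ciSup_le r0
  have sup_sq : ∀ {F : ℝ → ℝ} {Y : ℝ}, (∀ s, 0 ≤ F s) → (∀ s, F s ^ 2 ≤ Y) →
      (⨆ s, F s) ^ 2 ≤ Y := fun {F Y} hF hY => by
    have hY0 : 0 ≤ Y := (sq_nonneg _).trans (hY 0)
    have h1 : (⨆ s, F s) ≤ Real.sqrt Y := ciSup_le fun s => Real.le_sqrt_of_sq_le (hY s)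
    refine (pow_le_pow_left₀ (Real.iSup_nonneg hF) h1 2).trans (le_of_eq (Real.sq_sqrt hY0))
  have hd0 : 0 ≤ Real.sqrt (D₀ * D₁) := Real.sqrt_nonneg _
  have hd2 : Real.sqrt (D₀ * D₁) ^ 2 = D₀ * D₁ := Real.sq_sqrt (mul_nonneg nn0 nn1)
  have hdx : ∀ s x, |(u (s + τ) - u s) x| ≤ Real.sqrt (D₀ * D₁) := fun s x => by
    refine abs_le_of_sq_le_sq ?_ hd0
    rw [hd2]
    exact (sq_le_l2Norm_mul hL (hδm s).perC1 (hδm s).mean_zero x).trans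
      (mul_le_mul (le0 s) (le1 s) (l2Norm_nonneg _ _) nn0)
  have hH1 : D₁ ^ 2 ≤ K * D₀ ^ 2 := by
    have h1 := sup_sq (fun s => l2Norm_nonneg L (deriv (u (s + τ) - u s)))
      (hp.deriv_sq_le hL hγ le_rfl hd0 hB0.le le0 le1 hdx huinf hfl hsr)
    refine young_absorb (β := B / γ) (c := B / (2 * γ) + B) (e := B) (by positivity) hd2
      (h1.trans ?_)
    -- The bound `D₀ ≤ 2B` turns the cubic terms into quadratic ones, which keeps the estimate
    -- homogeneous and hence linear in `|τ|`.
    have h2 : Real.sqrt (D₀ * D₁) * D₀ * D₀ ≤ Real.sqrt (D₀ * D₁) * D₀ * (2 * B) := by gcongr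
    have e1 : (2 * B * Real.sqrt (D₀ * D₁) * D₁ + B * Real.sqrt (D₀ * D₁) * D₀
        + γ / 3 * (Real.sqrt (D₀ * D₁) * D₀ ^ 2)
        + 2 * 0 * ((B + Real.sqrt (D₀ * D₁) / 2) * D₀ ^ 2)) / (2 * γ)
        + (B + Real.sqrt (D₀ * D₁) / 3) * D₀ ^ 2
        = B / γ * Real.sqrt (D₀ * D₁) * D₁ + B / (2 * γ) * Real.sqrt (D₀ * D₁) * D₀
          + 1 / 2 * (Real.sqrt (D₀ * D₁) * D₀ * D₀) + B * D₀ ^ 2 := by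
      field_simp; ring
    rw [e1]
    linarith
  -- The equation is tested with the low modes of the difference themselves. Bernstein's inequality
  -- bounds the derivative of this test function, and one factor of its norm cancels.
  have hlow : ∀ s, l2Norm L (proj L N (u (s + τ) - u s)) ≤ B * (waveNum L N + 1) * |τ| := fun s => by
    have hE := hu.weakEvol hL hf isOpen_univ
    have h1 := hE.abs_ip_sub_le hL convex_univ subset_rfl (C := B) (fun t _ => ⟨hfl t, hsr t⟩)
      (mem_univ s) (mem_univ (s + τ)) (perC1_proj hL N (u (s + τ) - u s))
    rw [ip_self_proj hL (hδm s).isL2, deriv_proj hL (hδm s).perC1.perAC, add_sub_cancel_left] at h1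
    have h2 := l2Norm_proj_deriv_le hL (hδm s).perC1.perAC N
    set X := l2Norm L (proj L N (u (s + τ) - u s)) with hX
    have hX0 : 0 ≤ X := l2Norm_nonneg _ _
    have h3 : X ^ 2 ≤ B * (waveNum L N * X + X) * |τ| :=
      (le_abs_self _).trans (h1.trans (by gcongr))
    rcases hX0.eq_or_lt with h | h
    · rw [← h]; positivity
    · nlinarith
  have hL2 : D₀ ^ 2 ≤ P / γ * τ ^ 2 := by
    have key := hp.sq_le_of_low_modes hL hγ (N := N) (P := P * τ ^ 2) hux
      (by
        refine ⟨(2 * B) ^ 2, ?_⟩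
        rintro _ ⟨s, rfl⟩
        simp only
        rw [← l2Norm_sq hL]
        exact pow_le_pow_left₀ (l2Norm_nonneg _ _) (r0 s) 2) le1
      (fun s => by
        rw [mul_zero, zero_mul, zero_add, hP, mul_assoc, ← sq_abs τ, ← mul_pow]
        exact mul_le_mul_of_nonneg_left (pow_le_pow_left₀ (l2Norm_nonneg _ _) (hlow s) 2) hB0.le)
    have h1 := sup_sq (fun s => l2Norm_nonneg L (u (s + τ) - u s)) key
    rw [← hD₀, le_div_iff₀ (by positivity)] at h1
    have h2 : B * (L / (2 * Real.pi * (N + 1))) ^ 2 * D₁ ^ 2 ≤ γ * D₀ ^ 2 := by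
      calc _ ≤ B * (L / (2 * Real.pi * (N + 1))) ^ 2 * (K * D₀ ^ 2) := by gcongr
        _ = B * K * (L / (2 * Real.pi * (N + 1))) ^ 2 * D₀ ^ 2 := by ring
        _ ≤ γ * D₀ ^ 2 := by gcongr
    rw [div_mul_eq_mul_div, le_div_iff₀ hγ]
    linarith
  intro s
  refine (le1 s).trans ((le_abs_self _).trans (abs_le_of_sq_le_sq ?_ (by positivity)))
  rw [mul_pow, Real.sq_sqrt (by positivity), sq_abs]
  calc D₁ ^ 2 ≤ K * D₀ ^ 2 := hH1
    _ ≤ K * (P / γ * τ ^ 2) := by gcongr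
    _ = _ := by ring

/-- The Fourier coefficients of bounded complete solutions decay like `k⁻⁴`, uniformly. -/
theorem exists_coef_decay (hL : 0 < L) (hγ : 0 < γ) (hf : IsH2dot L f) (hM : 0 ≤ M) :
    ∃ C, 0 ≤ C ∧ ∀ u, IsKdVSolutionOn L γ f univ u → (∀ s, h2Norm L (u s) ≤ M) →
      ∀ s k, 1 ≤ k → |cosCoef L k (u s)| ≤ C / waveNum L k ^ 4 ∧
        |sinCoef L k (u s)| ≤ C / waveNum L k ^ 4 := by
  -- The equation expresses `ω³` times a coefficient of `u` by the time derivative of a coefficient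
  -- and by coefficients of `u u_x`, `γu` and `f`. The first is `O(1/ω)` because `u` is Lipschitz in
  -- time with values in `H¹`, the others because these functions have square integrable
  -- derivatives. Altogether `ω⁴` is gained.
  obtain ⟨B, hB0, hB⟩ := exists_bounds hL γ hf M hM
  obtain ⟨C, hC0, hC⟩ := exists_lipschitz_H1 hL hγ hf hM
  set Q := Real.sqrt L with hQ
  have hQ0 : 0 ≤ Q := Real.sqrt_nonneg _
  refine ⟨C * Q + B * Q + γ * (B * Q) + l2Norm L (deriv f) * Q, by
    have := l2Norm_nonneg L (deriv f); positivity, fun u hu hb s k hk => ?_⟩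
  have hum := fun s => hu.mem s (mem_univ s)
  have hw := waveNum_pos hL hk
  set ω := waveNum L k with hω
  have hE := hu.weakEvol hL hf isOpen_univ
  have hus := hum s
  obtain ⟨-, hu1, -, -, -, -, hB7, hB8⟩ := hB (u s) hus (hb s)
  have hδm : ∀ t, IsH2dot L (u t - u s) := fun t => (hum t).sub hL hus
  have hlip : ∀ t, l2Norm L (deriv (u t - u s)) ≤ C * |t - s| := fun t => by
    have := hC u hu hb (t - s) s
    rwa [add_sub_cancel] at this
  -- bounds for the time derivatives of the coefficients
  have dc : |ω * sinCoef L k (flux (u s)) - cosCoef L k (γ • u s - f)| ≤ C * Q / ω := by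
    refine (hE.hasDerivAt_cosCoef hL k (mem_univ s)).le_of_lip' (by positivity)
      (Eventually.of_forall fun t => ?_)
    rw [Real.norm_eq_abs, Real.norm_eq_abs, ← cosCoef_sub hL (hum t).isL2 hus.isL2, div_mul_eq_mul_div,
      le_div_iff₀ hw, mul_comm]
    refine ((hδm t).perC1.perAC.waveNum_mul_abs_cosCoef_le hL (hδm t).deriv_isL2 k).trans ?_
    have := mul_le_mul_of_nonneg_right (hlip t) hQ0
    linarith
  have ds : |-(ω * cosCoef L k (flux (u s))) - sinCoef L k (γ • u s - f)| ≤ C * Q / ω := by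
    refine (hE.hasDerivAt_sinCoef hL k (mem_univ s)).le_of_lip' (by positivity)
      (Eventually.of_forall fun t => ?_)
    rw [Real.norm_eq_abs, Real.norm_eq_abs, ← sinCoef_sub hL (hum t).isL2 hus.isL2, div_mul_eq_mul_div,
      le_div_iff₀ hw, mul_comm]
    refine ((hδm t).perC1.perAC.waveNum_mul_abs_sinCoef_le hL (hδm t).deriv_isL2 k).trans ?_
    have := mul_le_mul_of_nonneg_right (hlip t) hQ0
    linarith
  -- the coefficients of the flux
  have hsq := hus.perC1.mul hus.perC1
  have hdsq : deriv (u s * u s) = (2 : ℝ) • (u s * deriv (u s)) := by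
    rw [hus.perC1.deriv_mul hus.perC1]; funext x
    simp only [Pi.add_apply, Pi.mul_apply, Pi.smul_apply, smul_eq_mul]; ring
  have hac : PerAC L (u s * deriv (u s)) :=
    ⟨hus.perC1.perAC.ac.fun_mul hus.absolutelyContinuous, by
      simp only [Pi.mul_apply]; rw [hus.perC1.perAC.bdry, hus.perAC_deriv.bdry]⟩
  have fs : ω * sinCoef L k (flux (u s))
      = ω ^ 3 * sinCoef L k (u s) - cosCoef L k (u s * deriv (u s)) := by
    have e1 := cosCoef_deriv hL hsq.perAC k
    rw [hdsq, cosCoef, ip_smul_left, ← cosCoef] at e1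
    rw [flux, sinCoef_sub hL hus.memLp.neg (hsq.smul _).isL2, sinCoef, ip_neg_left, ← sinCoef,
      sinCoef_deriv hL hus.perAC_deriv, cosCoef_deriv hL hus.perC1.perAC, sinCoef, sinCoef,
      ip_smul_left, ← sinCoef, ← sinCoef, ← hω] 
    rw [← hω] at e1
    linear_combination (1 / 2) * e1
  have fc : ω * cosCoef L k (flux (u s))
      = ω ^ 3 * cosCoef L k (u s) + sinCoef L k (u s * deriv (u s)) := by
    have e1 := sinCoef_deriv hL hsq.perAC k
    rw [hdsq, sinCoef, ip_smul_left, ← sinCoef] at e1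
    rw [flux, cosCoef_sub hL hus.memLp.neg (hsq.smul _).isL2, cosCoef, ip_neg_left, ← cosCoef,
      cosCoef_deriv hL hus.perAC_deriv, sinCoef_deriv hL hus.perC1.perAC, cosCoef, cosCoef,
      ip_smul_left, ← cosCoef, ← cosCoef, ← hω] 
    rw [← hω] at e1
    linear_combination (-1 / 2) * e1
  have g1 := hac.waveNum_mul_abs_cosCoef_le hL hB8 k
  have g2 := hac.waveNum_mul_abs_sinCoef_le hL hB8 k
  have g3 := hus.perC1.perAC.waveNum_mul_abs_cosCoef_le hL hus.deriv_isL2 k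
  have g4 := hus.perC1.perAC.waveNum_mul_abs_sinCoef_le hL hus.deriv_isL2 k
  have g5 := hf.perC1.perAC.waveNum_mul_abs_cosCoef_le hL hf.deriv_isL2 k
  have g6 := hf.perC1.perAC.waveNum_mul_abs_sinCoef_le hL hf.deriv_isL2 k
  have m7 := mul_le_mul_of_nonneg_right hB7 hQ0
  have m1 := mul_le_mul_of_nonneg_right hu1 hQ0
  rw [le_div_iff₀ hw] at dc ds
  have finish : ∀ {X Y Z V W : ℝ}, |W| * ω ≤ C * Q → ω * |Y| ≤ B * Q → ω * |Z| ≤ B * Q →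
      ω * |V| ≤ l2Norm L (deriv f) * Q → |ω ^ 3 * X| ≤ |W| + |Y| + γ * |Z| + |V| →
      |X| ≤ (C * Q + B * Q + γ * (B * Q) + l2Norm L (deriv f) * Q) / ω ^ 4 := by
    intro X Y Z V W hW hY hZ hV hX
    rw [abs_mul, abs_of_pos (by positivity)] at hX
    rw [le_div_iff₀ (by positivity)]
    have h1 := mul_le_mul_of_nonneg_left hX hw.le
    have h2 := mul_le_mul_of_nonneg_left hZ hγ.le
    calc |X| * ω ^ 4 = ω * (ω ^ 3 * |X|) := by ring
      _ ≤ _ := h1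
      _ ≤ _ := by linarith
  rw [fs, cosCoef_sub hL (hus.isL2.const_smul γ) hf.isL2, cosCoef, cosCoef, ip_smul_left,
    ← cosCoef, ← cosCoef] at dc
  rw [fc, sinCoef_sub hL (hus.isL2.const_smul γ) hf.isL2, sinCoef, sinCoef, ip_smul_left,
    ← sinCoef, ← sinCoef] at ds
  have triangle : ∀ a W Y Z V : ℝ, a = W + Y + γ * Z - V ∨ a = -(W + Y + γ * Z - V) →
      |a| ≤ |W| + |Y| + γ * |Z| + |V| := by
    rintro a W Y Z V h
    have h1 : |W + Y + γ * Z - V| ≤ |W| + |Y| + γ * |Z| + |V| := by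
      rw [← abs_of_pos hγ, ← abs_mul, abs_of_pos hγ]
      exact (abs_sub _ _).trans (add_le_add_left (abs_add_three _ _ _) _)
    rcases h with rfl | rfl
    · exact h1
    · rwa [abs_neg]
  constructor
  · exact finish ds (g2.trans m7) (g4.trans m1) g6 (triangle _ _ _ _ _ (.inr (by ring)))
  · exact finish dc (g1.trans m7) (g3.trans m1) g5 (triangle _ _ _ _ _ (.inl (by ring)))

end

/-! ### Trigonometric series -/

section

variable {L C : ℝ} {α β : ℕ → ℝ}

theorem summable_div_waveNum_pow (hL : 0 < L) (C : ℝ) {p : ℕ} (hp : 1 < p) :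
    Summable fun k : ℕ => C / waveNum L (k + 1) ^ p := by
  have h := (((summable_nat_add_iff 1).2 (Real.summable_one_div_nat_pow.2 hp)).mul_left
    (C * (L / (2 * Real.pi)) ^ p))
  refine h.congr fun k => ?_
  have := Real.pi_pos
  have h1 : ((k + 1 : ℕ) : ℝ) ≠ 0 := by positivity
  unfold waveNum
  rw [div_pow, div_pow, mul_pow, mul_pow, mul_pow]
  field_simp

/-- The term of index `k` of a trigonometric series. -/
noncomputable def trigTerm (L : ℝ) (α β : ℕ → ℝ) (k : ℕ) : ℝ → ℝ :=
  fun x => α k * cosMode L (k + 1) x + β k * sinMode L (k + 1) x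

/-- The trigonometric series with coefficients `α` and `β`. -/
noncomputable def trigSeries (L : ℝ) (α β : ℕ → ℝ) : ℝ → ℝ := fun x => ∑' k, trigTerm L α β k x

/-- The coefficients are `O(k⁻ᵖ)`. -/
def CoefDecay (L C : ℝ) (p : ℕ) (α β : ℕ → ℝ) : Prop :=
  ∀ k, |α k| ≤ C / waveNum L (k + 1) ^ p ∧ |β k| ≤ C / waveNum L (k + 1) ^ p

theorem abs_trigTerm_le {p : ℕ} (h : CoefDecay L C p α β) (k : ℕ) (x : ℝ) :
    |trigTerm L α β k x| ≤ 2 * C / waveNum L (k + 1) ^ p := by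
  have h1 : |cosMode L (k + 1) x| ≤ 1 := Real.abs_cos_le_one _
  have h2 : |sinMode L (k + 1) x| ≤ 1 := Real.abs_sin_le_one _
  refine (abs_add_le _ _).trans ?_
  rw [abs_mul, abs_mul, mul_div_assoc, two_mul]
  exact add_le_add ((mul_le_of_le_one_right (abs_nonneg _) h1).trans (h k).1)
    ((mul_le_of_le_one_right (abs_nonneg _) h2).trans (h k).2)

theorem continuous_trigTerm (L : ℝ) (α β : ℕ → ℝ) (k : ℕ) : Continuous (trigTerm L α β k) :=
  (continuous_const.mul (contDiff_cosMode L _ (n := 0)).continuous).add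
    (continuous_const.mul (contDiff_sinMode L _ (n := 0)).continuous)

theorem CoefDecay.deriv_coef (hL : 0 < L) {p : ℕ} (h : CoefDecay L C (p + 1) α β) :
    CoefDecay L C p (fun k => waveNum L (k + 1) * β k) (fun k => -(waveNum L (k + 1) * α k)) := by
  intro k
  have hw := waveNum_pos hL (Nat.le_add_left 1 k)
  have key : ∀ a : ℝ, |a| ≤ C / waveNum L (k + 1) ^ (p + 1) →
      |waveNum L (k + 1) * a| ≤ C / waveNum L (k + 1) ^ p := fun a ha => by
    rw [abs_mul, abs_of_pos hw]
    refine (mul_le_mul_of_nonneg_left ha hw.le).trans (le_of_eq ?_)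
    rw [pow_succ']
    field_simp
  exact ⟨key _ (h k).2, by rw [abs_neg]; exact key _ (h k).1⟩

theorem CoefDecay.summable (hL : 0 < L) {p : ℕ} (hp : 1 < p) (h : CoefDecay L C p α β) (x : ℝ) :
    Summable fun k => trigTerm L α β k x :=
  Summable.of_norm_bounded (summable_div_waveNum_pow hL _ hp) fun k => abs_trigTerm_le h k x

theorem CoefDecay.continuous (hL : 0 < L) {p : ℕ} (hp : 1 < p) (h : CoefDecay L C p α β) :
    Continuous (trigSeries L α β) :=
  continuous_tsum (continuous_trigTerm L α β) (summable_div_waveNum_pow hL _ hp)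
    fun k x => abs_trigTerm_le h k x

theorem hasDerivAt_trigTerm (L : ℝ) (α β : ℕ → ℝ) (k : ℕ) (x : ℝ) :
    HasDerivAt (trigTerm L α β k) (trigTerm L (fun k => waveNum L (k + 1) * β k)
      (fun k => -(waveNum L (k + 1) * α k)) k x) x := by
  refine (((hasDerivAt_cosMode L (k + 1) x).const_mul (α k)).add
    ((hasDerivAt_sinMode L (k + 1) x).const_mul (β k))).congr_deriv ?_
  simp only [trigTerm]; ring

theorem CoefDecay.hasDerivAt_trigSeries (hL : 0 < L) {p : ℕ} (hp : 1 < p)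
    (h : CoefDecay L C (p + 1) α β) (x : ℝ) :
    HasDerivAt (trigSeries L α β) (trigSeries L (fun k => waveNum L (k + 1) * β k)
      (fun k => -(waveNum L (k + 1) * α k)) x) x :=
  hasDerivAt_tsum (summable_div_waveNum_pow hL _ hp) (hasDerivAt_trigTerm L α β)
    (fun k y => abs_trigTerm_le (h.deriv_coef hL) k y) (h.summable hL (by omega) 0) x

theorem periodic_trigSeries (hL : 0 < L) (α β : ℕ → ℝ) :
    Function.Periodic (trigSeries L α β) L := fun x => by
  unfold trigSeries trigTerm
  simp only [periodic_cosMode hL _ x, periodic_sinMode hL _ x]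

/-- Each derivative costs one power of the wave number, and after two of them the decay `k⁻²` is
still summable uniformly in `x`. -/
theorem CoefDecay.contDiff_two (hL : 0 < L) (h : CoefDecay L C 4 α β) :
    ContDiff ℝ 2 (trigSeries L α β) := by
  have d1 : deriv (trigSeries L α β) = _ := funext fun x => (h.hasDerivAt_trigSeries hL (by norm_num) x).deriv
  have h' := h.deriv_coef hL
  have d2 : deriv (trigSeries L _ _) = _ := funext fun x => (h'.hasDerivAt_trigSeries hL (by norm_num) x).deriv
  have c1 : ContDiff ℝ 1 (deriv (trigSeries L α β)) := by
    rw [d1, contDiff_one_iff_deriv, d2]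
    exact ⟨fun x => (h'.hasDerivAt_trigSeries hL (by norm_num) x).differentiableAt,
      (h'.deriv_coef hL).continuous hL (by norm_num)⟩
  rw [show (2 : WithTop ℕ∞) = 1 + 1 by norm_num, contDiff_succ_iff_deriv]
  exact ⟨fun x => (h.hasDerivAt_trigSeries hL (by norm_num) x).differentiableAt,
    fun hω => by simp at hω, c1⟩

/-- Termwise integration by dominated convergence. With a mode for `g`, orthogonality then reads off
the coefficients of the series. -/
theorem CoefDecay.hasSum_ip (hL : 0 < L) (h : CoefDecay L C 4 α β) {g : ℝ → ℝ} (hg : Continuous g)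
    (hg1 : ∀ x, |g x| ≤ 1) :
    HasSum (fun k => α k * ip L (cosMode L (k + 1)) g + β k * ip L (sinMode L (k + 1)) g)
      (ip L (trigSeries L α β) g) := by
  have hs := summable_div_waveNum_pow hL (2 * C) (p := 4) (by norm_num)
  have key := intervalIntegral.hasSum_integral_of_dominated_convergence (a := 0) (b := L)
    (μ := volume) (F := fun k x => trigTerm L α β k x * g x)
    (f := fun x => trigSeries L α β x * g x) (fun k _ => 2 * C / waveNum L (k + 1) ^ 4)
    (fun k => ((continuous_trigTerm L α β k).mul hg).aestronglyMeasurable)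
    (fun k => Eventually.of_forall fun x _ => by
      rw [norm_mul]
      exact (mul_le_of_le_one_right (norm_nonneg _) (hg1 x)).trans (abs_trigTerm_le h k x))
    (Eventually.of_forall fun x _ => hs) intervalIntegrable_const
    (Eventually.of_forall fun x _ => (h.summable hL (by norm_num) x).hasSum.mul_right _)
  convert! key using 2 with k
  have i1 : IntervalIntegrable (fun x => α k * (cosMode L (k + 1) x * g x)) volume 0 L :=
    (continuous_const.mul ((contDiff_cosMode L _ (n := 0)).continuous.mul hg)).intervalIntegrable _ _
  have i2 : IntervalIntegrable (fun x => β k * (sinMode L (k + 1) x * g x)) volume 0 L :=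
    (continuous_const.mul ((contDiff_sinMode L _ (n := 0)).continuous.mul hg)).intervalIntegrable _ _
  rw [ip, ip, ← intervalIntegral.integral_const_mul, ← intervalIntegral.integral_const_mul,
    ← intervalIntegral.integral_add i1 i2]
  refine intervalIntegral.integral_congr fun x _ => ?_
  simp only [trigTerm]; ring

theorem CoefDecay.cosCoef_trigSeries (hL : 0 < L) (h : CoefDecay L C 4 α β) (k : ℕ) :
    cosCoef L (k + 1) (trigSeries L α β) = α k * (L / 2) := by
  have h1 := h.hasSum_ip hL (contDiff_cosMode L (k + 1) (n := 0)).continuous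
    (fun x => Real.abs_cos_le_one _)
  have e : ∀ j, α j * ip L (cosMode L (j + 1)) (cosMode L (k + 1))
      + β j * ip L (sinMode L (j + 1)) (cosMode L (k + 1))
      = if j = k then α k * (L / 2) else 0 := fun j => by
    rw [← cosCoef, ← cosCoef, cosCoef_cosMode hL (Nat.le_add_left 1 j), cosCoef_sinMode hL]
    by_cases hj : j = k
    · simp [hj]
    · simp [hj, Ne.symm hj]
  simp only [e] at h1
  exact h1.unique (hasSum_ite_eq k _)

theorem CoefDecay.sinCoef_trigSeries (hL : 0 < L) (h : CoefDecay L C 4 α β) (k : ℕ) :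
    sinCoef L (k + 1) (trigSeries L α β) = β k * (L / 2) := by
  have h1 := h.hasSum_ip hL (contDiff_sinMode L (k + 1) (n := 0)).continuous
    (fun x => Real.abs_sin_le_one _)
  have e : ∀ j, α j * ip L (cosMode L (j + 1)) (sinMode L (k + 1))
      + β j * ip L (sinMode L (j + 1)) (sinMode L (k + 1))
      = if j = k then β k * (L / 2) else 0 := fun j => by
    rw [← sinCoef, ← sinCoef, sinCoef_sinMode hL (Nat.le_add_left 1 j), sinCoef_cosMode hL]
    by_cases hj : j = k
    · simp [hj]
    · simp [hj, Ne.symm hj]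
  simp only [e] at h1
  exact h1.unique (hasSum_ite_eq k _)

theorem CoefDecay.contDiff_deriv (hL : 0 < L) (h : CoefDecay L C 4 α β) :
    ContDiff ℝ 1 (deriv (trigSeries L α β)) :=
  (contDiff_succ_iff_deriv.1 (show ContDiff ℝ (1 + 1) (trigSeries L α β) by
    simpa [one_add_one_eq_two] using h.contDiff_two hL)).2.2

theorem CoefDecay.isH2dot (hL : 0 < L) (h : CoefDecay L C 4 α β) : IsH2dot L (trigSeries L α β) where
  periodic := periodic_trigSeries hL α β
  mean_zero := by
    have h1 := h.hasSum_ip hL (g := fun _ => 1) continuous_const (by simp)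
    have e : ∀ k, α k * ip L (cosMode L (k + 1)) (fun _ => 1)
        + β k * ip L (sinMode L (k + 1)) (fun _ => 1) = 0 := fun k => by
      simp [ip, integral_cosMode hL (Nat.le_add_left 1 k), integral_sinMode hL]
    simp only [e] at h1
    simpa [ip] using h1.unique hasSum_zero
  contDiff := (h.contDiff_two hL).of_le (by norm_num)
  absolutelyContinuous := (h.contDiff_deriv hL).contDiffOn.absolutelyContinuousOnInterval
  memLp := ((h.contDiff_deriv hL).continuous_deriv le_rfl).isL2

/-- Every sequence of coefficients that decays like `k⁻⁴` belongs to an `H²` function. -/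
theorem exists_isH2dot_of_coef (hL : 0 < L) {a b : ℕ → ℝ}
    (h : ∀ k, 1 ≤ k → |a k| ≤ C / waveNum L k ^ 4 ∧ |b k| ≤ C / waveNum L k ^ 4) :
    ∃ U, IsH2dot L U ∧ ∀ k, 1 ≤ k → cosCoef L k U = a k ∧ sinCoef L k U = b k := by
  have hd : CoefDecay L (2 / L * C) 4 (fun k => 2 / L * a (k + 1)) (fun k => 2 / L * b (k + 1)) := by
    intro k
    have h1 := h (k + 1) (Nat.le_add_left 1 k)
    have h2 : 0 < 2 / L := by positivity
    rw [abs_mul, abs_mul, abs_of_pos h2, mul_div_assoc]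
    exact ⟨mul_le_mul_of_nonneg_left h1.1 h2.le, mul_le_mul_of_nonneg_left h1.2 h2.le⟩
  refine ⟨_, hd.isH2dot hL, fun k hk => ?_⟩
  obtain ⟨j, rfl⟩ : ∃ j, k = j + 1 := ⟨k - 1, by omega⟩
  rw [hd.cosCoef_trigSeries hL, hd.sinCoef_trigSeries hL]
  constructor <;> field_simp

theorem IsH2dot.hasSum_h2Norm_sq (hL : 0 < L) {u : ℝ → ℝ} (hu : IsH2dot L u) :
    HasSum (fun k : ℕ => 2 / L * waveNum L (k + 1) ^ 4
      * (cosCoef L (k + 1) u ^ 2 + sinCoef L (k + 1) u ^ 2)) (h2Norm L u ^ 2) := by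
  have h := hasSum_sq_coef_of_mean_zero hL hu.memLp hu.perAC_deriv.integral_deriv
  rw [h2Norm_eq, l2Norm_sq hL]
  convert! h using 2 with k
  rw [cosCoef_deriv hL hu.perAC_deriv, sinCoef_deriv hL hu.perAC_deriv,
    cosCoef_deriv hL hu.perC1.perAC, sinCoef_deriv hL hu.perC1.perAC]
  ring

/-- Convergence of the coefficients under a uniform decay implies convergence in `H²`. -/
theorem tendsto_h2Norm_of_coef (hL : 0 < L) {ι : Type*} {l : Filter ι} {u : ι → ℝ → ℝ} {U : ℝ → ℝ}
    (hu : ∀ i, IsH2dot L (u i)) (hU : IsH2dot L U)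
    (hC : ∀ i k, 1 ≤ k → |cosCoef L k (u i)| ≤ C / waveNum L k ^ 4 ∧
      |sinCoef L k (u i)| ≤ C / waveNum L k ^ 4)
    (hCU : ∀ k, 1 ≤ k → |cosCoef L k U| ≤ C / waveNum L k ^ 4 ∧
      |sinCoef L k U| ≤ C / waveNum L k ^ 4)
    (hlim : ∀ k, 1 ≤ k → Tendsto (fun i => cosCoef L k (u i)) l (𝓝 (cosCoef L k U)) ∧
      Tendsto (fun i => sinCoef L k (u i)) l (𝓝 (sinCoef L k U))) :
    Tendsto (fun i => h2Norm L (u i - U)) l (𝓝 0) := by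
  have hsum : ∀ i, ∑' k : ℕ, 2 / L * waveNum L (k + 1) ^ 4
      * ((cosCoef L (k + 1) (u i) - cosCoef L (k + 1) U) ^ 2
        + (sinCoef L (k + 1) (u i) - sinCoef L (k + 1) U) ^ 2) = h2Norm L (u i - U) ^ 2 := fun i => by
    rw [← ((hu i).sub hL hU).hasSum_h2Norm_sq hL |>.tsum_eq]
    simp only [cosCoef_sub hL (hu i).isL2 hU.isL2, sinCoef_sub hL (hu i).isL2 hU.isL2]
  have key : Tendsto (fun i => h2Norm L (u i - U) ^ 2) l (𝓝 (∑' _ : ℕ, (0 : ℝ))) := by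
    simp only [← hsum]
    -- The weight `ω⁴` of the `H²` norm meets squared coefficients of order `ω⁻⁸`, so the majorant
    -- is of order `ω⁻⁴`. The factor is `16 = 2 · (4 + 4)`.
    refine tendsto_tsum_of_dominated_convergence
      (bound := fun k : ℕ => 16 * C ^ 2 / L / waveNum L (k + 1) ^ 4)
      (summable_div_waveNum_pow hL _ (by norm_num)) (fun k => ?_)
      (Eventually.of_forall fun i k => ?_)
    · obtain ⟨h1, h2⟩ := hlim (k + 1) (Nat.le_add_left 1 k)
      simpa using (((h1.sub_const (cosCoef L (k + 1) U)).pow 2).add ((h2.sub_const (sinCoef L (k + 1) U)).pow 2)).const_mul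
        (2 / L * waveNum L (k + 1) ^ 4)
    · have hk : 1 ≤ k + 1 := Nat.le_add_left 1 k
      have hw := waveNum_pos hL hk
      set ω := waveNum L (k + 1)
      have sq : ∀ a b : ℝ, |a| ≤ C / ω ^ 4 → |b| ≤ C / ω ^ 4 → (a - b) ^ 2 ≤ 4 * (C / ω ^ 4) ^ 2 :=
        fun a b ha hb => by
          have h1 : |a - b| ≤ 2 * (C / ω ^ 4) := (abs_sub _ _).trans (by linarith)
          rw [← sq_abs]
          exact (pow_le_pow_left₀ (abs_nonneg _) h1 2).trans (le_of_eq (by ring))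
      rw [Real.norm_of_nonneg (by positivity)]
      have h1 := sq _ _ (hC i _ hk).1 (hCU _ hk).1
      have h2 := sq _ _ (hC i _ hk).2 (hCU _ hk).2
      calc _ ≤ 2 / L * ω ^ 4 * (4 * (C / ω ^ 4) ^ 2 + 4 * (C / ω ^ 4) ^ 2) := by gcongr
        _ = _ := by field_simp; ring
  rw [tsum_zero] at key
  have h := (Real.continuous_sqrt.tendsto 0).comp key
  rw [Real.sqrt_zero] at h
  exact h.congr fun i => Real.sqrt_sq (h2Norm_nonneg _ _)

end

/-! ### Continuous dependence and limits of bounded complete solutions -/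

section

variable {L γ M : ℝ} {f : ℝ → ℝ} {u w : ℝ → ℝ → ℝ}

/-- Grönwall's inequality in both time directions: limits of complete solutions have to be taken at
negative times as well. -/
theorem le_exp_mul_of_abs_deriv_le {φ φ' : ℝ → ℝ} {K : ℝ} (h : ∀ t, HasDerivAt φ (φ' t) t)
    (hK : ∀ t, |φ' t| ≤ K * φ t) (t : ℝ) : φ t ≤ Real.exp (K * |t|) * φ 0 := by
  have he : ∀ c s, HasDerivAt (fun t => Real.exp (c * t) * φ t)
      (Real.exp (c * s) * (c * φ s + φ' s)) s := fun c s => by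
    refine ((((hasDerivAt_id s).const_mul c).exp).mul (h s)).congr_deriv ?_
    simp only [id]; ring
  rcases le_total 0 t with ht | ht
  · have ha : Antitone fun t => Real.exp (-K * t) * φ t :=
      antitone_of_deriv_nonpos (fun s => (he _ s).differentiableAt) fun s => by
        rw [(he _ s).deriv]
        exact mul_nonpos_of_nonneg_of_nonpos (Real.exp_nonneg _)
          (by linarith [le_abs_self (φ' s), hK s])
    have h1 := mul_le_mul_of_nonneg_left (ha ht) (Real.exp_nonneg (K * t))
    simp only [mul_zero, Real.exp_zero, one_mul] at h1
    rw [← mul_assoc, ← Real.exp_add, neg_mul, add_neg_cancel, Real.exp_zero, one_mul] at h1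
    rwa [abs_of_nonneg ht]
  · have ha : Monotone fun t => Real.exp (K * t) * φ t :=
      monotone_of_deriv_nonneg (fun s => (he _ s).differentiableAt) fun s => by
        rw [(he _ s).deriv]
        exact mul_nonneg (Real.exp_nonneg _) (by linarith [neg_abs_le (φ' s), hK s])
    have h1 := mul_le_mul_of_nonneg_left (ha ht) (Real.exp_nonneg (-(K * t)))
    simp only [mul_zero, Real.exp_zero, one_mul] at h1
    rw [← mul_assoc, ← Real.exp_add, neg_add_cancel, Real.exp_zero, one_mul,
      ← mul_neg] at h1
    rwa [abs_of_nonpos ht]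

theorem IsKdVSolutionOn.l2Norm_sub_le_exp (hL : 0 < L) (hγ : 0 < γ) (hf : IsH2dot L f)
    (hu : IsKdVSolutionOn L γ f univ u) (hw : IsKdVSolutionOn L γ f univ w) {U : ℝ}
    (hU : ∀ s x, |deriv (u s) x| ≤ U) (t : ℝ) :
    l2Norm L (w t - u t) ≤ Real.exp ((U + 2 * γ) * |t|) * l2Norm L (w 0 - u 0) := by
  have hp := hu.kdvPair hL hf isOpen_univ hw
  have hU0 : 0 ≤ U := (abs_nonneg _).trans (hU 0 0)
  have h1 := le_exp_mul_of_abs_deriv_le (K := U + 2 * γ)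
    (fun s => hp.hasDerivAt_l2 hL (mem_univ s)) (fun s => by
      have h1 := hp.abs_ip_deriv_mul_le hL (mem_univ s) (hU s)
      rw [l2Norm_sq hL] at h1
      have h2 : 0 ≤ ip L (w s - u s) (w s - u s) := by rw [← l2Norm_sq hL]; positivity
      rw [abs_le] at h1 ⊢
      constructor <;> nlinarith) t
  rw [← l2Norm_sq hL, ← l2Norm_sq hL] at h1
  refine le_of_sq_le_sq ?_ (by have := l2Norm_nonneg L (w 0 - u 0); positivity)
  rw [mul_pow]
  refine h1.trans (mul_le_mul_of_nonneg_right ?_ (sq_nonneg _))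
  -- The exponential is replaced by its square, which is cruder than necessary but keeps the
  -- exponent free of a factor one half.
  rw [pow_two]
  exact le_mul_of_one_le_left (Real.exp_nonneg _) (Real.one_le_exp (by positivity))

/-- Forward uniqueness. -/
theorem IsKdVSolutionOn.eq_of_eq_zero (hL : 0 < L) (hγ : 0 < γ) (hf : IsH2dot L f)
    (hu : IsKdVSolutionOn L γ f (Ici 0) u) (hw : IsKdVSolutionOn L γ f (Ici 0) w) {U : ℝ}
    (hU : ∀ s x, |deriv (u s) x| ≤ U) (h0 : w 0 = u 0) {t : ℝ} (ht : 0 ≤ t) : w t = u t := by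
  have hp := (hu.mono Ioi_subset_Ici_self).kdvPair hL hf isOpen_Ioi (hw.mono Ioi_subset_Ici_self)
  have hm : ∀ s ∈ Ici (0 : ℝ), IsH2dot L (w s - u s) := fun s hs => (hw.mem s hs).sub hL (hu.mem s hs)
  -- The energy law holds on the open half-line only; continuity up to zero connects it with the
  -- initial value.
  have hc : ContinuousOn (fun t => ip L (w t - u t) (w t - u t)) (Ici 0) := fun s hs => by
    have c : ∀ {v}, IsKdVSolutionOn L γ f (Ici 0) v → TendstoH1 L (𝓝[Ici 0] s) v (v s) := fun hv =>
      tendstoH1_of_h2Norm hL (eventually_mem_nhdsWithin.mono fun t ht => hv.mem t ht) (hv.mem s hs)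
        (hv.continuous s hs)
    have h1 := ((c hw).add hL ((c hu).smul hL (-1))).congr (χ := fun t => w t - u t)
      (χ₀ := w s - u s) (fun t => by simp [sub_eq_add_neg]) (by simp [sub_eq_add_neg])
    have hev : ∀ᶠ t in 𝓝[Ici 0] s, IsL2 L (w t - u t) :=
      eventually_mem_nhdsWithin.mono fun t ht => (hm t ht).isL2
    exact tendsto_ip hL (hm s hs).isL2 (hm s hs).isL2 hev hev (h1.l2 hL) (h1.l2 hL)
  have hd : ∀ s ∈ Ioi (0 : ℝ), HasDerivAt
      (fun t => Real.exp (-U * t) * ip L (w t - u t) (w t - u t)) _ s := fun s hs =>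
    (((hasDerivAt_id s).const_mul (-U)).exp).mul (hp.hasDerivAt_l2 hL hs)
  have ha : AntitoneOn (fun t => Real.exp (-U * t) * ip L (w t - u t) (w t - u t)) (Ici 0) := by
    refine antitoneOn_of_deriv_nonpos (convex_Ici 0)
      ((by fun_prop : Continuous fun t : ℝ => Real.exp (-U * t)).continuousOn.mul hc) ?_ ?_
    · rw [interior_Ici]
      exact fun s hs => (hd s hs).differentiableAt.differentiableWithinAt
    · rw [interior_Ici]
      intro s hs
      rw [(hd s hs).deriv]
      have h1 := (neg_le_abs _).trans (hp.abs_ip_deriv_mul_le hL hs (hU s))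
      have h2 : 0 ≤ ip L (w s - u s) (w s - u s) := by rw [← l2Norm_sq hL]; positivity
      rw [l2Norm_sq hL] at h1
      have h3 := mul_nonneg hγ.le h2
      have h4 := Real.exp_nonneg (-U * s)
      simp only [id]
      nlinarith
  have h1 := ha self_mem_Ici ht ht
  simp only [h0, sub_self] at h1
  have e : ip L (0 : ℝ → ℝ) 0 = 0 := by simp [ip]
  rw [e, mul_zero, ← l2Norm_sq hL] at h1
  have h2 : l2Norm L (w t - u t) = 0 := by
    have h3 := Real.exp_pos (-U * t)
    have h4 := nonpos_of_mul_nonpos_right h1 h3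
    exact pow_eq_zero_iff two_ne_zero |>.1 (le_antisymm h4 (sq_nonneg _))
  have h3 := eq_zero_of_l2Norm_eq_zero hL (hm t ht).perC1 h2
  exact sub_eq_zero.1 h3

/-- The pointwise limit of bounded complete solutions that converge in `L²`, locally uniformly in
time, is a solution. -/
theorem solvesOn_of_tendsto (hL : 0 < L) (hγ : 0 < γ) (hf : IsH2dot L f) {u : ℕ → ℝ → ℝ → ℝ}
    {U : ℝ → ℝ → ℝ} (hu : ∀ n, IsKdVSolutionOn L γ f univ (u n)) (hU : ∀ t, IsH2dot L (U t)) {B : ℝ}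
    (hB : ∀ n t x, |u n t x| ≤ B) (hBU : ∀ t x, |U t x| ≤ B) {d : ℕ → ℝ} (hd : Tendsto d atTop (𝓝 0))
    {K : ℝ} (hK : 0 ≤ K) (h : ∀ n t, l2Norm L (u n t - U t) ≤ Real.exp (K * |t|) * d n) :
    SolvesOn L γ (fun _ => f) univ U := by
  intro φ hφ hp s _
  rw [hasDerivWithinAt_univ]
  have hB0 : 0 ≤ B := (abs_nonneg _).trans (hBU 0 0)
  have hum := fun n t => (hu n).mem t (mem_univ t)
  have p0 : PerC1 L φ := ⟨hφ.of_le (by exact_mod_cast le_top), hp⟩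
  have hφ1 : ContDiff ℝ (⊤ : ℕ∞) (deriv φ) := (contDiff_infty_iff_deriv.1 hφ).2
  have hφ2 : ContDiff ℝ (⊤ : ℕ∞) (deriv (deriv φ)) := (contDiff_infty_iff_deriv.1 hφ1).2
  have p1 : PerC1 L (deriv φ) := ⟨hφ1.of_le (by exact_mod_cast le_top), hp.deriv'⟩
  have p2 : PerC1 L (deriv (deriv φ)) := ⟨hφ2.of_le (by exact_mod_cast le_top), hp.deriv'.deriv'⟩
  set Q := B * l2Norm L (deriv φ) + l2Norm L (deriv (deriv (deriv φ))) + γ * l2Norm L φ with hQ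
  have n0 := l2Norm_nonneg L φ
  have n1 := l2Norm_nonneg L (deriv φ)
  have n3 := l2Norm_nonneg L (deriv (deriv (deriv φ)))
  have hQ0 : 0 ≤ Q := by positivity
  have key : ∀ n t, |(∫ x in (0 : ℝ)..L,
        (u n t x ^ 2 / 2 * deriv φ x + u n t x * iteratedDeriv 3 φ x
          - γ * u n t x * φ x + f x * φ x)) - (∫ x in (0 : ℝ)..L,
        (U t x ^ 2 / 2 * deriv φ x + U t x * iteratedDeriv 3 φ x
          - γ * U t x * φ x + f x * φ x))| ≤ Q * l2Norm L (u n t - U t) := fun n t => by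
    have a := (hum n t).perC1
    have b := (hU t).perC1
    have hδ := (a.sub b).isL2
    rw [integral_test_eq hL γ a hf.isL2 p0 p1 p2, integral_test_eq hL γ b hf.isL2 p0 p1 p2]
    have hs1 : IsL2 L ((u n t + U t) * deriv φ) := ((a.add b).mul p1).isL2
    have e1 : ip L (u n t * u n t) (deriv φ) - ip L (U t * U t) (deriv φ)
        = ip L (u n t - U t) ((u n t + U t) * deriv φ) := by
      rw [← ip_sub_left hL (a.mul a).isL2 (b.mul b).isL2 p1.isL2, ip, ip]
      congr 1; funext x; simp only [Pi.sub_apply, Pi.mul_apply, Pi.add_apply]; ring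
    have e2 := ip_sub_left hL a.isL2 b.isL2 p2.deriv_isL2
    have e3 := ip_sub_left hL a.isL2 b.isL2 p0.isL2
    have b1 := abs_ip_le hL hδ hs1
    have b1' : l2Norm L ((u n t + U t) * deriv φ) ≤ 2 * B * l2Norm L (deriv φ) :=
      l2Norm_mul_le hL p1.isL2 (a.add b).continuous fun x =>
        (abs_add_le _ _).trans (by linarith [hB n t x, hBU t x])
    have b2 := abs_ip_le hL hδ p2.deriv_isL2
    have b3 := abs_ip_le hL hδ p0.isL2
    have b1'' := mul_le_mul_of_nonneg_left b1' (l2Norm_nonneg L (u n t - U t))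
    have b3' := mul_le_mul_of_nonneg_left b3 hγ.le
    have e : 1 / 2 * ip L (u n t * u n t) (deriv φ) + ip L (u n t) (deriv (deriv (deriv φ)))
        - γ * ip L (u n t) φ + ip L f φ - (1 / 2 * ip L (U t * U t) (deriv φ)
          + ip L (U t) (deriv (deriv (deriv φ))) - γ * ip L (U t) φ + ip L f φ)
        = 1 / 2 * ip L (u n t - U t) ((u n t + U t) * deriv φ)
          + ip L (u n t - U t) (deriv (deriv (deriv φ))) - γ * ip L (u n t - U t) φ := by
      rw [← e1, e2, e3]; ring
    rw [e]
    refine (abs_sub _ _).trans ((add_le_add (abs_add_le _ _) le_rfl).trans ?_)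
    rw [abs_mul, abs_mul, abs_of_pos hγ, abs_of_pos (by norm_num : (0 : ℝ) < 1 / 2)]
    rw [hQ]
    linarith
  have hlim0 : ∀ c : ℝ, Tendsto (fun n => c * d n) atTop (𝓝 0) := fun c => by
    simpa using hd.const_mul c
  -- On a ball of radius one about `s` the factor `exp (K |t|)` is bounded, so the time derivatives
  -- converge uniformly there.
  refine hasDerivAt_of_tendstoUniformlyOn (l := atTop) (Metric.isOpen_ball (x := s) (ε := 1))
    (f := fun n t => ∫ x in (0 : ℝ)..L, u n t x * φ x)
    (f' := fun n t => ∫ x in (0 : ℝ)..L,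
        (u n t x ^ 2 / 2 * deriv φ x + u n t x * iteratedDeriv 3 φ x
          - γ * u n t x * φ x + f x * φ x)) ?_ ?_ ?_ (Metric.mem_ball_self one_pos)
    (g' := fun t => ∫ x in (0 : ℝ)..L,
        (U t x ^ 2 / 2 * deriv φ x + U t x * iteratedDeriv 3 φ x
          - γ * U t x * φ x + f x * φ x))
  · rw [Metric.tendstoUniformlyOn_iff]
    intro e he
    filter_upwards [(hlim0 (Q * Real.exp (K * (|s| + 1)))).eventually (gt_mem_nhds he),
      Eventually.of_forall fun n => (nonneg_of_mul_nonneg_right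
        ((l2Norm_nonneg L _).trans (h n 0)) (Real.exp_pos _))] with n hn hdn t ht
    rw [Real.dist_eq, abs_sub_comm]
    refine ((key n t).trans ?_).trans_lt hn
    rw [mul_assoc]
    refine mul_le_mul_of_nonneg_left ((h n t).trans ?_) hQ0
    have h1 : |t| ≤ |s| + 1 := by
      rw [Metric.mem_ball, Real.dist_eq] at ht
      have := abs_sub_abs_le_abs_sub t s
      linarith
    exact mul_le_mul_of_nonneg_right (Real.exp_le_exp.2 (mul_le_mul_of_nonneg_left h1 hK)) hdn
  · exact Eventually.of_forall fun n t _ => ((hu n).solves φ hφ hp t (mem_univ t)).hasDerivAt univ_mem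
  · intro t _
    rw [tendsto_iff_dist_tendsto_zero]
    refine squeeze_zero (fun _ => dist_nonneg) (fun n => ?_)
      (hlim0 (l2Norm L φ * Real.exp (K * |t|)))
    rw [Real.dist_eq]
    change |ip L (u n t) φ - ip L (U t) φ| ≤ _
    rw [← ip_sub_left hL (hum n t).isL2 (hU t).isL2 p0.isL2]
    refine (abs_ip_le hL ((hum n t).isL2.sub (hU t).isL2) p0.isL2).trans ?_
    rw [mul_comm, mul_assoc]
    exact mul_le_mul_of_nonneg_left (h n t) n0

end

/-! ### The set of values of bounded complete solutions -/

section

variable {L γ M : ℝ} {f : ℝ → ℝ} {u w : ℝ → ℝ → ℝ}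

/-- The values at time zero of the complete solutions that are bounded by `M` in `H²`. -/
def boundedValues (L γ : ℝ) (f : ℝ → ℝ) (M : ℝ) : Set (ℝ → ℝ) :=
  {a | ∃ u, IsKdVSolutionOn L γ f univ u ∧ (∀ s, h2Norm L (u s) ≤ M) ∧ u 0 = a}

theorem mem_boundedValues (hu : IsKdVSolutionOn L γ f univ u) (hM : ∀ s, h2Norm L (u s) ≤ M) (s : ℝ) :
    u s ∈ boundedValues L γ f M :=
  ⟨_, hu.shift s, fun _ => hM _, by simp⟩

/-- `Flow` admits any solution on the half-line with the given initial value. Forward uniqueness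
identifies it with the complete bounded one, which remains in the set; conversely, every value is
reached from the same solution at time `-t`. -/
theorem isInvariantSet_boundedValues (hL : 0 < L) (hγ : 0 < γ) (hf : IsH2dot L f) (hM : 0 ≤ M) :
    IsInvariantSet L γ f (boundedValues L γ f M) := by
  obtain ⟨B, -, hB⟩ := exists_bounds hL γ hf M hM
  intro t ht
  ext b
  constructor
  · rintro ⟨_, ⟨u, hu, hb, rfl⟩, w, hw, h0, rfl⟩
    have h := (hu.mono (subset_univ _)).eq_of_eq_zero hL hγ hf hw
      (fun s x => (hB (u s) (hu.mem s (mem_univ s)) (hb s)).2.2.2.1 x) h0 ht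
    rw [h]
    exact mem_boundedValues hu hb t
  · rintro ⟨u, hu, hb, rfl⟩
    exact ⟨u (-t), mem_boundedValues hu hb (-t), fun s => u (s + -t),
      (hu.shift (-t)).mono (subset_univ _), by simp, by simp⟩

theorem exists_lim_of_dist_le {x b : ℕ → ℝ} (hb : Tendsto b atTop (𝓝 0))
    (h : ∀ i j, |x i - x j| ≤ b i + b j) : ∃ a, Tendsto x atTop (𝓝 a) := by
  refine cauchySeq_tendsto_of_complete (Metric.cauchySeq_iff.2 fun ε hε => ?_)
  obtain ⟨N, hN⟩ := eventually_atTop.1 (hb.eventually (gt_mem_nhds (half_pos hε)))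
  refine ⟨N, fun i hi j hj => ?_⟩
  rw [Real.dist_eq]
  linarith [h i j, hN i hi, hN j hj]

/-- Compactness of a countable product of squares replaces a diagonal argument. -/
theorem exists_subseq_coef {C : ℕ → ℝ} {a b : ℕ → ℕ → ℝ} (h : ∀ n k, |a n k| ≤ C k ∧ |b n k| ≤ C k) :
    ∃ (p q : ℕ → ℝ) (ψ : ℕ → ℕ), StrictMono ψ ∧ ∀ k, Tendsto (fun n => a (ψ n) k) atTop (𝓝 (p k)) ∧
      Tendsto (fun n => b (ψ n) k) atTop (𝓝 (q k)) := by
  have hc : IsCompact (Set.pi univ fun k => Icc (-C k) (C k) ×ˢ Icc (-C k) (C k)) :=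
    isCompact_univ_pi fun k => isCompact_Icc.prod isCompact_Icc
  obtain ⟨z, -, ψ, hψ, hz⟩ := hc.tendsto_subseq (x := fun n k => (a n k, b n k))
    fun n k _ => ⟨abs_le.1 (h n k).1, abs_le.1 (h n k).2⟩
  rw [tendsto_pi_nhds] at hz
  exact ⟨fun k => (z k).1, fun k => (z k).2, ψ, hψ, fun k =>
    ⟨(continuous_fst.tendsto _).comp (hz k), (continuous_snd.tendsto _).comp (hz k)⟩⟩

/-- The uniform decay of the coefficients gives a subsequence that converges in `H²` at time zero.
Continuous dependence carries the convergence to every other time, and the limit curve is again a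
complete solution with the same bound. -/
theorem isCompactH2_boundedValues (hL : 0 < L) (hγ : 0 < γ) (hf : IsH2dot L f) (hM : 0 ≤ M) :
    IsCompactH2 L (boundedValues L γ f M) := by
  refine ⟨?_, fun a ha => ?_⟩
  · rintro _ ⟨u, hu, -, rfl⟩
    exact hu.mem 0 (mem_univ 0)
  choose u hu hb h0 using ha
  obtain rfl : (fun n => u n 0) = a := funext h0
  have hum := fun n t => (hu n).mem t (mem_univ t)
  obtain ⟨B, hB0, hB⟩ := exists_bounds hL γ hf M hM
  obtain ⟨C, hC0, hC⟩ := exists_coef_decay hL hγ hf hM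
  obtain ⟨p, q, ψ, hψ, hpq⟩ := exists_subseq_coef (C := fun k => C / waveNum L (k + 1) ^ 4)
    (a := fun n k => cosCoef L (k + 1) (u n 0)) (b := fun n k => sinCoef L (k + 1) (u n 0))
    fun n k => hC (u n) (hu n) (hb n) 0 (k + 1) (Nat.le_add_left 1 k)
  have hCψ := fun n t k hk => hC (u (ψ n)) (hu (ψ n)) (hb (ψ n)) t k hk
  -- convergence at a given time, once the coefficients converge
  have conv : ∀ t, (∀ k, 1 ≤ k → ∃ c s, Tendsto (fun n => cosCoef L k (u (ψ n) t)) atTop (𝓝 c) ∧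
      Tendsto (fun n => sinCoef L k (u (ψ n) t)) atTop (𝓝 s)) →
      ∃ U, IsH2dot L U ∧ (∀ k, 1 ≤ k → |cosCoef L k U| ≤ C / waveNum L k ^ 4 ∧
        |sinCoef L k U| ≤ C / waveNum L k ^ 4) ∧
        Tendsto (fun n => h2Norm L (u (ψ n) t - U)) atTop (𝓝 0) := by
    intro t ht
    choose! c s hc hs using ht
    have hcs : ∀ k, 1 ≤ k → |c k| ≤ C / waveNum L k ^ 4 ∧ |s k| ≤ C / waveNum L k ^ 4 := fun k hk =>
      ⟨le_of_tendsto' (hc k hk).abs fun n => (hCψ n t k hk).1,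
        le_of_tendsto' (hs k hk).abs fun n => (hCψ n t k hk).2⟩
    obtain ⟨U, hU, hUc⟩ := exists_isH2dot_of_coef hL hcs
    have hCU : ∀ k, 1 ≤ k → |cosCoef L k U| ≤ C / waveNum L k ^ 4 ∧
        |sinCoef L k U| ≤ C / waveNum L k ^ 4 := fun k hk => by
      rw [(hUc k hk).1, (hUc k hk).2]; exact hcs k hk
    exact ⟨U, hU, hCU, tendsto_h2Norm_of_coef hL (fun n => hum _ t) hU (fun n k hk => hCψ n t k hk)
      hCU fun k hk => by rw [(hUc k hk).1, (hUc k hk).2]; exact ⟨hc k hk, hs k hk⟩⟩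
  have l2_of_h2 : ∀ {t U}, IsH2dot L U → Tendsto (fun n => h2Norm L (u (ψ n) t - U)) atTop (𝓝 0) →
      Tendsto (fun n => l2Norm L (u (ψ n) t - U)) atTop (𝓝 0) := fun {t U} hU h =>
    squeeze_zero (fun _ => l2Norm_nonneg _ _) (fun n => ((hum _ t).sub hL hU).l2Norm_le hL)
      (by simpa using h.const_mul ((L / (2 * Real.pi)) ^ 2))
  obtain ⟨U₀, hU₀, -, hlim₀⟩ := conv 0 fun k hk => by
    obtain ⟨j, rfl⟩ : ∃ j, k = j + 1 := ⟨k - 1, by omega⟩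
    exact ⟨_, _, hpq j⟩
  set d : ℕ → ℝ := fun n => l2Norm L (u (ψ n) 0 - U₀) with hd
  have hd0 : Tendsto d atTop (𝓝 0) := l2_of_h2 hU₀ hlim₀
  set K := B + 2 * γ with hK
  have hK0 : 0 ≤ K := by positivity
  -- The subsequence chosen at time zero serves all times: it is Cauchy in `L²` at each `t`, so
  -- every coefficient converges there, and the decay improves this to `H²`.
  have cauchy : ∀ t i j, l2Norm L (u (ψ i) t - u (ψ j) t) ≤ Real.exp (K * |t|) * (d i + d j) := by
    intro t i j
    refine ((hu (ψ j)).l2Norm_sub_le_exp hL hγ hf (hu (ψ i))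
      (fun s x => (hB _ (hum _ s) (hb _ s)).2.2.2.1 x) t).trans
      (mul_le_mul_of_nonneg_left ?_ (Real.exp_nonneg _))
    have e : u (ψ i) 0 - u (ψ j) 0 = (u (ψ i) 0 - U₀) - (u (ψ j) 0 - U₀) := by abel
    rw [e]
    exact l2Norm_sub_le hL ((hum _ 0).isL2.sub hU₀.isL2) ((hum _ 0).isL2.sub hU₀.isL2)
  have limits : ∀ t, ∃ U, IsH2dot L U ∧ (∀ k, 1 ≤ k → |cosCoef L k U| ≤ C / waveNum L k ^ 4 ∧
        |sinCoef L k U| ≤ C / waveNum L k ^ 4) ∧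
        Tendsto (fun n => h2Norm L (u (ψ n) t - U)) atTop (𝓝 0) := fun t => conv t fun k _ => by
    have hbt : Tendsto (fun n => Real.sqrt L * (Real.exp (K * |t|) * d n)) atTop (𝓝 0) := by
      simpa using (hd0.const_mul (Real.exp (K * |t|))).const_mul (Real.sqrt L)
    have bound : ∀ i j, l2Norm L (u (ψ i) t - u (ψ j) t) * Real.sqrt L
        ≤ Real.sqrt L * (Real.exp (K * |t|) * d i) + Real.sqrt L * (Real.exp (K * |t|) * d j) :=
      fun i j => (mul_le_mul_of_nonneg_right (cauchy t i j) (Real.sqrt_nonneg L)).trans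
        (le_of_eq (by ring))
    obtain ⟨c, hc⟩ := exists_lim_of_dist_le hbt fun i j => by
      rw [← cosCoef_sub hL (hum (ψ i) t).isL2 (hum (ψ j) t).isL2]
      exact (abs_cosCoef_le hL ((hum (ψ i) t).isL2.sub (hum (ψ j) t).isL2) k).trans (bound i j)
    obtain ⟨s, hs⟩ := exists_lim_of_dist_le hbt fun i j => by
      rw [← sinCoef_sub hL (hum (ψ i) t).isL2 (hum (ψ j) t).isL2]
      exact (abs_sinCoef_le hL ((hum (ψ i) t).isL2.sub (hum (ψ j) t).isL2) k).trans (bound i j)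
    exact ⟨c, s, hc, hs⟩
  choose U hU hCU hlim using limits
  have hUM : ∀ t, h2Norm L (U t) ≤ M := fun t => by
    refine ge_of_tendsto' (by simpa using (hlim t).const_add M) fun n => ?_
    have h1 := abs_le.1 (abs_h2Norm_sub_le hL (hum (ψ n) t) (hU t))
    linarith [h1.1, hb (ψ n) t]
  have hl2 : ∀ n t, l2Norm L (u (ψ n) t - U t) ≤ Real.exp (K * |t|) * d n := fun n t => by
    have h1 : Tendsto (fun j => Real.exp (K * |t|) * (d n + d j) + l2Norm L (u (ψ j) t - U t)) atTop
        (𝓝 (Real.exp (K * |t|) * d n)) := by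
      simpa using ((hd0.const_add (d n)).const_mul (Real.exp (K * |t|))).add (l2_of_h2 (hU t) (hlim t))
    refine ge_of_tendsto' h1 fun j => ?_
    have e : u (ψ n) t - U t = (u (ψ n) t - u (ψ j) t) + (u (ψ j) t - U t) := by abel
    rw [e]
    exact (l2Norm_add_le hL ((hum _ t).isL2.sub (hum _ t).isL2) ((hum _ t).isL2.sub (hU t).isL2)).trans
      (add_le_add (cauchy t n j) le_rfl)
  have hsolves := solvesOn_of_tendsto hL hγ hf (fun n => hu (ψ n)) hU
    (fun n t x => (hB _ (hum _ t) (hb _ t)).2.2.1 x) (fun t x => (hB _ (hU t) (hUM t)).2.2.1 x)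
    hd0 hK0 hl2
  -- The weak equation makes each coefficient continuous in time; the uniform decay turns this into
  -- continuity in `H²`.
  have hcont : ContinuousH2On L univ U := fun s _ => by
    rw [nhdsWithin_univ]
    refine tendsto_h2Norm_of_coef hL hU (hU s) hCU (hCU s) fun k _ => ⟨?_, ?_⟩
    · exact ((hsolves _ (contDiff_cosMode L k) (periodic_cosMode hL k) s (mem_univ s)).hasDerivAt
        univ_mem).continuousAt
    · exact ((hsolves _ (contDiff_sinMode L k) (periodic_sinMode hL k) s (mem_univ s)).hasDerivAt
        univ_mem).continuousAt
  exact ⟨U 0, ⟨U, ⟨fun t _ => hU t, hcont, hsolves⟩, hUM, rfl⟩, ψ, hψ, hlim 0⟩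

/-- Bounded complete solutions lie in the global attractor. -/
theorem IsKdVSolutionOn.isAttractorTrajectory (hL : 0 < L) (hγ : 0 < γ) (hf : IsH2dot L f)
    (hu : IsKdVSolutionOn L γ f univ u) (hM : ∀ s, h2Norm L (u s) ≤ M) :
    IsAttractorTrajectory L γ f u := by
  have hM0 : 0 ≤ M := (h2Norm_nonneg _ _).trans (hM 0)
  exact ⟨hu, fun s => ⟨_, ⟨isCompactH2_boundedValues hL hγ hf hM0,
    isInvariantSet_boundedValues hL hγ hf hM0⟩, mem_boundedValues hu hM s⟩⟩

end

/-! ### Trajectories in the attractor and the nudged equation -/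

section

variable {L γ μ R : ℝ} {m : ℕ} {f : ℝ → ℝ} {u v w : ℝ → ℝ → ℝ}

theorem proj_mem_trigSpace (L : ℝ) (m : ℕ) (g : ℝ → ℝ) : proj L m g ∈ trigSpace L m := by
  rw [proj_eq]
  refine Submodule.sum_mem _ fun k hk => ?_
  have hk' : k + 1 ≤ m := Finset.mem_range.1 hk
  exact Submodule.add_mem _
    (Submodule.smul_mem _ _ (Submodule.subset_span ⟨k + 1, Nat.le_add_left 1 k, hk', .inl rfl⟩))
    (Submodule.smul_mem _ _ (Submodule.subset_span ⟨k + 1, Nat.le_add_left 1 k, hk', .inr rfl⟩))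

theorem h2Norm_proj_le (hL : 0 < L) {g : ℝ → ℝ} (hg : IsH2dot L g) (m : ℕ) :
    h2Norm L (proj L m g) ≤ h2Norm L g := by
  rw [h2Norm_eq, h2Norm_eq, deriv_proj hL hg.perC1.perAC, deriv_proj hL hg.perAC_deriv]
  exact l2Norm_proj_le hL hg.memLp m

theorem isX_proj (hL : 0 < L) (hu : IsY L u) (m : ℕ) : IsX L m fun s => proj L m (u s) where
  mem s := proj_mem_trigSpace L m (u s)
  continuous s hs := squeeze_zero (fun _ => h2Norm_nonneg _ _) (fun t => by
    rw [← proj_sub hL (hu.mem t).isL2 (hu.mem s).isL2]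
    exact h2Norm_proj_le hL ((hu.mem t).sub hL (hu.mem s)) m) (hu.continuous s hs)
  bounded := by
    obtain ⟨B, hB⟩ := hu.bounded
    refine ⟨B, ?_⟩
    rintro _ ⟨s, rfl⟩
    exact (h2Norm_proj_le hL (hu.mem s) m).trans (hB ⟨s, rfl⟩)

/-- The nudging term vanishes identically, so existence for `v = P_m u` costs nothing. -/
theorem IsKdVSolutionOn.isBoundedSolution (hu : IsKdVSolutionOn L γ f univ u) (μ : ℝ) (m : ℕ)
    (hb : ∀ s, h2Norm L (u s) ≤ R) : IsBoundedSolution L γ μ m f (fun s => proj L m (u s)) u where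
  memY := ⟨fun s => hu.mem s (mem_univ s), hu.continuous, ⟨R, by rintro _ ⟨s, rfl⟩; exact hb s⟩⟩
  solves := by simpa only [sub_self, mul_zero, sub_zero] using hu.solves

/-- The same cancellation in the opposite direction, followed by the membership of complete bounded
solutions in the attractor. -/
theorem IsBoundedSolution.isAttractorTrajectory (hL : 0 < L) (hγ : 0 < γ) (hf : IsH2dot L f)
    (hw : IsBoundedSolution L γ μ m f (fun s => proj L m (w s)) w) :
    IsAttractorTrajectory L γ f w := by
  obtain ⟨B, hB⟩ := hw.memY.bounded
  refine IsKdVSolutionOn.isAttractorTrajectory (M := B) hL hγ hf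
    ⟨fun s _ => hw.memY.mem s, hw.memY.continuous, ?_⟩ fun s => hB ⟨s, rfl⟩
  simpa only [sub_self, mul_zero, sub_zero] using hw.solves

/-- `P_m` does not increase the `H²` norm, and `R < 4R` leaves room for the strict inequality. -/
theorem inXBall_proj (hL : 0 < L) (hR : 0 < R) (hu : IsY L u) (hb : ∀ s, h2Norm L (u s) ≤ R) (m : ℕ) :
    InXBall L m (4 * R) fun s => proj L m (u s) :=
  ⟨isX_proj hL hu m,
    (ciSup_le fun s => (h2Norm_proj_le hL (hu.mem s) m).trans (hb s)).trans_lt (by linarith)⟩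

end

end DampedKdV

theorem theorem3
    (L γ : ℝ) (hL : 0 < L) (hγ : 0 < γ)
    (f : ℝ → ℝ) (hf : IsH2dot L f)
    -- a bound `R` for the trajectories in the global attractor
    (R : ℝ) (hR : 0 < R)
    (hbound : ∀ u, IsAttractorTrajectory L γ f u → ∀ s, h2Norm L (u s) ≤ R)
    (c ε : ℝ) (hc : 0 ≤ c) (hε : 0 ≤ ε)
    (μ : ℝ) (hμ : 0 < μ) (m : ℕ)
    (h1 : (boundData L γ (4 * R) c ε f).Condition1 μ m)
    (h2 : (boundData L γ (4 * R) c ε f).Condition2 μ m)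
    (h3' : (boundData L γ (4 * R) c ε f).Condition3' μ)
    (h4 : (boundData L γ (4 * R) c ε f).Condition4 μ m) :
    -- (1) `W(P_m u) = u` for every trajectory `u` in the global attractor
    (∀ u, IsAttractorTrajectory L γ f u →
      InXBall L m (4 * R) (fun s => proj L m (u s)) ∧
      IsW L γ μ m f (fun s => proj L m (u s)) u) ∧
    -- (2) if `v = P_m w` for a bounded solution `w` that belongs to `v`, then `w` is a trajectory
    -- in the global attractor
    (∀ v w, InXBall L m (4 * R) v → IsBoundedSolution L γ μ m f v w →
      v = (fun s => proj L m (w s)) → IsAttractorTrajectory L γ f w) ∧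
    -- `W(P_m u) = u` exactly for the trajectories in the global attractor
    (∀ u, (InXBall L m (4 * R) (fun s => proj L m (u s)) ∧
        IsW L γ μ m f (fun s => proj L m (u s)) u) ↔
      IsAttractorTrajectory L γ f u) := by
  have part1 : ∀ u, IsAttractorTrajectory L γ f u →
      InXBall L m (4 * R) (fun s => proj L m (u s)) ∧
      IsW L γ μ m f (fun s => proj L m (u s)) u := fun u hu => by
    have hb := hbound u hu
    have hs := hu.1.isBoundedSolution μ m hb
    exact ⟨inXBall_proj hL hR hs.memY hb m, hs, fun w hw =>
      hw.eq_of_bound hL hγ hf hR rfl (le_of_condition3 hγ hR hc hε h3')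
        (le_of_condition4 hγ hR hc hε hμ.le h4 rfl) hu.1 hb⟩
  refine ⟨part1, ?_, fun u => ⟨fun h => h.2.1.isAttractorTrajectory hL hγ hf, part1 u⟩⟩
  rintro v w - hw rfl
  exact hw.isAttractorTrajectory hL hγ hf
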